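/- Let ${\rm Vir}={\rm span}_{\mathbb C}\{z,e_j\mid j\in\mathbb Z\}$ be the Virasoro algebra, with brackets $[e_j,e_k]=(k-j)e_{j+k}+\delta_{k,-j}\frac{j^3-j}{12}z$ and $[z,e_j]=0$, and let $\theta:{\rm Vir}\to\mathbb C[t^{\pm}]$ be the linear map with $\theta(e_j)=t^j$, $\theta(z)=0$. Let $f=\sum_{i=0}^p a_it^i\in\mathbb C[t]$ with $p\ge 0$, $a_p=1$, $a_0\neq 0$, and let $m\ge -1$ be an integer. Put ${\rm Vir}^f=\theta^{-1}(\langle f\rangle)$, where $\langle f\rangle$ is the ideal of $\mathbb C[t^{\pm}]$ generated by $f$, put $\mathfrak b_m={\rm span}\{z,e_j\mid j\ge m\}$ and $\mathfrak b_m^f={\rm Vir}^f\cap\mathfrak b_m$. For a homomorphism $\chi:\mathfrak h\to\mathbb C$ from a subalgebra $\mathfrak h$ of ${\rm Vir}$, let $\mathbb C_\chi$ be the corresponding one-dimensional module and ${\rm Ind}_{\mathfrak h}^{\rm Vir}\mathbb C_\chi=U({\rm Vir})\otimes_{U(\mathfrak h)}\mathbb C_\chi$; write $V^f_\chi$ for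 this module if $\mathfrak h={\rm Vir}^f$, and $V^{f,m}_\chi$ if $\mathfrak h=\mathfrak b_m^f$. Write $f=\prod_{i=1}^k(t-\lambda_i)^{n_i}$ with distinct $\lambda_i$ and $n_i\geq 1$. A homomorphism $\ddot\mu:{\rm Vir}^f\to\mathbb C$ has large degree if $\ddot\mu=\sum_{i=1}^k\mu_i|_{{\rm Vir}^f}$ for homomorphisms $\mu_i:{\rm Vir}^{(t-\lambda_i)^{n_i}}\to\mathbb C$ and nonzero polynomials $p_i$ such that $\deg p_i\ge n_i-2$ and, for all $j\in\mathbb Z$, $\mu_i(x_{i,j})=p_i(j)\lambda_i^j$, where $x_{i,j}$ is the linear combination of the $e_l$ with $\theta(x_{i,j})=t^j(t-\lambda_i)^{n_i}$. (1) For all homomorphisms $\ddot\mu:{\rm Vir}^f\to\mathbb C$ and $\hat\mu:\mathfrak b_m\to\mathbb C$, with $\mu=\ddot\mu|_{\mathfrak b_m^f}+\hat\mu|_{\mathfrak b_m^f}$, there is an isomorphism of ${\rm Vir}$-modules $$V^{f,m}_\mu\cong V^f_{\ddot\mu}\otimes{\rm Ind}_{\mathfrak b_m}^{\rm Vir}\mathbb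 C_{\hat\mu}.$$ (2) Conversely, every homomorphism $\mu:\mathfrak b_m^f\to\mathbb C$ is of the form $\mu=\ddot\mu|_{\mathfrak b_m^f}+\hat\mu|_{\mathfrak b_m^f}$ for exactly one pair of homomorphisms $\ddot\mu:{\rm Vir}^f\to\mathbb C$, $\hat\mu:\mathfrak b_m\to\mathbb C$, so that $V^{f,m}_\mu$ has the tensor product decomposition of (1). Say that $\mu$ has large degree if $\ddot\mu$ does. Then $V^{f,m}_\mu$ is simple if and only if $\mu$ has large degree and ${\rm Ind}_{\mathfrak b_m}^{\rm Vir}\mathbb C_{\hat\mu}$ is simple. -/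

import Mathlib

open scoped TensorProduct LaurentPolynomial

noncomputable section

/-! ### The Virasoro algebra -/

namespace Virasoro

open LaurentPolynomial (T)

/-- The operator `t d/dt` on Laurent polynomials, `t ^ n ↦ n t ^ n`. -/
def euler : ℂ[T;T⁻¹] →ₗ[ℂ] ℂ[T;T⁻¹] :=
  (Finsupp.linearCombination ℂ fun n : ℤ => (n : ℂ) • (T n : ℂ[T;T⁻¹])) ∘ₗ
    (AddMonoidAlgebra.coeffLinearEquiv ℂ).toLinearMap

/-- The Virasoro cocycle, `ω (t ^ j, t ^ k) = δ_{k, -j} (j ^ 3 - j) / 12`. -/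
def cocycle : ℂ[T;T⁻¹] →ₗ[ℂ] ℂ[T;T⁻¹] →ₗ[ℂ] ℂ :=
  (Finsupp.linearCombination ℂ fun j : ℤ => (((j : ℂ) ^ 3 - j) / 12) •
      (Finsupp.lapply (-j) ∘ₗ (AddMonoidAlgebra.coeffLinearEquiv ℂ).toLinearMap :
        ℂ[T;T⁻¹] →ₗ[ℂ] ℂ)) ∘ₗ
    (AddMonoidAlgebra.coeffLinearEquiv ℂ).toLinearMap

/-- The Lie bracket `[f, g] = t (f g' - g f')` on Laurent polynomials. -/
def wittBracket (f g : ℂ[T;T⁻¹]) : ℂ[T;T⁻¹] := f * euler g - g * euler f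

theorem euler_T (n : ℤ) : euler (T n) = (n : ℂ) • T n := by
  simp [euler, T, -LaurentPolynomial.single_eq_C_mul_T]

theorem cocycle_T (j k : ℤ) :
    cocycle (T j) (T k) = if k = -j then ((j : ℂ) ^ 3 - j) / 12 else 0 := by
  simp [cocycle, T, Finsupp.single_apply, -LaurentPolynomial.single_eq_C_mul_T]

theorem induction_T {P : ℂ[T;T⁻¹] → Prop} (f : ℂ[T;T⁻¹])
    (add : ∀ p q, P p → P q → P (p + q)) (smul : ∀ (c : ℂ) p, P p → P (c • p))
    (mono : ∀ n, P (T n)) : P f := by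
  induction f using LaurentPolynomial.induction_on' with
  | add p q hp hq => exact add p q hp hq
  | C_mul_T n a => rw [← LaurentPolynomial.smul_eq_C_mul]; exact smul a _ (mono n)

theorem euler_mul (f g : ℂ[T;T⁻¹]) : euler (f * g) = f * euler g + g * euler f := by
  induction f using induction_T with
  | add p q hp hq => simp only [add_mul, map_add, hp, hq, mul_add]; ring
  | smul c p hp => simp only [smul_mul_assoc, map_smul, hp, smul_add, mul_smul_comm]
  | mono n =>
    induction g using induction_T with
    | add p q hp hq => simp only [add_mul, map_add, hp, hq, mul_add]; ring
    | smul c p hp => simp only [smul_mul_assoc, map_smul, hp, smul_add, mul_smul_comm]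
    | mono k =>
      simp only [← LaurentPolynomial.T_add, euler_T, mul_smul_comm]
      rw [add_comm k n, ← add_smul]; push_cast; congr 1; ring

theorem wittBracket_T (j k : ℤ) :
    wittBracket (T j) (T k) = ((k : ℂ) - j) • T (j + k) := by
  simp only [wittBracket, euler_T, mul_smul_comm, ← LaurentPolynomial.T_add]
  rw [add_comm k j, sub_smul]

theorem wittBracket_add_left (f g h : ℂ[T;T⁻¹]) :
    wittBracket (f + g) h = wittBracket f h + wittBracket g h := by
  simp only [wittBracket, map_add]; ring

theorem wittBracket_add_right (f g h : ℂ[T;T⁻¹]) :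
    wittBracket f (g + h) = wittBracket f g + wittBracket f h := by
  simp only [wittBracket, map_add]; ring

theorem wittBracket_smul_left (c : ℂ) (f g : ℂ[T;T⁻¹]) :
    wittBracket (c • f) g = c • wittBracket f g := by
  simp only [wittBracket, map_smul, smul_mul_assoc, mul_smul_comm, smul_sub]

theorem wittBracket_smul_right (c : ℂ) (f g : ℂ[T;T⁻¹]) :
    wittBracket f (c • g) = c • wittBracket f g := by
  simp only [wittBracket, map_smul, smul_mul_assoc, mul_smul_comm, smul_sub]

theorem cocycle_skew (f g : ℂ[T;T⁻¹]) : cocycle f g = -cocycle g f := by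
  induction f using induction_T with
  | add p q hp hq => simp only [map_add, LinearMap.add_apply, hp, hq]; ring
  | smul c p hp => simp only [map_smul, LinearMap.smul_apply, hp, smul_neg]
  | mono n =>
    induction g using induction_T with
    | add p q hp hq => simp only [map_add, LinearMap.add_apply, hp, hq]; ring
    | smul c p hp => simp only [map_smul, LinearMap.smul_apply, hp, smul_neg]
    | mono k =>
      simp only [cocycle_T]
      by_cases h : k = -n
      · subst h; simp; ring
      · rw [if_neg h, if_neg (by omega), neg_zero]

theorem cocycle_leibniz (f g h : ℂ[T;T⁻¹]) :
    cocycle f (wittBracket g h) =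
      cocycle (wittBracket f g) h + cocycle g (wittBracket f h) := by
  induction f using induction_T with
  | add p q hp hq =>
    simp only [map_add, LinearMap.add_apply, wittBracket_add_left, hp, hq]; ring
  | smul c p hp =>
    simp only [map_smul, LinearMap.smul_apply, wittBracket_smul_left, hp, smul_add]
  | mono i =>
    induction g using induction_T with
    | add p q hp hq =>
      simp only [map_add, LinearMap.add_apply, wittBracket_add_left, wittBracket_add_right,
        hp, hq]; ring
    | smul c p hp =>
      simp only [map_smul, LinearMap.smul_apply, wittBracket_smul_left, wittBracket_smul_right,
        hp, smul_add]
    | mono j =>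
      induction h using induction_T with
      | add p q hp hq =>
        simp only [map_add, wittBracket_add_right, hp, hq]; ring
      | smul c p hp =>
        simp only [map_smul, wittBracket_smul_right, hp, smul_add]
      | mono k =>
        simp only [wittBracket_T, map_smul, LinearMap.smul_apply, cocycle_T, smul_eq_mul]
        by_cases h : k = -i - j
        · subst h
          rw [if_pos (by ring), if_pos (by ring), if_pos (by ring)]
          push_cast; ring
        · rw [if_neg (by omega), if_neg (by omega), if_neg (by omega)]; simp

end Virasoro

/-- The Virasoro algebra, as a vector space: the pair `(f, a)` stands for the Laurent
polynomial `f` in `t`, with `t ^ j` in the place of `e_j`, plus `a` times the central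
element `z`. -/
def Virasoro : Type := ℂ[T;T⁻¹] × ℂ

namespace Virasoro

open LaurentPolynomial (T)

instance : AddCommGroup Virasoro := inferInstanceAs (AddCommGroup (ℂ[T;T⁻¹] × ℂ))

instance : Module ℂ Virasoro := inferInstanceAs (Module ℂ (ℂ[T;T⁻¹] × ℂ))

/-- The linear map `θ` with `θ e_j = t ^ j` and `θ z = 0`. -/
def theta : Virasoro →ₗ[ℂ] ℂ[T;T⁻¹] := LinearMap.fst ℂ ℂ[T;T⁻¹] ℂ

/-- The coefficient of `z`, with respect to the basis `z, e_j`. -/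
def centralCoeff : Virasoro →ₗ[ℂ] ℂ := LinearMap.snd ℂ ℂ[T;T⁻¹] ℂ

/-- The basis vector `e_j`. -/
def e (j : ℤ) : Virasoro := (T j, 0)

/-- The central basis vector `z`. -/
def z : Virasoro := (0, 1)

@[simp] theorem theta_e (j : ℤ) : theta (e j) = T j := rfl

@[simp] theorem theta_z : theta z = 0 := rfl

@[simp] theorem centralCoeff_e (j : ℤ) : centralCoeff (e j) = 0 := rfl

@[simp] theorem centralCoeff_z : centralCoeff z = 1 := rfl

theorem ext' {x y : Virasoro} (h1 : theta x = theta y)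
    (h2 : centralCoeff x = centralCoeff y) : x = y := Prod.ext h1 h2

instance : Bracket Virasoro Virasoro :=
  ⟨fun x y => (wittBracket (theta x) (theta y), cocycle (theta x) (theta y))⟩

theorem theta_lie (x y : Virasoro) : theta ⁅x, y⁆ = wittBracket (theta x) (theta y) := rfl

theorem centralCoeff_lie (x y : Virasoro) :
    centralCoeff ⁅x, y⁆ = cocycle (theta x) (theta y) := rfl

instance : LieRing Virasoro where
  add_lie x y w := ext'
    (by simp only [theta_lie, map_add, wittBracket_add_left])
    (by simp only [centralCoeff_lie, map_add, LinearMap.add_apply])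
  lie_add x y w := ext'
    (by simp only [theta_lie, map_add, wittBracket_add_right])
    (by simp only [centralCoeff_lie, map_add])
  lie_self x := ext'
    (by simp only [theta_lie, wittBracket, sub_self, map_zero])
    (by
      rw [centralCoeff_lie, map_zero]
      have h := cocycle_skew (theta x) (theta x)
      linear_combination h / 2)
  leibniz_lie x y w := ext'
    (by simp only [theta_lie, map_add, wittBracket, map_sub, euler_mul]; ring)
    (by simp only [centralCoeff_lie, map_add, theta_lie]; exact cocycle_leibniz _ _ _)

instance : LieAlgebra ℂ Virasoro where
  lie_smul c x y := ext'
    (by simp only [theta_lie, map_smul, wittBracket_smul_right])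
    (by simp only [centralCoeff_lie, map_smul])

/-- The defining relation
`[e_j, e_k] = (k - j) e_{j+k} + δ_{k, -j} (j ^ 3 - j) / 12 z`. -/
theorem lie_e_e (j k : ℤ) :
    ⁅e j, e k⁆ =
      ((k : ℂ) - j) • e (j + k) + (if k = -j then ((j : ℂ) ^ 3 - j) / 12 else 0) • z := by
  refine ext' ?_ ?_
  · rw [theta_lie, map_add, map_smul, map_smul]
    simp [wittBracket_T]
  · rw [centralCoeff_lie, map_add, map_smul, map_smul]
    simp [cocycle_T]

/-- The defining relation `[z, x] = 0`. -/
theorem lie_z (x : Virasoro) : ⁅z, x⁆ = 0 :=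
  ext' (by rw [theta_lie]; simp [wittBracket])
    (by rw [centralCoeff_lie]; simp)

/-! ### Polynomial subalgebras and restricted polynomial subalgebras -/

/-- The polynomial subalgebra `Vir^f = θ⁻¹(⟨f⟩)`, where `⟨f⟩` is the ideal of `ℂ[t, t⁻¹]`
generated by `f`. -/
def polySubalgebra (f : Polynomial ℂ) : LieSubalgebra ℂ Virasoro where
  carrier := {x | theta x ∈ Ideal.span {Polynomial.toLaurent f}}
  add_mem' {x y} hx hy := by
    simp only [Set.mem_ofPred_eq, map_add] at *
    exact add_mem hx hy
  zero_mem' := by simp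
  smul_mem' c x hx := by
    simp only [Set.mem_ofPred_eq, map_smul] at *
    exact Submodule.smul_of_tower_mem _ c hx
  lie_mem' {x y} hx hy := by
    simp only [Set.mem_ofPred_eq, theta_lie, wittBracket] at *
    exact sub_mem (Ideal.mul_mem_right _ _ hx) (Ideal.mul_mem_right _ _ hy)

theorem mem_polySubalgebra {f : Polynomial ℂ} {x : Virasoro} :
    x ∈ polySubalgebra f ↔ theta x ∈ Ideal.span {Polynomial.toLaurent f} := Iff.rfl

theorem polySubalgebra_le {f g : Polynomial ℂ} (h : g ∣ f) :
    polySubalgebra f ≤ polySubalgebra g := by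
  intro x hx
  rw [mem_polySubalgebra, Ideal.mem_span_singleton] at *
  exact (map_dvd Polynomial.toLaurent h).trans hx

/-- The element `x_j^f = a_0 e_j + a_1 e_{j+1} + ⋯ + a_p e_{j+p}` for `f = ∑ a_i t ^ i`. -/
def xVec (f : Polynomial ℂ) (j : ℤ) : Virasoro :=
  ∑ i ∈ Finset.range (f.natDegree + 1), f.coeff i • e (j + i)

theorem theta_xVec (f : Polynomial ℂ) (j : ℤ) :
    theta (xVec f j) = T j * Polynomial.toLaurent f := by
  conv_rhs => rw [f.as_sum_range_C_mul_X_pow]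
  simp only [xVec, map_sum, map_smul, theta_e, Finset.mul_sum,
    LaurentPolynomial.smul_eq_C_mul, Polynomial.toLaurent_C_mul_X_pow, LaurentPolynomial.T_add]
  exact Finset.sum_congr rfl fun i _ => by ring

theorem xVec_mem (f : Polynomial ℂ) (j : ℤ) : xVec f j ∈ polySubalgebra f := by
  rw [mem_polySubalgebra, theta_xVec]
  exact Ideal.mul_mem_left _ _ (Ideal.mem_span_singleton_self _)

/-- The subalgebra `𝔟_m = span {z, e_j ∣ j ≥ m}`, for `m ≥ -1`. -/
def upperSubalgebra (m : ℤ) (hm : -1 ≤ m) : LieSubalgebra ℂ Virasoro where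
  __ := Submodule.span ℂ (insert z {x | ∃ j, m ≤ j ∧ x = e j})
  lie_mem' {x y} hx hy := by
    simp only [AddSubsemigroup.mem_carrier, AddSubmonoid.mem_toSubsemigroup,
      Submodule.mem_toAddSubmonoid] at *
    induction hx, hy using Submodule.span_induction₂ with
    | mem_mem x y hx hy =>
      rcases hx with rfl | ⟨j, hj, rfl⟩
      · rw [lie_z]; exact zero_mem _
      rcases hy with rfl | ⟨k, hk, rfl⟩
      · rw [← lie_skew, lie_z, neg_zero]; exact zero_mem _
      rw [lie_e_e]
      refine add_mem ?_
        (Submodule.smul_mem _ _ (Submodule.subset_span (Set.mem_insert _ _)))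
      by_cases hjk : j = k
      · subst hjk; rw [sub_self, zero_smul]; exact zero_mem _
      · exact Submodule.smul_mem _ _ (Submodule.subset_span
          (Set.mem_insert_of_mem _ ⟨j + k, by omega, rfl⟩))
    | zero_left y hy => rw [zero_lie]; exact zero_mem _
    | zero_right x hx => rw [lie_zero]; exact zero_mem _
    | add_left x y w _ _ _ h1 h2 => rw [add_lie]; exact add_mem h1 h2
    | add_right x y w _ _ _ h1 h2 => rw [lie_add]; exact add_mem h1 h2
    | smul_left r x y _ _ h => rw [smul_lie]; exact Submodule.smul_mem _ _ h
    | smul_right r x y _ _ h => rw [lie_smul]; exact Submodule.smul_mem _ _ h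

/-- The restricted polynomial subalgebra `𝔟_m^f = Vir^f ∩ 𝔟_m`. -/
abbrev restrictedSubalgebra (f : Polynomial ℂ) (m : ℤ) (hm : -1 ≤ m) :
    LieSubalgebra ℂ Virasoro :=
  polySubalgebra f ⊓ upperSubalgebra m hm

end Virasoro

/-! ### Characters and induced modules -/

section Induced

variable {R L : Type*} [CommRing R] [LieRing L] [LieAlgebra R L]

open LieAlgebra (LieCharacter)

attribute [local instance] LieRing.ofAssociativeRing

/-- For characters `α` of `𝔞` and `β` of `𝔟`, the character `α + β` of `𝔞 ∩ 𝔟`. -/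
def LieSubalgebra.addCharacter {A B : LieSubalgebra R L} (α : LieCharacter R A)
    (β : LieCharacter R B) : LieCharacter R ↥(A ⊓ B) where
  toLinearMap := (α : A →ₗ[R] R) ∘ₗ (LieSubalgebra.inclusion (inf_le_left : A ⊓ B ≤ A)) +
    (β : B →ₗ[R] R) ∘ₗ (LieSubalgebra.inclusion (inf_le_right : A ⊓ B ≤ B))
  map_lie' {x y} := by
    simp [LieRing.of_associative_ring_bracket, mul_comm]

/-- The left ideal of `U(L)` generated by the elements `x - χ(x)`, `x ∈ H`. -/
def LieSubalgebra.characterIdeal {H : LieSubalgebra R L} (χ : LieCharacter R H) :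
    Ideal (UniversalEnvelopingAlgebra R L) :=
  Ideal.span (Set.range fun x : H =>
    UniversalEnvelopingAlgebra.ι R (x : L) -
      algebraMap R (UniversalEnvelopingAlgebra R L) (χ x))

/-- The induced module `Ind_H^L R_χ = U(L) ⊗_{U(H)} R_χ` of the one-dimensional `H`-module
`R_χ` on which `H` acts through the character `χ`, realised in the usual way as the quotient
of `U(L)` by the left ideal generated by the elements `x - χ(x)`, `x ∈ H`; the canonical
generator `1 ⊗ 1` is the class of `1`. -/
def LieSubalgebra.Ind {H : LieSubalgebra R L} (χ : LieCharacter R H) : Type _ :=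
  UniversalEnvelopingAlgebra R L ⧸ LieSubalgebra.characterIdeal χ

namespace LieSubalgebra.Ind

variable {H : LieSubalgebra R L} (χ : LieCharacter R H)

instance : AddCommGroup (Ind χ) :=
  inferInstanceAs (AddCommGroup (UniversalEnvelopingAlgebra R L ⧸ characterIdeal χ))

instance : Module (UniversalEnvelopingAlgebra R L) (Ind χ) :=
  inferInstanceAs (Module (UniversalEnvelopingAlgebra R L)
    (UniversalEnvelopingAlgebra R L ⧸ characterIdeal χ))

instance : Module R (Ind χ) :=
  inferInstanceAs (Module R (UniversalEnvelopingAlgebra R L ⧸ characterIdeal χ))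

instance : IsScalarTower R (UniversalEnvelopingAlgebra R L) (Ind χ) :=
  inferInstanceAs (IsScalarTower R (UniversalEnvelopingAlgebra R L)
    (UniversalEnvelopingAlgebra R L ⧸ characterIdeal χ))

/-- `x ∈ L` acts on the induced module as left multiplication by `x ∈ U(L)`. -/
instance : LieRingModule L (Ind χ) where
  bracket x v := UniversalEnvelopingAlgebra.ι R x • v
  add_lie x y v := by
    change UniversalEnvelopingAlgebra.ι R (x + y) • v = _
    rw [map_add, add_smul]
  lie_add x v w := smul_add _ _ _
  leibniz_lie x y v := by
    change UniversalEnvelopingAlgebra.ι R x • (UniversalEnvelopingAlgebra.ι R y • v) =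
      UniversalEnvelopingAlgebra.ι R ⁅x, y⁆ • v +
        UniversalEnvelopingAlgebra.ι R y • (UniversalEnvelopingAlgebra.ι R x • v)
    rw [LieHom.map_lie, LieRing.of_associative_ring_bracket, sub_smul, mul_smul, mul_smul,
      sub_add_cancel]

theorem lie_def (x : L) (v : Ind χ) : ⁅x, v⁆ = UniversalEnvelopingAlgebra.ι R x • v := rfl

instance : LieModule R L (Ind χ) where
  smul_lie c x v := by rw [lie_def, lie_def, map_smul, smul_assoc]
  lie_smul c x v := by
    rw [lie_def, lie_def, ← IsScalarTower.algebraMap_smul (UniversalEnvelopingAlgebra R L) c v,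
      ← IsScalarTower.algebraMap_smul (UniversalEnvelopingAlgebra R L) c, smul_smul, smul_smul,
      Algebra.commutes]

end LieSubalgebra.Ind

end Induced

/-! ### Homomorphisms of large degree -/

namespace Virasoro

open LieAlgebra (LieCharacter)

/-- The polynomial `p` is associated to the homomorphism `μ : Vir^{(t - l)^n} → ℂ`, that is,
`μ (x_j) = p(j) l ^ j` for all integers `j`, where `x_j` corresponds to `t ^ j (t - l)^n`. -/
def IsAssociated {l : ℂ} {n : ℕ}
    (μ : LieCharacter ℂ (polySubalgebra ((Polynomial.X - Polynomial.C l) ^ n)))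
    (p : Polynomial ℂ) : Prop :=
  ∀ j : ℤ, μ ⟨xVec ((Polynomial.X - Polynomial.C l) ^ n) j, xVec_mem _ j⟩ =
    p.eval (j : ℂ) * l ^ j

/-- The homomorphism `μ : Vir^f → ℂ` has large degree: if `l` runs through the distinct roots
of `f`, and `n_l` is the multiplicity of `l`, then `μ` is a sum of (restrictions of)
homomorphisms `ν l : Vir^{(t - l)^{n_l}} → ℂ` whose associated polynomials `p l` are nonzero,
of degree at least `n_l - 2`. -/
def HasLargeDegree {f : Polynomial ℂ} (μ : LieCharacter ℂ (polySubalgebra f)) : Prop :=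
  ∃ (ν : ∀ l : ℂ, LieCharacter ℂ
      (polySubalgebra ((Polynomial.X - Polynomial.C l) ^ f.rootMultiplicity l)))
    (p : ℂ → Polynomial ℂ),
    (∀ x : polySubalgebra f, μ x = ∑ l ∈ f.roots.toFinset,
      ν l (LieSubalgebra.inclusion
        (polySubalgebra_le (f.pow_rootMultiplicity_dvd l)) x)) ∧
    ∀ l ∈ f.roots.toFinset,
      IsAssociated (ν l) (p l) ∧ p l ≠ 0 ∧ f.rootMultiplicity l ≤ (p l).natDegree + 2

/-- The homomorphism `μ : 𝔟_m^f → ℂ` has large degree: in a decomposition `μ = α + β` with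
homomorphisms `α : Vir^f → ℂ` and `β : 𝔟_m → ℂ`, the homomorphism `α` has large degree. -/
def HasLargeDegreeRestricted {f : Polynomial ℂ} {m : ℤ} {hm : -1 ≤ m}
    (μ : LieCharacter ℂ (restrictedSubalgebra f m hm)) : Prop :=
  ∃ (α : LieCharacter ℂ (polySubalgebra f)) (β : LieCharacter ℂ (upperSubalgebra m hm)),
    μ = LieSubalgebra.addCharacter α β ∧ HasLargeDegree α

end Virasoro

end

/-! The tensor decomposition is a Mackey statement. Since a_0 ≠ 0, t is invertible modulo f, so
every Laurent polynomial is congruent modulo f to an element of t^m ℂ[t]; that is, Vir = Vir^f +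
𝔟_m. Whenever L = A + B, a basis of L/A can be lifted into B, and by the PBW theorem Ind α has the
ordered monomials in it as a basis; as a B-module it is therefore induced from A ∩ B. So
B-semi-invariants in Hom(Ind α, N) can be prescribed on the generator, and this yields a left
inverse of the canonical map Ind (α + β) → Ind α ⊗ Ind β, whose surjectivity is direct
(`Ind.nonempty_equiv_tensor`). PBW itself is obtained from an explicit action of L on ordered
monomials (`Complement.commutator`).

Characters split because of what they must kill: a character of Vir^f kills z and f² ℂ[t^±], one of
𝔟_m kills t^(2m+1) ℂ[t], and one of 𝔟_m^f kills t^(2m+1) f² ℂ[t]. Matching these spaces gives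
existence and uniqueness (`existsUnique_addCharacter`).

Sufficiency of large degree: the roots of f are split off one at a time by the Mackey statement, so
the point is that Ind χ ⊗ M is simple when χ is a character of Vir^((t-l)^n) of large degree, and M
is simple with every vector killed by some g ℂ[t], g(l) ≠ 0. Let N = n + deg p be the top power of t
- l on which χ is nonzero, and give (t-l)^a the weight N + 1 - 2a. Large degree says exactly that
the letters with a < n have positive weight, so words in them filter Ind χ in degrees ≥ 0, with only
multiples of the generator in degree 0. The element (t-l)^(N+1-a) g has the opposite weight, and its
bracket with (t-l)^a is a nonzero scalar to leading order; for N ≥ 2 the sum of the products of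
these pairs is, up to a nonzero factor, the degree operator on the graded space
(`HasTopDegree.euler_word`), and for N = 1 a direct computation replaces it
(`HasTopDegree.lie_replicate`). If g kills the components in M, these operators act on the left
factor alone and still preserve submodules, so a nonzero submodule contains a nonzero gen ⊗ m
(`HasTopDegree.exists_tmul_mem`), and from there everything.

Necessity: a proper quotient of M, or an extension of α to a larger subalgebra, would give Ind α ⊗ M
a map with proper nonzero kernel. With f' = f/(t-l), the character α extends to Vir^(f') as soon as
it kills ⟨f⟩ ∩ ⟨f'²⟩. Hence it does not kill it, and after splitting α into local characters by a
partition of unity modulo f², this says that each associated polynomial is nonzero of degree at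
least n - 2 (`hasLargeDegree_of_forall`). -/

noncomputable section

/-! ### Universal property of induced modules. -/

section Induced

attribute [local instance] LieRing.ofAssociativeRing

open LieAlgebra (LieCharacter)

namespace UniversalEnvelopingAlgebra

variable {R L : Type*} [CommRing R] [LieRing L] [LieAlgebra R L]

theorem mkAlgHom_surjective : Function.Surjective (mkAlgHom R L) :=
  RingCon.mkₐ_surjective _

theorem mem_of_ι_mul_mem {P : UniversalEnvelopingAlgebra R L → Prop}
    (one : P 1) (add : ∀ u v, P u → P v → P (u + v)) (smul : ∀ (c : R) u, P u → P (c • u))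
    (mul : ∀ x u, P u → P (ι R x * u)) (u : UniversalEnvelopingAlgebra R L) : P u := by
  obtain ⟨a, rfl⟩ := mkAlgHom_surjective u
  -- Replacing 1 by an arbitrary v turns the product case of the induction into a composition.
  suffices h : ∀ v, P v → P (mkAlgHom R L a * v) by simpa using h 1 one
  induction a using TensorAlgebra.induction with
  | algebraMap r => intro v hv; simpa [Algebra.smul_def] using smul r v hv
  | ι x => intro v hv; exact mul x v hv
  | mul a b ha hb => intro v hv; rw [map_mul, mul_assoc]; exact ha _ (hb _ hv)
  | add a b ha hb => intro v hv; rw [map_add, add_mul]; exact add _ _ (ha _ hv) (hb _ hv)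

end UniversalEnvelopingAlgebra

namespace LieSubalgebra.Ind

variable {R L : Type*} [CommRing R] [LieRing L] [LieAlgebra R L]
variable {H : LieSubalgebra R L} (χ : LieCharacter R H)

/-- The canonical generator `1 ⊗ 1` of the induced module. -/
def gen : Ind χ := Submodule.Quotient.mk (p := characterIdeal χ) 1

theorem smul_gen (u : UniversalEnvelopingAlgebra R L) :
    u • gen χ = Submodule.Quotient.mk (p := characterIdeal χ) u := by
  change Submodule.Quotient.mk (p := characterIdeal χ) (u * 1) = _
  rw [mul_one]

theorem lie_gen (x : H) : ⁅(x : L), gen χ⁆ = χ x • gen χ := by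
  rw [lie_def, ← IsScalarTower.algebraMap_smul (UniversalEnvelopingAlgebra R L) (χ x), smul_gen,
    smul_gen]
  exact (Submodule.Quotient.eq _).2 (Ideal.subset_span ⟨x, rfl⟩)

theorem induction_gen {P : Ind χ → Prop} (gen : P (gen χ)) (add : ∀ v w, P v → P w → P (v + w))
    (smul : ∀ (c : R) v, P v → P (c • v)) (lie : ∀ (x : L) v, P v → P ⁅x, v⁆) (v : Ind χ) :
    P v := by
  obtain ⟨u, rfl⟩ := Submodule.Quotient.mk_surjective (characterIdeal χ) v
  rw [← smul_gen]
  induction u using UniversalEnvelopingAlgebra.mem_of_ι_mul_mem with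
  | one => rwa [one_smul]
  | add u v hu hv => rw [add_smul]; exact add _ _ hu hv
  | smul c u hu => rw [smul_assoc]; exact smul _ _ hu
  | mul x u hu => rw [mul_smul]; exact lie _ _ hu

variable {χ} {N : Type*} [AddCommGroup N] [Module R N] [LieRingModule L N] [LieModule R L N]

omit [LieModule R L N] in
theorem hom_ext {φ ψ : Ind χ →ₗ⁅R, L⁆ N} (h : φ (gen χ) = ψ (gen χ)) : φ = ψ := by
  ext v
  induction v using induction_gen with
  | gen => exact h
  | add v w hv hw => rw [map_add, map_add, hv, hw]
  | smul c v hv => rw [map_smul, map_smul, hv]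
  | lie x v hv => rw [LieModuleHom.map_lie, LieModuleHom.map_lie, hv]

/-- The universal property of the induced module. -/
theorem exists_hom (n : N) (hn : ∀ x : H, ⁅(x : L), n⁆ = χ x • n) :
    ∃ φ : Ind χ →ₗ⁅R, L⁆ N, φ (gen χ) = n := by
  let ρ := UniversalEnvelopingAlgebra.lift R (LieModule.toEnd R L N)
  have hρ : ∀ x : L, ρ (UniversalEnvelopingAlgebra.ι R x) = LieModule.toEnd R L N x :=
    fun x => UniversalEnvelopingAlgebra.lift_ι_apply R _ x
  let ev : UniversalEnvelopingAlgebra R L →ₗ[R] N := LinearMap.applyₗ n ∘ₗ ρ.toLinearMap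
  have hev : ∀ u, ev u = ρ u n := fun _ => rfl
  have hker : (characterIdeal χ).restrictScalars R ≤ LinearMap.ker ev := by
    intro u hu
    rw [Submodule.restrictScalars_mem] at hu
    rw [LinearMap.mem_ker, hev]
    induction hu using Submodule.span_induction with
    | mem u hu =>
      obtain ⟨x, rfl⟩ := hu
      rw [map_sub, hρ, AlgHom.commutes, LinearMap.sub_apply, LieModule.toEnd_apply_apply, hn,
        Module.algebraMap_end_apply, sub_self]
    | zero => rw [map_zero, LinearMap.zero_apply]
    | add u v _ _ hu hv => rw [map_add, LinearMap.add_apply, hu, hv, add_zero]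
    | smul a u _ hu => rw [smul_eq_mul, map_mul, Module.End.mul_apply, hu, map_zero]
  let φ : Ind χ →ₗ[R] N := ((characterIdeal χ).restrictScalars R).liftQ ev hker
  have hφ : ∀ u, φ (Submodule.Quotient.mk (p := characterIdeal χ) u) = ρ u n := fun _ => rfl
  refine ⟨{ φ with map_lie' := fun {x v} => ?_ }, ?_⟩
  · obtain ⟨u, rfl⟩ := Submodule.Quotient.mk_surjective (characterIdeal χ) v
    change φ (Submodule.Quotient.mk (p := characterIdeal χ)
      (UniversalEnvelopingAlgebra.ι R x * u)) = ⁅x, ρ u n⁆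
    rw [hφ, map_mul, hρ, Module.End.mul_apply, LieModule.toEnd_apply_apply]
  · change ρ 1 n = n
    rw [map_one, Module.End.one_apply]

end LieSubalgebra.Ind

end Induced

end

/-! ### The PBW theorem relative to a subalgebra: the action on ordered monomials. -/

noncomputable section

section Complement

attribute [local instance] LieRing.ofAssociativeRing

open LieAlgebra (LieCharacter)

/-- A linearly ordered basis of a complement of the subalgebra `H`, given by its vectors and
by the coordinate map, whose kernel is `H`. -/
structure LieSubalgebra.Complement {R L : Type*} [CommRing R] [LieRing L] [LieAlgebra R L]
    (H : LieSubalgebra R L) (ι : Type*) where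
  vec : ι → L
  coord : L →ₗ[R] ι →₀ R
  coord_vec : ∀ i, coord (vec i) = Finsupp.single i 1
  coord_eq_zero : ∀ x, coord x = 0 ↔ x ∈ H

namespace LieSubalgebra.Complement

variable {R L : Type*} [CommRing R] [LieRing L] [LieAlgebra R L] {H : LieSubalgebra R L}
variable {ι : Type*} (b : H.Complement ι)

/-- The projection to `H` along the complement. -/
def proj : L →ₗ[R] L := LinearMap.id - Finsupp.linearCombination R b.vec ∘ₗ b.coord

theorem proj_mem (x : L) : b.proj x ∈ H := by
  rw [← b.coord_eq_zero]
  have h : b.coord ∘ₗ Finsupp.linearCombination R b.vec = LinearMap.id := by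
    ext i : 2; simp [b.coord_vec]
  have h' := LinearMap.congr_fun h (b.coord x)
  simp only [LinearMap.comp_apply, LinearMap.id_apply] at h'
  simp [proj, h']

theorem linearCombination_add_proj (x : L) :
    Finsupp.linearCombination R b.vec (b.coord x) + b.proj x = x := by
  simp [proj]

theorem proj_of_mem {x : L} (hx : x ∈ H) : b.proj x = x := by
  simp [proj, (b.coord_eq_zero x).2 hx]

theorem proj_vec (i : ι) : b.proj (b.vec i) = 0 := by
  simp [proj, b.coord_vec]

theorem mem_of_vec_of_mem (K : Submodule R L) (hv : ∀ i, b.vec i ∈ K) (hH : ∀ x ∈ H, x ∈ K)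
    (x : L) : x ∈ K := by
  rw [← b.linearCombination_add_proj x, Finsupp.linearCombination_apply]
  exact add_mem (Submodule.sum_mem _ fun i _ => K.smul_mem _ (hv i))
    (hH _ (b.proj_mem x))

/-- The projection to `H` along the complement, with values in `H`. -/
def projH : L →ₗ[R] H := LinearMap.codRestrict H.toSubmodule b.proj b.proj_mem

/-- The span of the monomials of degree at most `n`. -/
def degLE (R ι : Type*) [CommRing R] (n : ℕ) : Submodule R (Multiset ι →₀ R) :=
  Finsupp.supported R R {s | s.card ≤ n}

theorem single_mem_degLE {s : Multiset ι} {n : ℕ} (h : s.card ≤ n) (a : R) :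
    Finsupp.single s a ∈ degLE R ι n :=
  Finsupp.single_mem_supported R a h

theorem degLE_mono {m n : ℕ} (h : m ≤ n) : degLE R ι m ≤ degLE R ι n :=
  Finsupp.supported_mono fun _ hs => le_trans hs h

theorem degLE_induction {n : ℕ} (K : Submodule R (Multiset ι →₀ R))
    (h : ∀ s : Multiset ι, s.card ≤ n → Finsupp.single s 1 ∈ K) : degLE R ι n ≤ K := by
  rw [degLE, Finsupp.supported_eq_span_single, Submodule.span_le]
  rintro _ ⟨s, hs, rfl⟩
  exact h s hs

/-- The leading part of the action. -/
def lead (s : Multiset ι) : L →ₗ[R] Multiset ι →₀ R :=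
  Finsupp.lmapDomain R R (fun i => i ::ₘ s) ∘ₗ b.coord

theorem lead_vec (s : Multiset ι) (i : ι) :
    b.lead s (b.vec i) = Finsupp.single (i ::ₘ s) 1 := by
  simp [lead, b.coord_vec]

theorem lead_of_mem (s : Multiset ι) {x : L} (hx : x ∈ H) : b.lead s x = 0 := by
  simp [lead, (b.coord_eq_zero x).2 hx]

variable [LinearOrder ι] (χ : LieCharacter R H)

/-- The least element of a multiset. -/
def least (s : Multiset ι) (hs : s ≠ 0) : ι :=
  s.toFinset.min' (Multiset.toFinset_nonempty.2 hs)

theorem least_mem (s : Multiset ι) (hs : s ≠ 0) : least s hs ∈ s :=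
  Multiset.mem_toFinset.1 (Finset.min'_mem _ _)

theorem least_le {s : Multiset ι} (hs : s ≠ 0) {j : ι} (hj : j ∈ s) : least s hs ≤ j :=
  Finset.min'_le _ _ (Multiset.mem_toFinset.2 hj)

theorem exists_least (s : Multiset ι) (hs : s ≠ 0) :
    ∃ k t, s = k ::ₘ t ∧ ∀ j ∈ t, k ≤ j :=
  ⟨least s hs, s.erase (least s hs), (Multiset.cons_erase (least_mem s hs)).symm,
    fun _ hj => least_le hs (Multiset.mem_of_mem_erase hj)⟩

theorem least_cons {k : ι} {t : Multiset ι} (h : ∀ j ∈ t, k ≤ j) (hs : k ::ₘ t ≠ 0) :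
    least (k ::ₘ t) hs = k :=
  le_antisymm (least_le hs (Multiset.mem_cons_self k t)) <| by
    rcases Multiset.mem_cons.1 (least_mem _ hs) with h' | h'
    · exact h'.ge
    · exact h _ h'

/-- The action of `L` on the ordered monomials in the basis of the complement, which are
indexed by multisets. -/
def act (s : Multiset ι) : L →ₗ[R] Multiset ι →₀ R :=
  if hs : s = 0 then
    Finsupp.lmapDomain R R (fun i => {i}) ∘ₗ b.coord +
      (Finsupp.lsingle 0 : R →ₗ[R] Multiset ι →₀ R) ∘ₗ (χ : H →ₗ[R] R) ∘ₗ b.projH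
  else
    let k := least s hs
    let t := s.erase k
    -- The recursion reaches only monomials shorter than `s`, so the action is extended by the junk
    -- value 0 to the others. `A` is applied only to combinations of monomials no longer than `t`,
    -- by `act_sub_lead_mem`, so the truncation is invisible.
    let A : (Multiset ι →₀ R) →ₗ[R] L →ₗ[R] Multiset ι →₀ R :=
      Finsupp.linearCombination R fun r => if _ : r.card < s.card then act r else 0
    have : t.card < s.card := Multiset.card_erase_lt_of_mem (least_mem s hs)
    -- With v_k the least letter of s = v_k t, the action must satisfy x v_k t = v_k x t + [x, v_k]
    -- t. For x = v_i with i > k, the leading monomial of v_i t is as long as `s` and so out of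
    -- reach of `A`; its product with v_k is entered by hand.
    Finsupp.linearCombination R (fun i =>
        if i ≤ k then Finsupp.single (i ::ₘ s) 1 else
          Finsupp.single (i ::ₘ s) 1 +
            A (act t (b.vec i) - Finsupp.single (i ::ₘ t) 1) (b.vec k) +
            act t ⁅b.vec i, b.vec k⁆) ∘ₗ b.coord +
      (A.flip (b.vec k) ∘ₗ act t - act t ∘ₗ (LieAlgebra.ad R L (b.vec k) : L →ₗ[R] L)) ∘ₗ b.proj
termination_by s.card

/-- The action of `L` on the span of the ordered monomials. -/
def action : (Multiset ι →₀ R) →ₗ[R] L →ₗ[R] Multiset ι →₀ R :=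
  Finsupp.linearCombination R (b.act χ)

@[simp] theorem action_single (s : Multiset ι) : b.action χ (Finsupp.single s 1) = b.act χ s := by
  simp [action]

theorem act_zero_of_mem {x : L} (hx : x ∈ H) :
    b.act χ 0 x = Finsupp.single 0 (χ ⟨x, hx⟩) := by
  have h : b.projH x = ⟨x, hx⟩ := Subtype.ext (b.proj_of_mem hx)
  rw [act]
  simp [(b.coord_eq_zero x).2 hx, h]

theorem act_vec {s : Multiset ι} {i : ι} (h : ∀ j ∈ s, i ≤ j) :
    b.act χ s (b.vec i) = Finsupp.single (i ::ₘ s) 1 := by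
  rw [act]
  split_ifs with hs
  · subst hs
    have h : b.projH (b.vec i) = 0 := Subtype.ext (b.proj_vec i)
    simp [b.coord_vec, h]
  · simp [b.coord_vec, b.proj_vec, h _ (least_mem s hs)]

/-- `x` belongs to `H`, or it is a basis vector with an index above `k`. -/
def Above (k : ι) (x : L) : Prop := x ∈ H ∨ ∃ i, k < i ∧ x = b.vec i

theorem action_truncated {n : ℕ} {p : Multiset ι →₀ R} (hp : p ∈ degLE R ι n)
    {N : ℕ} (hN : n < N) :
    Finsupp.linearCombination R (fun r => if _ : r.card < N then b.act χ r else 0) p =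
      b.action χ p := by
  have h : degLE R ι n ≤ LinearMap.eqLocus
      (Finsupp.linearCombination R fun r => if _ : r.card < N then b.act χ r else 0)
      (b.action χ) := by
    refine degLE_induction _ fun s hs => ?_
    simp [LinearMap.mem_eqLocus, lt_of_le_of_lt hs hN]
  exact h hp

theorem act_cons_truncated {k : ι} {t : Multiset ι} (h : ∀ j ∈ t, k ≤ j) {x : L}
    (hx : b.Above k x) :
    b.act χ (k ::ₘ t) x = b.lead (k ::ₘ t) x +
      Finsupp.linearCombination R
        (fun r => if _ : r.card < (k ::ₘ t).card then b.act χ r else 0)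
        (b.act χ t x - b.lead t x) (b.vec k) + b.act χ t ⁅x, b.vec k⁆ := by
  have hs : k ::ₘ t ≠ 0 := Multiset.cons_ne_zero
  rw [act, dif_neg hs]
  simp only [least_cons h hs, Multiset.erase_cons_head]
  rcases hx with hx | ⟨i, hi, rfl⟩
  · simp only [LinearMap.add_apply, LinearMap.sub_apply, LinearMap.comp_apply,
      (b.coord_eq_zero x).2 hx, map_zero, b.proj_of_mem hx, b.lead_of_mem _ hx, sub_zero,
      zero_add, LinearMap.flip_apply, LieAlgebra.ad_apply]
    rw [← lie_skew, map_neg, sub_neg_eq_add]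
  · simp [b.coord_vec, b.proj_vec, b.lead_vec, not_le.2 hi]

/-- To leading order the action is multiplication in the symmetric algebra of L/H. The estimate is
what removes the truncation in `act`, so it has to be derived from the truncated recursion. -/
theorem act_sub_lead_mem (s : Multiset ι) (x : L) :
    b.act χ s x - b.lead s x ∈ degLE R ι s.card := by
  induction hn : s.card using Nat.strong_induction_on generalizing s x with
  | _ n ih =>
  subst hn
  have hlead : ∀ (t : Multiset ι) (x : L), b.lead t x ∈ degLE R ι (t.card + 1) := by
    intro t x
    rw [lead, LinearMap.comp_apply, Finsupp.lmapDomain_apply, Finsupp.mapDomain]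
    exact Submodule.sum_mem _ fun i _ => single_mem_degLE (by simp) _
  have hact : ∀ t : Multiset ι, t.card < s.card → ∀ x, b.act χ t x ∈ degLE R ι (t.card + 1) := by
    intro t ht x
    have := add_mem (degLE_mono (Nat.le_succ _) (ih _ ht t x rfl)) (hlead t x)
    rwa [sub_add_cancel] at this
  have habove : ∀ (k : ι) (t : Multiset ι), s = k ::ₘ t → (∀ j ∈ t, k ≤ j) → ∀ x, b.Above k x →
      b.act χ s x - b.lead s x ∈ degLE R ι s.card := by
    rintro k t rfl hk x hx
    have ht : t.card < (k ::ₘ t).card := by simp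
    have hlow := ih _ ht t x rfl
    rw [b.act_cons_truncated χ hk hx, b.action_truncated χ hlow ht, add_assoc, add_sub_cancel_left]
    rw [Multiset.card_cons]
    refine add_mem ?_ (hact t ht _)
    have hle : degLE R ι t.card ≤
        (degLE R ι (t.card + 1)).comap ((b.action χ).flip (b.vec k)) := by
      refine degLE_induction _ fun r hr => ?_
      rw [Submodule.mem_comap, LinearMap.flip_apply, action_single]
      exact degLE_mono (by omega) (hact r (by omega) _)
    exact hle hlow
  refine b.mem_of_vec_of_mem ((degLE R ι s.card).comap (b.act χ s - b.lead s))
    (fun i => ?_) (fun x hx => ?_) x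
  · rw [Submodule.mem_comap, LinearMap.sub_apply]
    by_cases hi : ∀ j ∈ s, i ≤ j
    · rw [b.act_vec χ hi, b.lead_vec, sub_self]; exact zero_mem _
    · push Not at hi
      obtain ⟨j, hj, hji⟩ := hi
      obtain ⟨k, t, rfl, hk⟩ := exists_least s (by rintro rfl; simp at hj)
      refine habove k t rfl hk _ (Or.inr ⟨i, ?_, rfl⟩)
      rcases Multiset.mem_cons.1 hj with rfl | hj
      · exact hji
      · exact (hk j hj).trans_lt hji
  · rw [Submodule.mem_comap, LinearMap.sub_apply]
    by_cases hs : s = 0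
    · subst hs
      rw [b.act_zero_of_mem χ hx, b.lead_of_mem _ hx, sub_zero]
      exact single_mem_degLE le_rfl _
    · obtain ⟨k, t, rfl, hk⟩ := exists_least s hs
      exact habove k t rfl hk _ (Or.inl hx)

/-- The straightening rule without truncation. The leading term needs no recursion: k is least, so
v_k times an ordered monomial with indices ≥ k is again one. -/
theorem act_cons_of_above {k : ι} {t : Multiset ι} (h : ∀ j ∈ t, k ≤ j) {x : L}
    (hx : b.Above k x) :
    b.act χ (k ::ₘ t) x = b.action χ (b.act χ t x) (b.vec k) + b.act χ t ⁅x, b.vec k⁆ := by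
  rw [b.act_cons_truncated χ h hx,
    b.action_truncated χ (b.act_sub_lead_mem χ t x) (by simp : t.card < (k ::ₘ t).card), map_sub,
    LinearMap.sub_apply]
  have : b.action χ (b.lead t x) (b.vec k) = b.lead (k ::ₘ t) x := by
    rcases hx with hx | ⟨i, hi, rfl⟩
    · simp [b.lead_of_mem _ hx]
    · rw [b.lead_vec, b.lead_vec, action_single, b.act_vec χ, Multiset.cons_swap]
      intro j hj
      rcases Multiset.mem_cons.1 hj with rfl | hj
      · exact hi.le
      · exact h j hj
  rw [this]
  abel

theorem commutator_of_above_of_le {j : ι} {s : Multiset ι} (h : ∀ i ∈ s, j ≤ i) {x : L}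
    (hx : b.Above j x) :
    b.action χ (b.act χ s (b.vec j)) x - b.action χ (b.act χ s x) (b.vec j) =
      b.act χ s ⁅x, b.vec j⁆ := by
  rw [b.act_vec χ h, action_single, b.act_cons_of_above χ h hx, add_sub_cancel_left]

/-- The Jacobi step of PBW: v_k is moved to the left past both x and y by the straightening rule,
and what remains is the relation on t for several pairs, combined by the Jacobi identity. -/
theorem commutator_of_above {k : ι} {t : Multiset ι} (h : ∀ j ∈ t, k ≤ j)
    (ih : ∀ p ∈ degLE R ι t.card, ∀ x y : L,
      b.action χ (b.action χ p y) x - b.action χ (b.action χ p x) y = b.action χ p ⁅x, y⁆)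
    {x y : L} (hx : b.Above k x) (hy : b.Above k y) :
    b.action χ (b.act χ (k ::ₘ t) y) x - b.action χ (b.act χ (k ::ₘ t) x) y =
      b.act χ (k ::ₘ t) ⁅x, y⁆ := by
  have iht : ∀ x y : L, b.action χ (b.act χ t y) x - b.action χ (b.act χ t x) y =
      b.act χ t ⁅x, y⁆ := by
    intro x y
    simpa using ih (Finsupp.single t 1) (single_mem_degLE le_rfl 1) x y
  -- The vector y t has length one more than t, so the induction hypothesis covers only its lower
  -- part. Its leading monomial has all indices ≥ k, and there the relation with v_k holds by
  -- construction.
  have key : ∀ x y : L, b.Above k x → b.Above k y →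
      b.action χ (b.action χ (b.act χ t y) (b.vec k)) x =
        b.action χ (b.action χ (b.act χ t y) x) (b.vec k) +
          b.action χ (b.act χ t y) ⁅x, b.vec k⁆ := by
    intro x y hx hy
    have h1 := ih _ (b.act_sub_lead_mem χ t y) x (b.vec k)
    have h2 : b.action χ (b.action χ (b.lead t y) (b.vec k)) x -
        b.action χ (b.action χ (b.lead t y) x) (b.vec k) =
          b.action χ (b.lead t y) ⁅x, b.vec k⁆ := by
      rcases hy with hy | ⟨i, hi, rfl⟩
      · simp [b.lead_of_mem _ hy]
      · rw [b.lead_vec, action_single]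
        refine b.commutator_of_above_of_le χ ?_ hx
        intro j hj
        rcases Multiset.mem_cons.1 hj with rfl | hj
        · exact hi.le
        · exact h j hj
    simp only [map_sub, LinearMap.sub_apply] at h1
    rw [← sub_eq_iff_eq_add', ← sub_eq_zero]
    rw [← sub_eq_zero] at h1 h2
    rw [← add_zero (0 : Multiset ι →₀ R), ← congrArg₂ (· + ·) h1 h2]
    abel
  rw [b.act_cons_of_above χ h hx, b.act_cons_of_above χ h hy, map_add, map_add,
    LinearMap.add_apply, LinearMap.add_apply, key x y hx hy, key y x hy hx]
  have e1 := iht x ⁅y, b.vec k⁆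
  have e2 := iht y ⁅x, b.vec k⁆
  have e3 := congrArg (fun p => b.action χ p (b.vec k)) (iht x y)
  have e4 := iht ⁅x, y⁆ (b.vec k)
  have e5 : b.act χ t ⁅⁅x, y⁆, b.vec k⁆ =
      b.act χ t ⁅x, ⁅y, b.vec k⁆⁆ - b.act χ t ⁅y, ⁅x, b.vec k⁆⁆ := by
    rw [← map_sub, lie_lie]
  rw [b.act_vec χ h, action_single] at e4
  simp only [map_sub, LinearMap.sub_apply] at e3
  rw [← sub_eq_zero] at e1 e2 e3 e4 e5 ⊢
  have e := congrArg₂ (· + ·) (congrArg₂ (· - ·) e1 e2)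
    (congrArg₂ (· - ·) e3 (congrArg₂ (· + ·) e5 e4))
  simp only [sub_zero, add_zero] at e
  rw [← e]
  abel

/-- By bilinearity x and y are basis vectors or elements of H. If one is v_j, with the other above
j, then either j is at most every index of the monomial and the relation is the definition, or the
least index k of the monomial is below j and both elements are above k. Two elements of H are above
any k; on the empty monomial the relation says that χ kills brackets. -/
theorem commutator_of_mem_degLE (n : ℕ) : ∀ p ∈ degLE R ι n, ∀ x y : L,
    b.action χ (b.action χ p y) x - b.action χ (b.action χ p x) y = b.action χ p ⁅x, y⁆ := by
  induction n using Nat.strong_induction_on with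
  | _ n ih =>
  have hgen : ∀ s : Multiset ι, s.card ≤ n → ∀ x y : L,
      b.action χ (b.act χ s y) x - b.action χ (b.act χ s x) y = b.act χ s ⁅x, y⁆ := by
    intro s hs
    have hcons : ∀ k t, s = k ::ₘ t → (∀ j ∈ t, k ≤ j) → ∀ x y : L, b.Above k x → b.Above k y →
        b.action χ (b.act χ s y) x - b.action χ (b.act χ s x) y = b.act χ s ⁅x, y⁆ := by
      rintro k t rfl h x y hx hy
      refine b.commutator_of_above χ h (ih _ ?_) hx hy
      rw [Multiset.card_cons] at hs
      omega
    have hvec : ∀ j x, b.Above j x →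
        b.action χ (b.act χ s (b.vec j)) x - b.action χ (b.act χ s x) (b.vec j) =
          b.act χ s ⁅x, b.vec j⁆ := by
      intro j x hx
      by_cases hj : ∀ i ∈ s, j ≤ i
      · exact b.commutator_of_above_of_le χ hj hx
      · push Not at hj
        obtain ⟨i, hi, hij⟩ := hj
        obtain ⟨k, t, rfl, hk⟩ := exists_least s (by rintro rfl; simp at hi)
        have hkj : k < j := by
          rcases Multiset.mem_cons.1 hi with rfl | hi
          · exact hij
          · exact (hk i hi).trans_lt hij
        refine hcons k t rfl hk _ _ ?_ (Or.inr ⟨j, hkj, rfl⟩)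
        rcases hx with hx | ⟨i, hi, rfl⟩
        · exact Or.inl hx
        · exact Or.inr ⟨i, hkj.trans hi, rfl⟩
    have hneg : ∀ x y : L,
        b.action χ (b.act χ s y) x - b.action χ (b.act χ s x) y = b.act χ s ⁅x, y⁆ →
        b.action χ (b.act χ s x) y - b.action χ (b.act χ s y) x = b.act χ s ⁅y, x⁆ := by
      intro x y h
      rw [← lie_skew, map_neg, ← h, neg_sub]
    let D : L →ₗ[R] L →ₗ[R] Multiset ι →₀ R :=
      LinearMap.mk₂ R (fun x y => b.action χ (b.act χ s y) x - b.action χ (b.act χ s x) y -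
        b.act χ s ⁅x, y⁆)
        (by intros; simp only [map_add, LinearMap.add_apply, add_lie]; abel)
        (by intros; simp only [map_smul, LinearMap.smul_apply, smul_lie, smul_sub])
        (by intros; simp only [map_add, LinearMap.add_apply, lie_add]; abel)
        (by intros; simp only [map_smul, LinearMap.smul_apply, lie_smul, smul_sub])
    have hD : ∀ x y, D x y = b.action χ (b.act χ s y) x - b.action χ (b.act χ s x) y -
        b.act χ s ⁅x, y⁆ := fun _ _ => rfl
    suffices h : ∀ x y, D x y = 0 from fun x y => sub_eq_zero.1 (h x y)
    have h1 : ∀ x i, D x (b.vec i) = 0 := by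
      intro x i
      refine b.mem_of_vec_of_mem (LinearMap.ker (D.flip (b.vec i))) (fun j => ?_)
        (fun x hx => ?_) x
      · rw [LinearMap.mem_ker, LinearMap.flip_apply, hD, sub_eq_zero]
        rcases lt_trichotomy i j with hij | rfl | hij
        · exact hvec i _ (Or.inr ⟨j, hij, rfl⟩)
        · rw [sub_self, lie_self, map_zero]
        · exact hneg _ _ (hvec j _ (Or.inr ⟨i, hij, rfl⟩))
      · rw [LinearMap.mem_ker, LinearMap.flip_apply, hD, sub_eq_zero]
        exact hvec i x (Or.inl hx)
    intro x y
    refine b.mem_of_vec_of_mem (LinearMap.ker (D x)) (h1 x) (fun y hy => ?_) y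
    rw [LinearMap.mem_ker]
    refine b.mem_of_vec_of_mem (LinearMap.ker (D.flip y)) (fun j => ?_) (fun x hx => ?_) x
    · rw [LinearMap.mem_ker, LinearMap.flip_apply, hD, sub_eq_zero]
      exact hneg _ _ (hvec j y (Or.inl hy))
    · rw [LinearMap.mem_ker, LinearMap.flip_apply, hD, sub_eq_zero]
      by_cases hs0 : s = 0
      · subst hs0
        rw [b.act_zero_of_mem χ hx, b.act_zero_of_mem χ hy,
          b.act_zero_of_mem χ (H.lie_mem hx hy)]
        have : χ ⟨⁅x, y⁆, H.lie_mem hx hy⟩ = 0 :=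
          LieAlgebra.lieCharacter_apply_lie χ ⟨x, hx⟩ ⟨y, hy⟩
        rw [this]
        simp [action, b.act_zero_of_mem χ hx, b.act_zero_of_mem χ hy, mul_comm]
      · obtain ⟨k, t, hkt, hk⟩ := exists_least s hs0
        exact hcons k t hkt hk x y (Or.inl hx) (Or.inl hy)
  intro p hp x y
  have hle : degLE R ι n ≤ LinearMap.eqLocus
      ((b.action χ).flip x ∘ₗ (b.action χ).flip y - (b.action χ).flip y ∘ₗ (b.action χ).flip x)
      ((b.action χ).flip ⁅x, y⁆) := by
    refine degLE_induction _ fun s hs => ?_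
    simpa [LinearMap.mem_eqLocus] using hgen s hs x y
  exact hle hp

theorem commutator (p : Multiset ι →₀ R) (x y : L) :
    b.action χ (b.action χ p y) x - b.action χ (b.action χ p x) y = b.action χ p ⁅x, y⁆ := by
  refine b.commutator_of_mem_degLE χ (p.support.sup Multiset.card) p ?_ x y
  rw [degLE, Finsupp.mem_supported]
  exact fun s hs => Finset.le_sup (f := Multiset.card) hs

end LieSubalgebra.Complement

end Complement

end

/-! ### The monomial module and its maps to other modules. -/

noncomputable section

section Monomials

attribute [local instance] LieRing.ofAssociativeRing

open LieAlgebra (LieCharacter)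

namespace LieSubalgebra.Complement

variable {R L : Type*} [CommRing R] [LieRing L] [LieAlgebra R L] {H : LieSubalgebra R L}
variable {ι : Type*} [LinearOrder ι] (b : H.Complement ι) (χ : LieCharacter R H)

/-- The span of the ordered monomials in the basis of the complement, as a module for `L`. -/
def MonomialModule (_b : H.Complement ι) (_χ : LieCharacter R H) : Type _ := Multiset ι →₀ R

namespace MonomialModule

instance : AddCommGroup (MonomialModule b χ) := inferInstanceAs (AddCommGroup (Multiset ι →₀ R))

instance : Module R (MonomialModule b χ) := inferInstanceAs (Module R (Multiset ι →₀ R))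

instance : LieRingModule L (MonomialModule b χ) where
  bracket x p := b.action χ p x
  add_lie x y p := map_add (b.action χ p) x y
  lie_add x p q := LinearMap.congr_fun (map_add (b.action χ) p q) x
  leibniz_lie x y p := (sub_eq_iff_eq_add.1 (b.commutator χ p x y))

theorem lie_def (x : L) (p : MonomialModule b χ) : ⁅x, p⁆ = b.action χ p x := rfl

instance : LieModule R L (MonomialModule b χ) where
  smul_lie c x p := map_smul (b.action χ p) c x
  lie_smul c x p := LinearMap.congr_fun (map_smul (b.action χ) c p) x

/-- The empty monomial. -/
def one : MonomialModule b χ := Finsupp.single (0 : Multiset ι) (1 : R)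

theorem lie_one (x : H) : ⁅(x : L), one b χ⁆ = χ x • one b χ := by
  rw [lie_def, one, action_single, b.act_zero_of_mem χ x.2]
  exact (Finsupp.smul_single_one (0 : Multiset ι) (χ x)).symm

end MonomialModule

section WordMap

variable {N : Type*} [AddCommGroup N] [Module R N] (ρ : L →ₗ[R] Module.End R N) (n : N)

/-- The linear map that replaces the ordered monomials by the corresponding products of
operators, applied to `n`. -/
def wordMap : (Multiset ι →₀ R) →ₗ[R] N :=
  Finsupp.linearCombination R fun s => ((s.sort (· ≤ ·)).map fun i => ρ (b.vec i)).prod n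

theorem wordMap_zero : b.wordMap ρ n (Finsupp.single 0 1) = n := by
  simp [wordMap]

theorem wordMap_cons {i : ι} {s : Multiset ι} (h : ∀ j ∈ s, i ≤ j) :
    b.wordMap ρ n (Finsupp.single (i ::ₘ s) 1) =
      ρ (b.vec i) (b.wordMap ρ n (Finsupp.single s 1)) := by
  simp [wordMap, Multiset.sort_cons (r := (· ≤ ·)) i s h]

variable {ρ n} (B : LieSubalgebra R L) (hv : ∀ i, b.vec i ∈ B)
  (hρ : ∀ x ∈ B, ∀ y ∈ B, ρ ⁅x, y⁆ = ρ x * ρ y - ρ y * ρ x)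
  (hn : ∀ x (hx : x ∈ H), x ∈ B → ρ x n = χ ⟨x, hx⟩ • n)

include hv hρ hn in
-- The straightening rules hold for the operators `ρ` as well. When the basis vectors and x lie in
-- B, so do all brackets and the projection of x to H; hence `ρ` need be a representation only on B,
-- and `n` an eigenvector only for H ∩ B.
theorem wordMap_action_of_mem_degLE (m : ℕ) : ∀ p ∈ degLE R ι m, ∀ x ∈ B,
    b.wordMap ρ n (b.action χ p x) = ρ x (b.wordMap ρ n p) := by
  induction m using Nat.strong_induction_on with
  | _ m ih =>
  intro p hp x hx
  have hle : degLE R ι m ≤ LinearMap.eqLocus (b.wordMap ρ n ∘ₗ (b.action χ).flip x)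
      (ρ x ∘ₗ b.wordMap ρ n) := by
    refine degLE_induction _ fun s hs => ?_
    rw [LinearMap.mem_eqLocus, LinearMap.comp_apply, LinearMap.comp_apply, LinearMap.flip_apply,
      action_single]
    clear hp
    have habove : ∀ k t, s = k ::ₘ t → (∀ j ∈ t, k ≤ j) → ∀ x ∈ B, b.Above k x →
        b.wordMap ρ n (b.act χ s x) = ρ x (b.wordMap ρ n (Finsupp.single s 1)) := by
      rintro k t rfl hk x hx hkx
      have ht : t.card < m := by rw [Multiset.card_cons] at hs; omega
      have h1 : b.wordMap ρ n (b.action χ (b.act χ t x) (b.vec k)) =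
          ρ (b.vec k) (b.wordMap ρ n (b.act χ t x)) := by
        have h2 := ih _ ht _ (b.act_sub_lead_mem χ t x) _ (hv k)
        have h3 : b.wordMap ρ n (b.action χ (b.lead t x) (b.vec k)) =
            ρ (b.vec k) (b.wordMap ρ n (b.lead t x)) := by
          rcases hkx with hkx | ⟨i, hi, rfl⟩
          · simp [b.lead_of_mem _ hkx]
          · have hki : ∀ j ∈ i ::ₘ t, k ≤ j := by
              intro j hj
              rcases Multiset.mem_cons.1 hj with rfl | hj
              · exact hi.le
              · exact hk j hj
            rw [b.lead_vec, action_single, b.act_vec χ hki, b.wordMap_cons ρ n hki]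
        simp only [map_sub, LinearMap.sub_apply] at h2
        rw [h3] at h2
        exact sub_left_injective h2
      have h4 : ∀ y ∈ B, b.wordMap ρ n (b.act χ t y) =
          ρ y (b.wordMap ρ n (Finsupp.single t 1)) := by
        intro y hy
        simpa using ih _ ht _ (single_mem_degLE le_rfl 1) y hy
      rw [b.act_cons_of_above χ hk hkx, map_add, h1, h4 x hx, h4 _ (B.lie_mem hx (hv k)),
        hρ x hx _ (hv k), b.wordMap_cons ρ n hk]
      simp
    have hvec : ∀ i, b.wordMap ρ n (b.act χ s (b.vec i)) =
        ρ (b.vec i) (b.wordMap ρ n (Finsupp.single s 1)) := by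
      intro i
      by_cases hi : ∀ j ∈ s, i ≤ j
      · rw [b.act_vec χ hi, b.wordMap_cons ρ n hi]
      · push Not at hi
        obtain ⟨j, hj, hji⟩ := hi
        obtain ⟨k, t, rfl, hk⟩ := exists_least s (by rintro rfl; simp at hj)
        refine habove k t rfl hk _ (hv i) (Or.inr ⟨i, ?_, rfl⟩)
        rcases Multiset.mem_cons.1 hj with rfl | hj
        · exact hji
        · exact (hk j hj).trans_lt hji
    have hmem : ∀ y ∈ H, y ∈ B → b.wordMap ρ n (b.act χ s y) =
        ρ y (b.wordMap ρ n (Finsupp.single s 1)) := by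
      intro y hyH hyB
      by_cases hs : s = 0
      · subst hs
        rw [b.act_zero_of_mem χ hyH, b.wordMap_zero, hn y hyH hyB,
          ← Finsupp.smul_single_one, map_smul, b.wordMap_zero]
      · obtain ⟨k, t, hkt, hk⟩ := exists_least s hs
        exact habove k t hkt hk y hyB (Or.inl hyH)
    let E : L →ₗ[R] N := b.wordMap ρ n ∘ₗ b.act χ s -
      (ρ : L →ₗ[R] N →ₗ[R] N).flip (b.wordMap ρ n (Finsupp.single s 1))
    have hE : ∀ y, E y = b.wordMap ρ n (b.act χ s y) -
      ρ y (b.wordMap ρ n (Finsupp.single s 1)) := fun _ => rfl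
    rw [← sub_eq_zero, ← hE, ← b.linearCombination_add_proj x, map_add]
    have hlc : ∀ c : ι →₀ R, Finsupp.linearCombination R b.vec c ∈ B := fun c => by
      rw [Finsupp.linearCombination_apply]
      exact Submodule.sum_mem B.toSubmodule fun i _ => B.smul_mem _ (hv i)
    have h5 : b.proj x ∈ B := by
      have h := sub_mem hx (hlc (b.coord x))
      exact h
    rw [hE (b.proj x), hmem _ (b.proj_mem x) h5, sub_self, add_zero, ← LinearMap.comp_apply]
    have h6 : E ∘ₗ Finsupp.linearCombination R b.vec = 0 := by
      ext i
      simp [hE, hvec]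
    rw [h6, LinearMap.zero_apply]
  exact hle hp

include hv hρ hn in
theorem wordMap_action (p : Multiset ι →₀ R) (x : L) (hx : x ∈ B) :
    b.wordMap ρ n (b.action χ p x) = ρ x (b.wordMap ρ n p) := by
  refine b.wordMap_action_of_mem_degLE χ B hv hρ hn (p.support.sup Multiset.card) p ?_ x hx
  rw [degLE, Finsupp.mem_supported]
  exact fun s hs => Finset.le_sup (f := Multiset.card) hs

end WordMap

end LieSubalgebra.Complement

end Monomials

/-! ### The Mackey tensor product theorem for L = A + B. -/

section Mackey

attribute [local instance] LieRing.ofAssociativeRing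

open LieAlgebra (LieCharacter)

universe u v

variable {k : Type u} {L : Type v} [Field k] [LieRing L] [LieAlgebra k L]

namespace LieSubalgebra

/-- If `L = A + B`, then `A` has a complement with a basis in `B`. -/
theorem exists_complement {A B : LieSubalgebra k L} (h : A.toSubmodule ⊔ B.toSubmodule = ⊤) :
    ∃ (ι : Type v) (_ : LinearOrder ι) (b : A.Complement ι), ∀ i, b.vec i ∈ B := by
  let e := Module.Basis.ofVectorSpace k (L ⧸ A.toSubmodule)
  have hlift : ∀ q : L ⧸ A.toSubmodule, ∃ x ∈ B, A.toSubmodule.mkQ x = q := by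
    intro q
    obtain ⟨y, rfl⟩ := A.toSubmodule.mkQ_surjective q
    have hy : y ∈ A.toSubmodule ⊔ B.toSubmodule := h ▸ Submodule.mem_top
    obtain ⟨a, ha, c, hc, rfl⟩ := Submodule.mem_sup.1 hy
    refine ⟨c, hc, ?_⟩
    have ha' : A.toSubmodule.mkQ a = 0 := (Submodule.Quotient.mk_eq_zero _).2 ha
    rw [map_add, ha', zero_add]
  choose v hvB hv using fun i => hlift (e i)
  classical
  let b : A.Complement (Module.Basis.ofVectorSpaceIndex k (L ⧸ A.toSubmodule)) :=
    ⟨v, e.repr.toLinearMap ∘ₗ A.toSubmodule.mkQ, fun i => ?_, fun x => ?_⟩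
  · exact ⟨_, linearOrderOfSTO WellOrderingRel, b, hvB⟩
  · simp [hv]
  · simp

namespace Ind

/-- If `L = A + B`, a linear map out of a module induced from `A` which is equivariant for `B`,
up to a twist by the character `β`, may be prescribed on the generator. -/
theorem exists_twisted_map {A B : LieSubalgebra k L} (h : A.toSubmodule ⊔ B.toSubmodule = ⊤)
    (α : LieCharacter k A) (β : LieCharacter k B) {N : Type*} [AddCommGroup N] [Module k N]
    [LieRingModule L N] [LieModule k L N] (n : N)
    (hn : ∀ x : ↥(A ⊓ B), ⁅(x : L), n⁆ = addCharacter α β x • n) :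
    ∃ ψ : Ind α →ₗ[k] N, ψ (gen α) = n ∧
      ∀ (x : B) v, ψ ⁅(x : L), v⁆ = ⁅(x : L), ψ v⁆ - β x • ψ v := by
  obtain ⟨ι, _, b, hb⟩ := exists_complement h
  obtain ⟨β', hβ'⟩ := LinearMap.exists_extend (β : B.toSubmodule →ₗ[k] k)
  have hβ : ∀ x : B, β' x = β x := fun x => LinearMap.congr_fun hβ' x
  -- Twisting by -β still represents B, because β kills brackets, and it turns the eigenvalue α + β
  -- of `n` on A ∩ B into α. Off B the extension `β'` is arbitrary and `ρ` is not a representation.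
  let ρ : L →ₗ[k] Module.End k N := (LieModule.toEnd k L N : L →ₗ[k] Module.End k N) -
    LinearMap.toSpanSingleton k (Module.End k N) 1 ∘ₗ β'
  have hρ : ∀ x v, ρ x v = ⁅x, v⁆ - β' x • v := fun x v => rfl
  obtain ⟨φ, hφ⟩ := exists_hom (χ := α) (Complement.MonomialModule.one b α)
    (Complement.MonomialModule.lie_one b α)
  let q : Complement.MonomialModule b α →ₗ[k] N := b.wordMap ρ n
  have hq : ∀ (p : Complement.MonomialModule b α) (x : B), q ⁅(x : L), p⁆ = ρ x (q p) := by
    intro p x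
    refine b.wordMap_action α B hb ?_ ?_ p x x.2
    · intro x hx y hy
      have h0 : β' ⁅x, y⁆ = 0 :=
        (hβ ⁅(⟨x, hx⟩ : B), ⟨y, hy⟩⁆).trans (LieAlgebra.lieCharacter_apply_lie β _ _)
      ext v
      simp only [LinearMap.sub_apply, Module.End.mul_apply, hρ, h0, zero_smul, sub_zero, lie_sub,
        lie_smul, smul_sub, smul_smul, lie_lie, mul_comm (β' x)]
      abel
    · intro x hxA hxB
      have h1 := hn ⟨x, hxA, hxB⟩
      have h2 : addCharacter α β ⟨x, hxA, hxB⟩ = α ⟨x, hxA⟩ + β ⟨x, hxB⟩ := rfl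
      rw [hρ, h1, h2, hβ ⟨x, hxB⟩, add_smul, add_sub_cancel_right]
  refine ⟨q ∘ₗ (φ : Ind α →ₗ[k] _), ?_, ?_⟩
  · change q (φ (gen α)) = n
    rw [hφ]
    exact b.wordMap_zero ρ n
  · intro x v
    change q (φ ⁅(x : L), v⁆) = ⁅(x : L), q (φ v)⁆ - β x • q (φ v)
    rw [LieModuleHom.map_lie, hq, hρ, hβ]

/-- If `L = A + B`, the module induced from `A` is generated by `B` from its generator. -/
theorem induction_gen_of_sup_eq_top {A : LieSubalgebra k L} (K : LieSubalgebra k L)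
    (h : A.toSubmodule ⊔ K.toSubmodule = ⊤) (α : LieCharacter k A) {P : Submodule k (Ind α)}
    (hgen : gen α ∈ P) (hlie : ∀ x ∈ K, ∀ v ∈ P, ⁅x, v⁆ ∈ P) : P = ⊤ := by
  -- `F n` collects products of at most n elements of K applied to the generator. Each `F n` is
  -- stable under A: moving a ∈ A past y ∈ K leaves [a, y] ∈ A + K acting on `F (n - 1)`. Hence L
  -- maps `F n` to `F (n + 1)`.
  let F : ℕ → Submodule k (Ind α) := fun n => Nat.rec (k ∙ gen α)
    (fun _ Q => Q ⊔ Submodule.span k {w | ∃ x ∈ K, ∃ v ∈ Q, w = ⁅x, v⁆}) n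
  have hF0 : F 0 = k ∙ gen α := rfl
  have hFs : ∀ n, F (n + 1) = F n ⊔ Submodule.span k {w | ∃ x ∈ K, ∃ v ∈ F n, w = ⁅x, v⁆} :=
    fun _ => rfl
  have hmono : ∀ n, F n ≤ F (n + 1) := fun n => (hFs n).symm ▸ le_sup_left
  have hK : ∀ n, ∀ x ∈ K, ∀ v ∈ F n, ⁅x, v⁆ ∈ F (n + 1) := fun n x hx v hv =>
    (hFs n).symm ▸ Submodule.mem_sup_right (Submodule.subset_span ⟨x, hx, v, hv, rfl⟩)
  have hL : ∀ n, (∀ x ∈ A, ∀ v ∈ F n, ⁅x, v⁆ ∈ F n) → ∀ x : L, ∀ v ∈ F n, ⁅x, v⁆ ∈ F (n + 1) := by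
    intro n hA x v hv
    have hx : x ∈ A.toSubmodule ⊔ K.toSubmodule := h ▸ Submodule.mem_top
    obtain ⟨a, ha, c, hc, rfl⟩ := Submodule.mem_sup.1 hx
    rw [add_lie]
    exact add_mem (hmono n (hA a ha v hv)) (hK n c hc v hv)
  have hA : ∀ n, ∀ x ∈ A, ∀ v ∈ F n, ⁅x, v⁆ ∈ F n := by
    intro n
    induction n with
    | zero =>
      intro x hx v hv
      rw [hF0, Submodule.mem_span_singleton] at hv ⊢
      obtain ⟨c, rfl⟩ := hv
      exact ⟨c * α ⟨x, hx⟩, by rw [lie_smul, lie_gen α ⟨x, hx⟩, smul_smul]⟩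
    | succ n ih =>
      intro x hx v hv
      have hle : F (n + 1) ≤ (F (n + 1)).comap (LieModule.toEnd k L (Ind α) x) := by
        conv_lhs => rw [hFs]
        refine sup_le (fun v hv => hmono n (ih x hx v hv)) (Submodule.span_le.2 ?_)
        rintro _ ⟨y, hy, v, hv, rfl⟩
        change ⁅x, ⁅y, v⁆⁆ ∈ F (n + 1)
        rw [leibniz_lie]
        exact add_mem (hL n ih _ v hv) (hK n y hy _ (ih x hx v hv))
      exact hle hv
  have hFP : ∀ n, F n ≤ P := by
    intro n
    induction n with
    | zero => rw [hF0, Submodule.span_singleton_le_iff_mem]; exact hgen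
    | succ n ih =>
      rw [hFs]
      refine sup_le ih (Submodule.span_le.2 ?_)
      rintro _ ⟨y, hy, v, hv, rfl⟩
      exact hlie y hy v (ih hv)
  rw [eq_top_iff]
  intro v _
  suffices hv : ∃ n, v ∈ F n by
    obtain ⟨n, hn⟩ := hv
    exact hFP n hn
  have hmono' : Monotone F := monotone_nat_of_le_succ hmono
  induction v using induction_gen with
  | gen => exact ⟨0, Submodule.mem_span_singleton_self _⟩
  | add v w hv hw =>
    obtain ⟨m, hm⟩ := hv trivial
    obtain ⟨n, hn⟩ := hw trivial
    exact ⟨max m n, add_mem (hmono' (le_max_left _ _) hm) (hmono' (le_max_right _ _) hn)⟩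
  | smul c v hv =>
    obtain ⟨m, hm⟩ := hv trivial
    exact ⟨m, Submodule.smul_mem _ _ hm⟩
  | lie x v hv =>
    obtain ⟨m, hm⟩ := hv trivial
    exact ⟨m + 1, hL m (hA m) x v hm⟩

theorem lie_gen_tmul_gen {A B : LieSubalgebra k L} (α : LieCharacter k A) (β : LieCharacter k B)
    (x : ↥(A ⊓ B)) :
    ⁅(x : L), gen α ⊗ₜ[k] gen β⁆ = addCharacter α β x • (gen α ⊗ₜ[k] gen β) := by
  have h2 : addCharacter α β x = α ⟨x, x.2.1⟩ + β ⟨x, x.2.2⟩ := rfl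
  rw [TensorProduct.LieModule.lie_tmul_right, lie_gen α ⟨x, x.2.1⟩, lie_gen β ⟨x, x.2.2⟩, h2,
    add_smul, TensorProduct.smul_tmul', TensorProduct.tmul_smul]

/-- If `L = A + B`, then the module induced from `A ∩ B` by the sum of two characters is the
tensor product of the modules induced from `A` and `B`. -/
theorem nonempty_equiv_tensor {A B : LieSubalgebra k L}
    (h : A.toSubmodule ⊔ B.toSubmodule = ⊤) (α : LieCharacter k A) (β : LieCharacter k B) :
    Nonempty (Ind (addCharacter α β) ≃ₗ⁅k, L⁆ Ind α ⊗[k] Ind β) := by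
  obtain ⟨φ, hφ⟩ := exists_hom (χ := addCharacter α β) _ (lie_gen_tmul_gen α β)
  obtain ⟨ψ, hψ, hψB⟩ := exists_twisted_map h α β _ (lie_gen (addCharacter α β))
  -- In Hom(Ind α, Ind (α + β)) the map `ψ` is an eigenvector of B with character β, so it induces a
  -- homomorphism from Ind β, which is then uncurried.
  obtain ⟨θ, hθ⟩ := exists_hom (χ := β) ψ fun x => by
    ext v
    rw [LieHom.lie_apply, hψB, LinearMap.smul_apply, sub_sub_cancel]
  let θ' : Ind α ⊗[k] Ind β →ₗ⁅k, L⁆ Ind (addCharacter α β) :=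
    (TensorProduct.LieModule.liftLie k L (Ind β) (Ind α) (Ind (addCharacter α β)) θ).comp
      { (TensorProduct.comm k (Ind α) (Ind β) : _ →ₗ[k] _) with
        map_lie' := fun {x t} => by
          induction t with
          | zero => simp
          | tmul v w => simp [add_comm]
          | add s t hs ht => simp_all }
  have hθ' : θ' (gen α ⊗ₜ gen β) = gen (addCharacter α β) := by
    change TensorProduct.LieModule.liftLie k L (Ind β) (Ind α) (Ind (addCharacter α β)) θ
      (gen β ⊗ₜ gen α) = _
    rw [TensorProduct.LieModule.liftLie_apply, hθ, hψ]
  have hinj : Function.Injective φ := by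
    have : θ'.comp φ = LieModuleHom.id := hom_ext (by
      rw [LieModuleHom.comp_apply, hφ, hθ', LieModuleHom.id_apply])
    exact Function.LeftInverse.injective (g := θ') fun v => LieModuleHom.congr_fun this v
  have hsurj : Function.Surjective φ := by
    rw [← LieModuleHom.range_eq_top]
    have h0 : gen α ⊗ₜ gen β ∈ φ.range := ⟨gen _, hφ⟩
    -- B acts on `gen β` by scalars, so B moves only the left factor, and B generates Ind α from
    -- `gen α`.
    have h1 : ∀ v, v ⊗ₜ gen β ∈ φ.range := by
      intro v
      have : φ.range.toSubmodule.comap ((TensorProduct.mk k (Ind α) (Ind β)).flip (gen β)) = ⊤ := by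
        refine induction_gen_of_sup_eq_top B h α h0 fun x hx v hv => ?_
        have h2 := φ.range.lie_mem (x := x) hv
        simp only [LinearMap.flip_apply, TensorProduct.mk_apply,
          TensorProduct.LieModule.lie_tmul_right, lie_gen β ⟨x, hx⟩, TensorProduct.tmul_smul] at h2
        exact (add_mem_cancel_right (φ.range.smul_mem _ hv)).1 h2
      exact (this ▸ Submodule.mem_top : v ∈ Submodule.comap _ _)
    have h2 : ∀ w v, v ⊗ₜ w ∈ φ.range := by
      intro w
      induction w using induction_gen with
      | gen => exact h1
      | add w w' hw hw' => intro v; rw [TensorProduct.tmul_add]; exact add_mem (hw v) (hw' v)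
      | smul c w hw => intro v; rw [TensorProduct.tmul_smul]; exact φ.range.smul_mem _ (hw v)
      | lie x w hw =>
        intro v
        have h3 := φ.range.lie_mem (x := x) (hw v)
        rw [TensorProduct.LieModule.lie_tmul_right] at h3
        exact (add_mem_cancel_left (hw _)).1 h3
    rw [eq_top_iff]
    intro t _
    induction t with
    | zero => exact zero_mem _
    | tmul v w => exact h2 w v
    | add s t hs ht => exact add_mem (hs trivial) (ht trivial)
  let e : Ind (addCharacter α β) ≃ₗ[k] Ind α ⊗[k] Ind β :=
    LinearEquiv.ofBijective (φ : Ind (addCharacter α β) →ₗ[k] Ind α ⊗[k] Ind β) ⟨hinj, hsurj⟩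
  exact ⟨{ e with map_lie' := fun {x v} => φ.map_lie x v }⟩

theorem gen_ne_zero {A : LieSubalgebra k L} (α : LieCharacter k A) : gen α ≠ 0 := by
  obtain ⟨ι, _, b, -⟩ := exists_complement (A := A) (B := ⊤) (by simp)
  obtain ⟨φ, hφ⟩ := exists_hom (χ := α) (Complement.MonomialModule.one b α)
    (Complement.MonomialModule.lie_one b α)
  intro h
  rw [h, map_zero] at hφ
  have := DFunLike.congr_fun (show (0 : Multiset ι →₀ k) = Finsupp.single 0 1 from hφ) 0
  simp at this

/-- The coefficients of the monomials of length one in x · 1 are the coordinates of x modulo A. This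
later shows that a proper extension of α gives a strictly smaller induced module. -/
theorem mem_of_lie_gen_eq_smul {A : LieSubalgebra k L} (α : LieCharacter k A) {x : L} {c : k}
    (h : ⁅x, gen α⁆ = c • gen α) : x ∈ A := by
  obtain ⟨ι, _, b, -⟩ := exists_complement (A := A) (B := ⊤) (by simp)
  obtain ⟨φ, hφ⟩ := exists_hom (χ := α) (Complement.MonomialModule.one b α)
    (Complement.MonomialModule.lie_one b α)
  have h1 := congrArg φ h
  rw [LieModuleHom.map_lie, map_smul, hφ, Complement.MonomialModule.lie_def,
    Complement.MonomialModule.one, Complement.action_single] at h1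
  have h2 : b.act α 0 x = c • Finsupp.single (0 : Multiset ι) (1 : k) := h1
  rw [← b.coord_eq_zero]
  ext i
  have h3 := DFunLike.congr_fun h2 {i}
  rw [Complement.act] at h3
  have h4 : Function.Injective fun i : ι => ({i} : Multiset ι) := fun i j => Multiset.singleton_inj.1
  simpa [Finsupp.single_apply, Finsupp.mapDomain_apply h4] using h3

end Ind

end LieSubalgebra

end Mackey

end

/-! ### Brackets in Vir^f and 𝔟_m, and what their characters kill. -/

noncomputable section

namespace Virasoro

open LaurentPolynomial (T)
open Polynomial (toLaurent X C)
open LieAlgebra (LieCharacter)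

attribute [local instance] LieRing.ofAssociativeRing

/-! ### Laurent polynomials modulo a polynomial -/

theorem isCoprime_X {f : Polynomial ℂ} (hf : f.coeff 0 ≠ 0) : IsCoprime X f :=
  (Polynomial.irreducible_X.coprime_iff_not_dvd).2 (by rwa [Polynomial.X_dvd_iff])

theorem toLaurent_X_pow (n : ℕ) : toLaurent (X ^ n : Polynomial ℂ) = T n := by
  simp

/-- Both t and g are units modulo f. Every decomposition of Vir as a sum of two subalgebras comes
from here. -/
theorem exists_eq_toLaurent_add {f g : Polynomial ℂ} (hg : IsCoprime g f) (hX : IsCoprime X f)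
    (m : ℤ) (h : ℂ[T;T⁻¹]) :
    ∃ (q : Polynomial ℂ) (r : ℂ[T;T⁻¹]), h = T m * toLaurent (g * q) + toLaurent f * r := by
  obtain ⟨n, h0, hh0⟩ := LaurentPolynomial.exists_T_pow (T (-m) * h)
  obtain ⟨a, b, hab⟩ := hX.pow_left (m := n)
  obtain ⟨c, d, hcd⟩ := hg
  have e1 : toLaurent a * T n + toLaurent b * toLaurent f = 1 := by
    rw [← toLaurent_X_pow, ← map_mul, ← map_mul, ← map_add, hab, map_one]
  have e2 : toLaurent c * toLaurent g + toLaurent d * toLaurent f = 1 := by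
    rw [← map_mul, ← map_mul, ← map_add, hcd, map_one]
  have e3 : (T m : ℂ[T;T⁻¹]) * T (-m) = 1 := by rw [← LaurentPolynomial.T_add]; simp
  -- Modulo f, `a` inverts t^n and `c` inverts g, while `h0` is t^(n-m) h.
  refine ⟨c * a * h0, h * toLaurent b + h * toLaurent a * T n * toLaurent d, ?_⟩
  simp only [map_mul, hh0]
  linear_combination (-h) * e1 - h * toLaurent a * T n * e2 -
    (toLaurent c * toLaurent g * toLaurent a * T n * h) * e3

/-- As f is prime to t, divisibility by f in ℂ[t^±] descends to ℂ[t]; so ⟨f⟩ ∩ t^m ℂ[t] = t^m f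
ℂ[t]. -/
theorem exists_of_T_mul_eq {f q : Polynomial ℂ} (hX : IsCoprime X f) {m : ℤ} {r : ℂ[T;T⁻¹]}
    (h : T m * toLaurent q = toLaurent f * r) :
    ∃ q', q = f * q' ∧ r = T m * toLaurent q' := by
  obtain ⟨n, r0, hr0⟩ := LaurentPolynomial.exists_T_pow (T (-m) * r)
  have e3 : (T m : ℂ[T;T⁻¹]) * T (-m) = 1 := by rw [← LaurentPolynomial.T_add]; simp
  have e4 : (T n : ℂ[T;T⁻¹]) * T (-n) = 1 := by rw [← LaurentPolynomial.T_add]; simp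
  have h1 : X ^ n * q = f * r0 := by
    apply Polynomial.toLaurent_injective
    rw [map_mul, map_mul, hr0, toLaurent_X_pow]
    linear_combination (T n * T (-m)) * h - T n * toLaurent q * e3
  obtain ⟨q', rfl⟩ := (hX.pow_left (m := n)).symm.dvd_of_dvd_mul_left ⟨r0, h1⟩
  refine ⟨q', rfl, ?_⟩
  have hf : f ≠ 0 := by
    rintro rfl
    exact Polynomial.not_isUnit_X (isCoprime_zero_right.1 hX)
  have h2 : X ^ n * q' = r0 := mul_left_cancel₀ hf (by rw [← h1]; ring)
  rw [← h2, map_mul, toLaurent_X_pow] at hr0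
  linear_combination (-T m * T (-n)) * hr0 - (r - T m * toLaurent q') * e4 -
    (r * T n * T (-n)) * e3

/-! ### Elements of the Virasoro algebra -/

/-- The linear section of `θ` with values in the span of the `e_j`. -/
def emb : ℂ[T;T⁻¹] →ₗ[ℂ] Virasoro := LinearMap.inl ℂ ℂ[T;T⁻¹] ℂ

@[simp] theorem theta_emb (f : ℂ[T;T⁻¹]) : theta (emb f) = f := rfl

@[simp] theorem centralCoeff_emb (f : ℂ[T;T⁻¹]) : centralCoeff (emb f) = 0 := rfl

theorem emb_theta_add (x : Virasoro) : emb (theta x) + centralCoeff x • z = x :=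
  ext' (by simp) (by simp)

theorem lie_eq (x y : Virasoro) :
    ⁅x, y⁆ = emb (wittBracket (theta x) (theta y)) + cocycle (theta x) (theta y) • z :=
  (emb_theta_add ⁅x, y⁆).symm

theorem mem_polySubalgebra_iff {f : Polynomial ℂ} {x : Virasoro} :
    x ∈ polySubalgebra f ↔ ∃ h, theta x = toLaurent f * h := by
  rw [mem_polySubalgebra, Ideal.mem_span_singleton]; rfl

theorem z_mem_polySubalgebra (f : Polynomial ℂ) : z ∈ polySubalgebra f :=
  mem_polySubalgebra_iff.2 ⟨0, by simp⟩

theorem emb_mem_polySubalgebra (f : Polynomial ℂ) (h : ℂ[T;T⁻¹]) :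
    emb (toLaurent f * h) ∈ polySubalgebra f :=
  mem_polySubalgebra_iff.2 ⟨h, rfl⟩

theorem z_mem_upperSubalgebra (m : ℤ) (hm : -1 ≤ m) : z ∈ upperSubalgebra m hm :=
  Submodule.subset_span (Set.mem_insert _ _)

theorem mem_upperSubalgebra_iff {m : ℤ} {hm : -1 ≤ m} {x : Virasoro} :
    x ∈ upperSubalgebra m hm ↔ ∃ q : Polynomial ℂ, theta x = T m * toLaurent q := by
  constructor
  · intro hx
    have hx' : x ∈ Submodule.span ℂ (insert z {x | ∃ j, m ≤ j ∧ x = e j}) := hx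
    clear hx
    induction hx' using Submodule.span_induction with
    | mem x hx =>
      rcases hx with rfl | ⟨j, hj, rfl⟩
      · exact ⟨0, by simp⟩
      · refine ⟨X ^ (j - m).toNat, ?_⟩
        rw [toLaurent_X_pow, ← LaurentPolynomial.T_add, theta_e]
        congr 1; omega
    | zero => exact ⟨0, by simp⟩
    | add x y _ _ hx hy =>
      obtain ⟨p, hp⟩ := hx
      obtain ⟨q, hq⟩ := hy
      exact ⟨p + q, by rw [map_add, map_add, hp, hq, mul_add]⟩
    | smul c x _ hx =>
      obtain ⟨p, hp⟩ := hx
      exact ⟨c • p, by rw [map_smul, hp, Polynomial.smul_eq_C_mul, map_mul, Polynomial.toLaurent_C,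
        LaurentPolynomial.smul_eq_C_mul]; ring⟩
  · rintro ⟨q, hq⟩
    rw [← emb_theta_add x, hq]
    refine add_mem ?_ ((upperSubalgebra m hm).smul_mem _ (z_mem_upperSubalgebra m hm))
    clear hq
    induction q using Polynomial.induction_on' with
    | add p q hp hq => rw [map_add, mul_add, map_add]; exact add_mem hp hq
    | monomial n a =>
      rw [← Polynomial.C_mul_X_pow_eq_monomial, map_mul toLaurent, Polynomial.toLaurent_C,
        toLaurent_X_pow, mul_left_comm, ← LaurentPolynomial.smul_eq_C_mul, ← LaurentPolynomial.T_add, map_smul]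
      exact (upperSubalgebra m hm).smul_mem _ (Submodule.subset_span
        (Set.mem_insert_of_mem _ ⟨_, by omega, rfl⟩))

theorem emb_mem_upperSubalgebra (m : ℤ) (hm : -1 ≤ m) (q : Polynomial ℂ) :
    emb (T m * toLaurent q) ∈ upperSubalgebra m hm :=
  mem_upperSubalgebra_iff.2 ⟨q, rfl⟩

/-- The terms with the derivative of f cancel; hence characters of Vir^f are governed by ⟨f²⟩. -/
theorem wittBracket_mul_mul (f a b : ℂ[T;T⁻¹]) :
    wittBracket (f * a) (f * b) = f ^ 2 * wittBracket a b := by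
  simp only [wittBracket, euler_mul]; ring

theorem wittBracket_T_mul (f : ℂ[T;T⁻¹]) (j k : ℤ) :
    wittBracket (T j * f) (T k * f) = ((k : ℂ) - j) • (T (j + k) * f ^ 2) := by
  rw [mul_comm _ f, mul_comm _ f, wittBracket_mul_mul, wittBracket_T, mul_smul_comm, mul_comm]

theorem toLaurent_induction₂ {P : Polynomial ℂ → Polynomial ℂ → Prop}
    (add_left : ∀ p q r, P p r → P q r → P (p + q) r)
    (add_right : ∀ p q r, P p q → P p r → P p (q + r))
    (smul_left : ∀ (c : ℂ) p q, P p q → P (c • p) q)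
    (smul_right : ∀ (c : ℂ) p q, P p q → P p (c • q))
    (mono : ∀ i j : ℕ, P (X ^ i) (X ^ j)) (p q : Polynomial ℂ) : P p q := by
  induction p using Polynomial.induction_on' with
  | add p r hp hr => exact add_left _ _ _ hp hr
  | monomial i a =>
    rw [← Polynomial.C_mul_X_pow_eq_monomial, ← Polynomial.smul_eq_C_mul]
    apply smul_left
    induction q using Polynomial.induction_on' with
    | add p r hp hr => exact add_right _ _ _ hp hr
    | monomial j a =>
      rw [← Polynomial.C_mul_X_pow_eq_monomial, ← Polynomial.smul_eq_C_mul]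
      exact smul_right _ _ _ (mono i j)

theorem toLaurent_smul (c : ℂ) (p : Polynomial ℂ) : toLaurent (c • p) = c • toLaurent p := by
  rw [Polynomial.smul_eq_C_mul, map_mul, Polynomial.toLaurent_C, LaurentPolynomial.smul_eq_C_mul]

theorem cocycle_T_mul_neg (r : ℤ) (p q : Polynomial ℂ) :
    cocycle (T (-r) * toLaurent p) (T r * toLaurent q) =
      p.coeff 0 * q.coeff 0 * (((r : ℂ) - r ^ 3) / 12) := by
  induction p, q using toLaurent_induction₂ with
  | add_left p q s hp hq =>
    rw [map_add, mul_add, map_add, LinearMap.add_apply, hp, hq, Polynomial.coeff_add]; ring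
  | add_right p q s hp hq => rw [map_add, mul_add, map_add, hp, hq, Polynomial.coeff_add]; ring
  | smul_left c p q h =>
    rw [toLaurent_smul, mul_smul_comm, map_smul, LinearMap.smul_apply, h, Polynomial.coeff_smul]
    simp only [smul_eq_mul]; ring
  | smul_right c p q h =>
    rw [toLaurent_smul, mul_smul_comm, map_smul, h, Polynomial.coeff_smul]
    simp only [smul_eq_mul]; ring
  | mono i j =>
    rw [toLaurent_X_pow, toLaurent_X_pow, ← LaurentPolynomial.T_add, ← LaurentPolynomial.T_add,
      cocycle_T]
    simp only [Polynomial.coeff_X_pow]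
    by_cases h : i = 0 ∧ j = 0
    · obtain ⟨rfl, rfl⟩ := h
      simp; ring
    · rw [if_neg (by omega)]
      by_cases hi : i = 0
      · rw [if_neg (by omega : ¬ 0 = j)]; simp
      · rw [if_neg (by omega : ¬ 0 = i)]; simp

/-- Opposite exponents that are both at least -1 belong to {-1, 0, 1}, the zeros of j³ - j. Thus
𝔟_m, for m ≥ -1, does not see the cocycle, and its characters are unconstrained on z. -/
theorem cocycle_eq_zero {j k : ℤ} (hj : -1 ≤ j) (hk : -1 ≤ k) (p q : Polynomial ℂ) :
    cocycle (T j * toLaurent p) (T k * toLaurent q) = 0 := by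
  induction p, q using toLaurent_induction₂ with
  | add_left p q s hp hq =>
    rw [map_add, mul_add, map_add, LinearMap.add_apply, hp, hq, add_zero]
  | add_right p q s hp hq => rw [map_add, mul_add, map_add, hp, hq, add_zero]
  | smul_left c p q h =>
    rw [toLaurent_smul, mul_smul_comm, map_smul, LinearMap.smul_apply, h, smul_zero]
  | smul_right c p q h => rw [toLaurent_smul, mul_smul_comm, map_smul, h, smul_zero]
  | mono i l =>
    rw [toLaurent_X_pow, toLaurent_X_pow, ← LaurentPolynomial.T_add, ← LaurentPolynomial.T_add,
      cocycle_T]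
    split_ifs with h
    · have : j + i = -1 ∨ j + i = 0 ∨ j + i = 1 := by omega
      rcases this with h | h | h <;> rw [h] <;> norm_num
    · rfl

/-! ### Characters -/

/-- A linear form which vanishes on the brackets of elements of `A` gives a character of `A`. -/
def characterOf (A : LieSubalgebra ℂ Virasoro) (ψ : Virasoro →ₗ[ℂ] ℂ)
    (h : ∀ x ∈ A, ∀ y ∈ A, ψ ⁅x, y⁆ = 0) : LieCharacter ℂ A where
  toLinearMap := ψ ∘ₗ A.toSubmodule.subtype
  map_lie' {x y} := by
    rw [LieRing.of_associative_ring_bracket, mul_comm, sub_self]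
    exact h x x.2 y y.2

theorem characterOf_apply {A : LieSubalgebra ℂ Virasoro} {ψ : Virasoro →ₗ[ℂ] ℂ}
    (h : ∀ x ∈ A, ∀ y ∈ A, ψ ⁅x, y⁆ = 0) (x : A) : characterOf A ψ h x = ψ x := rfl

theorem exists_eq_characterOf {A : LieSubalgebra ℂ Virasoro} (α : LieCharacter ℂ A) :
    ∃ (ψ : Virasoro →ₗ[ℂ] ℂ) (h : ∀ x ∈ A, ∀ y ∈ A, ψ ⁅x, y⁆ = 0), α = characterOf A ψ h := by
  obtain ⟨ψ, hψ⟩ := LinearMap.exists_extend (α : A.toSubmodule →ₗ[ℂ] ℂ)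
  have hψ' : ∀ x : A, ψ x = α x := fun x => LinearMap.congr_fun hψ x
  refine ⟨ψ, fun x hx y hy => ?_, LieHom.ext fun x => (hψ' x).symm⟩
  exact (hψ' ⁅(⟨x, hx⟩ : A), ⟨y, hy⟩⁆).trans (LieAlgebra.lieCharacter_apply_lie α _ _)

/-- The brackets of t^(-1) f with t f and of t^(-2) f with t² f are both multiples of f² up to a
central term, which is 0 for the first and a nonzero multiple of a_0² z for the second; so f² and z
are killed. With z gone, every t^s f² is a nonzero multiple of a bracket. -/
theorem eq_zero_of_lie_eq_zero {f : Polynomial ℂ} (hf : f.coeff 0 ≠ 0) {ψ : Virasoro →ₗ[ℂ] ℂ}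
    (h : ∀ x ∈ polySubalgebra f, ∀ y ∈ polySubalgebra f, ψ ⁅x, y⁆ = 0) :
    ψ z = 0 ∧ ∀ g : ℂ[T;T⁻¹], ψ (emb (toLaurent f ^ 2 * g)) = 0 := by
  have key : ∀ j k : ℤ, ((k : ℂ) - j) * ψ (emb (T (j + k) * toLaurent f ^ 2)) +
      cocycle (T j * toLaurent f) (T k * toLaurent f) * ψ z = 0 := by
    intro j k
    have h1 := h (emb (T j * toLaurent f)) (by rw [mul_comm]; exact emb_mem_polySubalgebra _ _)
      (emb (T k * toLaurent f)) (by rw [mul_comm]; exact emb_mem_polySubalgebra _ _)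
    rwa [lie_eq, theta_emb, theta_emb, wittBracket_T_mul, map_add, map_smul, map_smul, map_smul,
      smul_eq_mul, smul_eq_mul] at h1
  have hz : ψ z = 0 := by
    have k1 := key (-1) 1
    have k2 := key (-2) 2
    rw [cocycle_T_mul_neg] at k1 k2
    norm_num at k1 k2
    rw [k1] at k2
    simpa [hf] using k2
  refine ⟨hz, fun g => ?_⟩
  induction g using induction_T with
  | add p q hp hq => rw [mul_add, map_add, map_add, hp, hq, add_zero]
  | smul c p hp => rw [mul_smul_comm, map_smul, map_smul, hp, smul_zero]
  | mono s =>
    rw [mul_comm]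
    obtain ⟨j, hj⟩ : ∃ j : ℤ, s - j - j ≠ 0 := by
      by_cases hs : s = 0
      · exact ⟨1, by omega⟩
      · exact ⟨0, by omega⟩
    have k1 := key j (s - j)
    rw [hz, mul_zero, add_zero, add_sub_cancel] at k1
    refine (mul_eq_zero.1 k1).resolve_left ?_
    rw [← Int.cast_sub]
    exact_mod_cast hj

theorem lie_eq_zero_of_eq_zero {f : Polynomial ℂ} {ψ : Virasoro →ₗ[ℂ] ℂ} (hz : ψ z = 0)
    (h : ∀ g : ℂ[T;T⁻¹], ψ (emb (toLaurent f ^ 2 * g)) = 0) :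
    ∀ x ∈ polySubalgebra f, ∀ y ∈ polySubalgebra f, ψ ⁅x, y⁆ = 0 := by
  intro x hx y hy
  obtain ⟨a, ha⟩ := mem_polySubalgebra_iff.1 hx
  obtain ⟨b, hb⟩ := mem_polySubalgebra_iff.1 hy
  rw [lie_eq, ha, hb, wittBracket_mul_mul, map_add, h, map_smul, hz, smul_zero, add_zero]

/-- A character of `𝔟_m` vanishes on `e_j` for `j ≥ 2m + 1`. -/
theorem eq_zero_of_lie_eq_zero_upper {m : ℤ} {hm : -1 ≤ m} {g : Polynomial ℂ}
    {ψ : Virasoro →ₗ[ℂ] ℂ}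
    (h : ∀ x ∈ polySubalgebra g ⊓ upperSubalgebra m hm,
      ∀ y ∈ polySubalgebra g ⊓ upperSubalgebra m hm, ψ ⁅x, y⁆ = 0) (q : Polynomial ℂ) :
    ψ (emb (T (2 * m + 1) * toLaurent (g ^ 2 * q))) = 0 := by
  induction q using Polynomial.induction_on' with
  | add p q hp hq => rw [mul_add, map_add, mul_add, map_add, map_add, hp, hq, add_zero]
  | monomial n a =>
    have hmem : ∀ j : ℤ, m ≤ j →
        emb (T j * toLaurent g) ∈ polySubalgebra g ⊓ upperSubalgebra m hm := by
      refine fun j hj => ⟨by rw [mul_comm]; exact emb_mem_polySubalgebra _ _,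
        mem_upperSubalgebra_iff.2 ⟨X ^ (j - m).toNat * g, ?_⟩⟩
      rw [map_mul toLaurent, toLaurent_X_pow, ← mul_assoc, ← LaurentPolynomial.T_add, theta_emb]
      congr 2; omega
    -- The exponents m and m + 1 + n add up to 2m + 1 + n, and their difference n + 1 is never zero.
    have h1 := h _ (hmem m le_rfl) _ (hmem (m + 1 + n) (by omega))
    rw [lie_eq, theta_emb, theta_emb, wittBracket_T_mul, cocycle_eq_zero hm (by omega), zero_smul,
      add_zero, map_smul, map_smul, smul_eq_mul] at h1
    have h2 : (((m + 1 + n : ℤ) : ℂ) - m) ≠ 0 := by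
      push_cast
      rw [show (m : ℂ) + 1 + n - m = (n : ℂ) + 1 by ring]
      exact Nat.cast_add_one_ne_zero n
    have h3 := (mul_eq_zero.1 h1).resolve_left h2
    have h4 : (T (2 * m + 1) * toLaurent (g ^ 2 * Polynomial.monomial n a) : ℂ[T;T⁻¹]) =
        a • (T (m + (m + 1 + n)) * toLaurent g ^ 2) := by
      rw [← Polynomial.C_mul_X_pow_eq_monomial, map_mul, map_mul, map_pow, toLaurent_X_pow,
        Polynomial.toLaurent_C, LaurentPolynomial.smul_eq_C_mul,
        show m + (m + 1 + n) = (2 * m + 1) + n by ring, LaurentPolynomial.T_add (2 * m + 1)]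
      ring
    rw [h4, map_smul, map_smul, h3, smul_zero]

end Virasoro

/-- A linear form on `P` which vanishes on `P ∩ Q` extends to a linear form which vanishes
on `Q`. -/
theorem Submodule.exists_extend_of_eq_zero {k V : Type*} [Field k] [AddCommGroup V] [Module k V]
    (P Q : Submodule k V) (φ : V →ₗ[k] k) (h : ∀ x ∈ P, x ∈ Q → φ x = 0) :
    ∃ ψ : V →ₗ[k] k, (∀ x ∈ P, ψ x = φ x) ∧ ∀ x ∈ Q, ψ x = 0 := by
  let F : V →ₗ.[k] k := ⟨P, φ.domRestrict P⟩
  let G : V →ₗ.[k] k := ⟨Q, 0⟩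
  have H : ∀ (x : F.domain) (y : G.domain), (x : V) = y → F x = G y := by
    intro x y hxy
    exact h x x.2 (hxy ▸ y.2)
  obtain ⟨ψ, hψ⟩ := LinearMap.exists_extend (F.sup G H).toFun
  have hψ' : ∀ x : (F.sup G H).domain, ψ x = F.sup G H x := fun x => LinearMap.congr_fun hψ x
  refine ⟨ψ, fun x hx => ?_, fun x hx => ?_⟩
  · have := LinearPMap.sup_apply H ⟨x, hx⟩ 0 ⟨x, Submodule.mem_sup_left hx⟩ (by simp)
    rw [LinearPMap.map_zero, add_zero] at this
    exact (hψ' ⟨x, Submodule.mem_sup_left hx⟩).trans this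
  · have := LinearPMap.sup_apply H 0 ⟨x, hx⟩ ⟨x, Submodule.mem_sup_right hx⟩ (by simp)
    rw [LinearPMap.map_zero, zero_add] at this
    exact (hψ' ⟨x, Submodule.mem_sup_right hx⟩).trans this

/-! ### Decomposition of the characters of 𝔟_m^f. -/

namespace Virasoro

open LaurentPolynomial (T)
open Polynomial (toLaurent X C)
open LieAlgebra (LieCharacter)

attribute [local instance] LieRing.ofAssociativeRing

theorem polySubalgebra_one : polySubalgebra 1 = ⊤ := by
  rw [eq_top_iff]
  exact fun x _ => mem_polySubalgebra_iff.2 ⟨theta x, by simp⟩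

section Decomposition

variable {f : Polynomial ℂ} (hf : f.coeff 0 ≠ 0) {m : ℤ} {hm : -1 ≤ m}

include hf

theorem polySubalgebra_sup_upperSubalgebra :
    (polySubalgebra f).toSubmodule ⊔ (upperSubalgebra m hm).toSubmodule = ⊤ := by
  rw [eq_top_iff]
  intro x _
  obtain ⟨q, r, h⟩ := exists_eq_toLaurent_add isCoprime_one_left (isCoprime_X hf) m (theta x)
  rw [one_mul] at h
  rw [← emb_theta_add x, h, map_add, add_comm (emb _), add_assoc]
  exact Submodule.add_mem_sup (emb_mem_polySubalgebra f r) (add_mem (emb_mem_upperSubalgebra m hm q)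
    ((upperSubalgebra m hm).smul_mem _ (z_mem_upperSubalgebra m hm)))

omit hf in
theorem emb_mem_upperSubalgebra_of_le {j : ℤ} (h : m ≤ j) (q : Polynomial ℂ) :
    emb (T j * toLaurent q) ∈ upperSubalgebra m hm := by
  refine mem_upperSubalgebra_iff.2 ⟨X ^ (j - m).toNat * q, ?_⟩
  rw [map_mul toLaurent, toLaurent_X_pow, ← mul_assoc, ← LaurentPolynomial.T_add, theta_emb]
  congr 2; omega

omit hf in
theorem emb_mem_restricted {j : ℤ} (h : m ≤ j) (q : Polynomial ℂ) :
    emb (T j * toLaurent (f * q)) ∈ restrictedSubalgebra f m hm :=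
  ⟨by rw [map_mul toLaurent, mul_left_comm]; exact emb_mem_polySubalgebra _ _,
    emb_mem_upperSubalgebra_of_le h _⟩

omit hf in
theorem eq_zero_of_upper {ψ : Virasoro →ₗ[ℂ] ℂ}
    (h : ∀ x ∈ upperSubalgebra m hm, ∀ y ∈ upperSubalgebra m hm, ψ ⁅x, y⁆ = 0)
    (q : Polynomial ℂ) : ψ (emb (T (2 * m + 1) * toLaurent q)) = 0 := by
  have h1 := eq_zero_of_lie_eq_zero_upper (g := 1) (fun x hx y hy => h x hx.2 y hy.2) q
  simpa using h1

/-- Classes modulo f have representatives in t^(2m+1) ℂ[t], which lies in t^m ℂ[t] because m ≥ -1.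
Characters of 𝔟_m kill that space, so they are determined by their restriction to 𝔟_m^f. -/
theorem exists_add_of_mem_upperSubalgebra {x : Virasoro} (hx : x ∈ upperSubalgebra m hm) :
    ∃ c ∈ restrictedSubalgebra f m hm, ∃ q, x = c + emb (T (2 * m + 1) * toLaurent q) := by
  obtain ⟨q, hq⟩ := mem_upperSubalgebra_iff.1 hx
  obtain ⟨s, r, hs⟩ := exists_eq_toLaurent_add isCoprime_one_left (isCoprime_X hf) (2 * m + 1)
    (theta x)
  rw [one_mul] at hs
  have h1 : T m * toLaurent (q - X ^ (m + 1).toNat * s) = toLaurent f * r := by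
    rw [map_sub, map_mul, mul_sub, ← hq, toLaurent_X_pow, ← mul_assoc, ← LaurentPolynomial.T_add,
      show m + ((m + 1).toNat : ℤ) = 2 * m + 1 by omega, hs]
    ring
  obtain ⟨q', -, rfl⟩ := exists_of_T_mul_eq (isCoprime_X hf) h1
  refine ⟨emb (T m * toLaurent (f * q')) + centralCoeff x • z,
    add_mem (emb_mem_restricted le_rfl q') ((restrictedSubalgebra f m hm).smul_mem _
      ⟨z_mem_polySubalgebra f, z_mem_upperSubalgebra m hm⟩), s, ?_⟩
  conv_lhs => rw [← emb_theta_add x, hs]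
  rw [map_add, map_mul toLaurent, mul_left_comm]
  abel

/-- On t^(2m+1) f ℂ[t] the second summand vanishes, so the sum determines α there; together with f²
ℂ[t^±] and z, which α kills, this space spans Vir^f. Then β is known on 𝔟_m^f, hence everywhere. -/
theorem addCharacter_injective {α α' : LieCharacter ℂ (polySubalgebra f)}
    {β β' : LieCharacter ℂ (upperSubalgebra m hm)}
    (h : LieSubalgebra.addCharacter α β = LieSubalgebra.addCharacter α' β') :
    α = α' ∧ β = β' := by
  obtain ⟨φ, hφ, rfl⟩ := exists_eq_characterOf α
  obtain ⟨φ', hφ', rfl⟩ := exists_eq_characterOf α'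
  obtain ⟨ψ, hψ, rfl⟩ := exists_eq_characterOf β
  obtain ⟨ψ', hψ', rfl⟩ := exists_eq_characterOf β'
  have h1 : ∀ x ∈ restrictedSubalgebra f m hm, φ x + ψ x = φ' x + ψ' x :=
    fun x hx => LieHom.congr_fun h ⟨x, hx⟩
  obtain ⟨hz, hφ2⟩ := eq_zero_of_lie_eq_zero hf hφ
  obtain ⟨hz', hφ2'⟩ := eq_zero_of_lie_eq_zero hf hφ'
  have h2 : ∀ x ∈ polySubalgebra f, φ x = φ' x := by
    intro x hx
    obtain ⟨a, ha⟩ := mem_polySubalgebra_iff.1 hx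
    obtain ⟨q, r, hq⟩ := exists_eq_toLaurent_add isCoprime_one_left (isCoprime_X hf) (2 * m + 1) a
    rw [one_mul] at hq
    have h3 := h1 _ (emb_mem_restricted (j := 2 * m + 1) (by omega) q)
    rw [eq_zero_of_upper hψ, eq_zero_of_upper hψ', add_zero, add_zero] at h3
    have h4 : toLaurent f * a = T (2 * m + 1) * toLaurent (f * q) + toLaurent f ^ 2 * r := by
      rw [hq, map_mul]; ring
    rw [← emb_theta_add x, ha, h4]
    simp only [map_add, map_smul, hz, hz', hφ2, hφ2', h3]
  refine ⟨LieHom.ext fun x => h2 x x.2, LieHom.ext fun ⟨x, hx⟩ => ?_⟩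
  change ψ x = ψ' x
  obtain ⟨c, hc, q, rfl⟩ := exists_add_of_mem_upperSubalgebra hf hx
  have h3 := h1 c hc
  rw [h2 c hc.1] at h3
  rw [map_add, map_add, eq_zero_of_upper hψ, eq_zero_of_upper hψ', add_left_cancel h3]

omit hf in
theorem euler_toLaurent (p : Polynomial ℂ) :
    euler (toLaurent p) = T 1 * toLaurent (Polynomial.derivative p) := by
  induction p using Polynomial.induction_on' with
  | add p q hp hq => simp only [map_add, hp, hq, mul_add]
  | monomial n a =>
    rw [← Polynomial.C_mul_X_pow_eq_monomial, ← Polynomial.smul_eq_C_mul, toLaurent_smul, map_smul,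
      toLaurent_X_pow, euler_T, Polynomial.derivative_smul, Polynomial.derivative_X_pow,
      toLaurent_smul, mul_smul_comm, map_mul, toLaurent_X_pow, Polynomial.toLaurent_C,
      ← LaurentPolynomial.smul_eq_C_mul, mul_smul_comm, ← LaurentPolynomial.T_add]
    rcases n with _ | n
    · simp
    · rw [Nat.add_sub_cancel, Nat.cast_succ (R := ℤ), add_comm 1 (n : ℤ)]
      congr 1

omit hf in
theorem lie_mem_of_mem_upperSubalgebra {x y : Virasoro} (hx : x ∈ upperSubalgebra m hm)
    (hy : y ∈ upperSubalgebra m hm) : ∃ q, ⁅x, y⁆ = emb (T (2 * m + 1) * toLaurent q) := by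
  obtain ⟨p, hp⟩ := mem_upperSubalgebra_iff.1 hx
  obtain ⟨q, hq⟩ := mem_upperSubalgebra_iff.1 hy
  refine ⟨p * Polynomial.derivative q - q * Polynomial.derivative p, ?_⟩
  rw [lie_eq, hp, hq, cocycle_eq_zero hm hm, zero_smul, add_zero, wittBracket_mul_mul, wittBracket,
    euler_toLaurent, euler_toLaurent, LaurentPolynomial.T_add, two_mul, LaurentPolynomial.T_add,
    map_sub toLaurent, map_mul toLaurent, map_mul toLaurent]
  refine congrArg emb ?_
  ring

/-- α is forced to be μ on t^(2m+1) f ℂ[t] and 0 on Vir^(f²); the two prescriptions agree because μ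
kills t^(2m+1) f² ℂ[t]. Likewise β must be μ - α on 𝔟_m^f and 0 on t^(2m+1) ℂ[t]. -/
theorem exists_addCharacter (μ : LieCharacter ℂ (restrictedSubalgebra f m hm)) :
    ∃ (α : LieCharacter ℂ (polySubalgebra f)) (β : LieCharacter ℂ (upperSubalgebra m hm)),
      μ = LieSubalgebra.addCharacter α β := by
  obtain ⟨M, hM, rfl⟩ := exists_eq_characterOf μ
  have hm' : -1 ≤ 2 * m + 1 := by omega
  have hX2 : IsCoprime X (f ^ 2) := (isCoprime_X hf).pow_right
  obtain ⟨φ, hφ, hφ0⟩ := Submodule.exists_extend_of_eq_zero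
    -- The kernel of `centralCoeff` keeps z out: α(z) = 0 is forced, while μ(z) is arbitrary and
    -- passes to β.
    ((restrictedSubalgebra f (2 * m + 1) hm').toSubmodule ⊓ LinearMap.ker centralCoeff)
    (polySubalgebra (f ^ 2)).toSubmodule M (by
      rintro x ⟨⟨-, hx⟩, hx0⟩ hxf
      obtain ⟨q, hq⟩ := mem_upperSubalgebra_iff.1 hx
      obtain ⟨r, hr⟩ := mem_polySubalgebra_iff.1 hxf
      obtain ⟨q', rfl, -⟩ := exists_of_T_mul_eq hX2 (hq.symm.trans hr)
      rw [← emb_theta_add x, LinearMap.mem_ker.1 hx0, zero_smul, add_zero, hq]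
      exact eq_zero_of_lie_eq_zero_upper hM q')
  obtain ⟨ψ, hψ, hψ0⟩ := Submodule.exists_extend_of_eq_zero
    (restrictedSubalgebra f m hm).toSubmodule
    ((upperSubalgebra (2 * m + 1) hm').toSubmodule ⊓ LinearMap.ker centralCoeff) (M - φ) (by
      rintro x hx ⟨hx1, hx0⟩
      rw [LinearMap.sub_apply, hφ x ⟨⟨hx.1, hx1⟩, hx0⟩, sub_self])
  have hφ' := lie_eq_zero_of_eq_zero (f := f) (hφ0 z (z_mem_polySubalgebra _)) fun g => by
    rw [← map_pow]; exact hφ0 _ (emb_mem_polySubalgebra _ _)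
  have hψ' : ∀ x ∈ upperSubalgebra m hm, ∀ y ∈ upperSubalgebra m hm, ψ ⁅x, y⁆ = 0 := by
    intro x hx y hy
    obtain ⟨q, hq⟩ := lie_mem_of_mem_upperSubalgebra hx hy
    rw [hq]
    exact hψ0 _ ⟨emb_mem_upperSubalgebra _ hm' q, centralCoeff_emb _⟩
  refine ⟨characterOf _ φ hφ', characterOf _ ψ hψ', LieHom.ext fun ⟨x, hx⟩ => ?_⟩
  change M x = φ x + ψ x
  rw [hψ x hx, LinearMap.sub_apply, add_sub_cancel]

theorem existsUnique_addCharacter (μ : LieCharacter ℂ (restrictedSubalgebra f m hm)) :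
    ∃! d : LieCharacter ℂ (polySubalgebra f) × LieCharacter ℂ (upperSubalgebra m hm),
      μ = LieSubalgebra.addCharacter d.1 d.2 := by
  obtain ⟨α, β, rfl⟩ := exists_addCharacter hf μ
  exact ⟨(α, β), rfl, fun d hd => Prod.ext (addCharacter_injective hf hd).1.symm
    (addCharacter_injective hf hd).2.symm⟩

end Decomposition

end Virasoro

end

/-! ### Linear forms t^j ↦ p(j) l^j and powers of t - l. -/

noncomputable section

namespace Virasoro

open LaurentPolynomial (T)
open Polynomial (toLaurent X C)
open LieAlgebra (LieCharacter)

attribute [local instance] LieRing.ofAssociativeRing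

theorem linearMap_ext_T {M : Type*} [AddCommMonoid M] [Module ℂ M] {φ ψ : ℂ[T;T⁻¹] →ₗ[ℂ] M}
    (h : ∀ j, φ (T j) = ψ (T j)) : φ = ψ := by
  refine LinearMap.ext fun f => ?_
  induction f using induction_T with
  | add p q hp hq => rw [map_add, map_add, hp, hq]
  | smul c p hp => rw [map_smul, map_smul, hp]
  | mono n => exact h n

/-- The linear form on Laurent polynomials with `t ^ j ↦ p(j) l ^ j`. -/
def assocForm (l : ℂ) (p : Polynomial ℂ) : ℂ[T;T⁻¹] →ₗ[ℂ] ℂ :=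
  (Finsupp.linearCombination ℂ fun j : ℤ => p.eval (j : ℂ) * l ^ j) ∘ₗ
    (AddMonoidAlgebra.coeffLinearEquiv ℂ).toLinearMap

theorem assocForm_T (l : ℂ) (p : Polynomial ℂ) (j : ℤ) :
    assocForm l p (T j) = p.eval (j : ℂ) * l ^ j := by
  simp [assocForm, T, -LaurentPolynomial.single_eq_C_mul_T]

theorem assocForm_add (l : ℂ) (p q : Polynomial ℂ) :
    assocForm l (p + q) = assocForm l p + assocForm l q :=
  linearMap_ext_T fun j => by simp [assocForm_T, add_mul]

theorem assocForm_smul (l c : ℂ) (p : Polynomial ℂ) :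
    assocForm l (c • p) = c • assocForm l p :=
  linearMap_ext_T fun j => by simp [assocForm_T, mul_assoc]

/-- The form of p is p(t d/dt) followed by evaluation at l, so its order of differentiation is deg
p. -/
theorem assocForm_X_mul (l : ℂ) (p : Polynomial ℂ) (h : ℂ[T;T⁻¹]) :
    assocForm l (X * p) h = assocForm l p (euler h) := by
  have : assocForm l (X * p) = assocForm l p ∘ₗ euler :=
    linearMap_ext_T fun j => by simp [assocForm_T, euler_T, mul_assoc]
  rw [this, LinearMap.comp_apply]

/-- Evaluation of Laurent polynomials at `l`. -/
def evalAt (l : ℂ) : ℂ[T;T⁻¹] →ₗ[ℂ] ℂ := assocForm l 1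

theorem evalAt_T (l : ℂ) (j : ℤ) : evalAt l (T j) = l ^ j := by
  simp [evalAt, assocForm_T]

theorem evalAt_one (l : ℂ) : evalAt l 1 = 1 := by
  rw [← LaurentPolynomial.T_zero, evalAt_T, zpow_zero]

variable {l : ℂ} (hl : l ≠ 0)

include hl in
theorem evalAt_mul (f g : ℂ[T;T⁻¹]) : evalAt l (f * g) = evalAt l f * evalAt l g := by
  induction f using induction_T with
  | add p q hp hq => rw [add_mul, map_add, map_add, hp, hq, add_mul]
  | smul c p hp => rw [smul_mul_assoc, map_smul, map_smul, hp, smul_mul_assoc]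
  | mono n =>
    induction g using induction_T with
    | add p q hp hq => rw [mul_add, map_add, map_add, hp, hq, mul_add]
    | smul c p hp => rw [mul_smul_comm, map_smul, map_smul, hp, mul_smul_comm]
    | mono k => rw [← LaurentPolynomial.T_add, evalAt_T, evalAt_T, evalAt_T, zpow_add₀ hl]

theorem evalAt_toLaurent (p : Polynomial ℂ) : evalAt l (toLaurent p) = p.eval l := by
  induction p using Polynomial.induction_on' with
  | add p q hp hq => rw [map_add, map_add, hp, hq, Polynomial.eval_add]
  | monomial n a =>
    rw [← Polynomial.C_mul_X_pow_eq_monomial, ← Polynomial.smul_eq_C_mul, toLaurent_smul, map_smul,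
      toLaurent_X_pow, evalAt_T, Polynomial.eval_smul, Polynomial.eval_pow, Polynomial.eval_X,
      zpow_natCast]

/-- The Laurent polynomial `t - l`. -/
def lin (l : ℂ) : ℂ[T;T⁻¹] := toLaurent (X - C l)

theorem evalAt_lin : evalAt l (lin l) = 0 := by
  rw [lin, evalAt_toLaurent]; simp

theorem toLaurent_lin_pow (n : ℕ) : toLaurent ((X - C l) ^ n) = lin l ^ n := map_pow _ _ _

theorem euler_lin : euler (lin l) = T 1 := by
  rw [lin, euler_toLaurent]; simp

theorem euler_lin_pow_mul (k : ℕ) (h : ℂ[T;T⁻¹]) :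
    euler (lin l ^ (k + 1) * h) = lin l ^ k * ((k + 1 : ℂ) • (T 1 * h) + lin l * euler h) := by
  induction k generalizing h with
  | zero => rw [zero_add, pow_one, euler_mul, euler_lin]; simp; ring
  | succ k ih =>
    rw [pow_succ (lin l) (k + 1), mul_assoc, ih, euler_mul, euler_lin]
    push_cast
    simp only [LaurentPolynomial.smul_eq_C_mul, map_add, map_one]
    ring

include hl in
theorem exists_eq_evalAt_add (h : ℂ[T;T⁻¹]) :
    ∃ r, h = algebraMap ℂ _ (evalAt l h) + lin l * r := by
  induction h using induction_T with
  | add p q hp hq =>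
    obtain ⟨r, hr⟩ := hp
    obtain ⟨s, hs⟩ := hq
    exact ⟨r + s, by rw [map_add, map_add]; linear_combination hr + hs⟩
  | smul c p hp =>
    obtain ⟨r, hr⟩ := hp
    refine ⟨c • r, ?_⟩
    conv_lhs => rw [hr]
    rw [map_smul, smul_add, mul_smul_comm, smul_eq_mul, map_mul, Algebra.smul_def c]
  | mono j =>
    rw [evalAt_T]
    have hpow : ∀ n : ℕ, ∃ r, (T n : ℂ[T;T⁻¹]) = algebraMap ℂ _ (l ^ n) + lin l * r := by
      intro n
      obtain ⟨r, hr⟩ := sub_dvd_pow_sub_pow (X : Polynomial ℂ) (C l) n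
      refine ⟨toLaurent r, ?_⟩
      rw [lin, ← map_mul, ← hr, map_sub, toLaurent_X_pow, ← Polynomial.C_pow,
        Polynomial.toLaurent_C, LaurentPolynomial.algebraMap_apply]
      simp
    obtain ⟨n, rfl | rfl⟩ := j.eq_nat_or_neg
    · simpa using hpow n
    · obtain ⟨r, hr⟩ := hpow n
      refine ⟨-(T (-n) * algebraMap ℂ _ (l ^ (-n : ℤ)) * r), ?_⟩
      have h1 : (T n * T (-n) : ℂ[T;T⁻¹]) = 1 := by rw [← LaurentPolynomial.T_add]; simp
      have h2 : algebraMap ℂ ℂ[T;T⁻¹] (l ^ n) * algebraMap ℂ _ (l ^ (-n : ℤ)) = 1 := by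
        rw [← map_mul, ← zpow_natCast, ← zpow_add₀ hl, add_neg_cancel, zpow_zero, map_one]
      linear_combination (-T (-n) * algebraMap ℂ _ (l ^ (-n : ℤ))) * hr +
        algebraMap ℂ ℂ[T;T⁻¹] (l ^ (-n : ℤ)) * h1 - T (-n) * h2

include hl in
-- Each application of t d/dt removes at most one factor t - l, and removing one of k of them
-- contributes k l at t = l.
theorem assocForm_X_pow (i : ℕ) : (∀ h, assocForm l (X ^ i) (lin l ^ i * h) =
      i.factorial * l ^ i * evalAt l h) ∧
    ∀ k, i < k → ∀ h, assocForm l (X ^ i) (lin l ^ k * h) = 0 := by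
  induction i with
  | zero =>
    have : assocForm l (X ^ 0) = evalAt l := by rw [pow_zero]; rfl
    refine ⟨fun h => by rw [this]; simp, fun k hk h => ?_⟩
    obtain ⟨k, rfl⟩ := Nat.exists_eq_succ_of_ne_zero hk.ne'
    rw [this, pow_succ', mul_assoc, evalAt_mul hl, evalAt_lin, zero_mul]
  | succ i ih =>
    refine ⟨fun h => ?_, fun k hk h => ?_⟩
    · rw [pow_succ' X, assocForm_X_mul, euler_lin_pow_mul, ih.1, map_add, map_smul,
        evalAt_mul hl, evalAt_mul hl, evalAt_lin, evalAt_T, Nat.factorial_succ]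
      push_cast
      simp only [smul_eq_mul, zpow_one]
      ring
    · obtain ⟨k, rfl⟩ := Nat.exists_eq_succ_of_ne_zero (Nat.ne_zero_of_lt hk)
      rw [pow_succ' X, assocForm_X_mul, euler_lin_pow_mul]
      exact ih.2 k (by omega) _

theorem assocForm_eq_sum (p : Polynomial ℂ) (h : ℂ[T;T⁻¹]) :
    assocForm l p h = ∑ i ∈ Finset.range (p.natDegree + 1),
      p.coeff i * assocForm l (X ^ i) h := by
  let Φ : Polynomial ℂ →ₗ[ℂ] ℂ :=
    { toFun := fun p => assocForm l p h
      map_add' := fun p q => by rw [assocForm_add, LinearMap.add_apply]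
      map_smul' := fun c p => by rw [assocForm_smul, LinearMap.smul_apply]; rfl }
  change Φ p = ∑ i ∈ Finset.range (p.natDegree + 1), p.coeff i * Φ (X ^ i)
  conv_lhs => rw [p.as_sum_range_C_mul_X_pow]
  simp only [map_sum, ← Polynomial.smul_eq_C_mul, map_smul, smul_eq_mul]

include hl in
theorem assocForm_of_natDegree_lt {p : Polynomial ℂ} {k : ℕ} (hk : p.natDegree < k)
    (h : ℂ[T;T⁻¹]) : assocForm l p (lin l ^ k * h) = 0 := by
  rw [assocForm_eq_sum]
  refine Finset.sum_eq_zero fun i hi => ?_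
  rw [(assocForm_X_pow hl i).2 k (by rw [Finset.mem_range] at hi; omega), mul_zero]

include hl in
theorem assocForm_natDegree (p : Polynomial ℂ) (h : ℂ[T;T⁻¹]) :
    assocForm l p (lin l ^ p.natDegree * h) =
      p.leadingCoeff * (p.natDegree.factorial * l ^ p.natDegree) * evalAt l h := by
  rw [assocForm_eq_sum, Finset.sum_range_succ, Finset.sum_eq_zero, zero_add,
    (assocForm_X_pow hl _).1, Polynomial.leadingCoeff]
  · ring
  intro i hi
  rw [(assocForm_X_pow hl i).2 _ (Finset.mem_range.1 hi), mul_zero]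

include hl in
-- A form killing (t-l)^(n+1) is fixed on ⟨(t-l)^n⟩ by one number, and subtracting a multiple of the
-- form of X^n makes that number zero.
theorem exists_eq_assocForm (n : ℕ) (φ : ℂ[T;T⁻¹] →ₗ[ℂ] ℂ) (hφ : ∀ h, φ (lin l ^ n * h) = 0) :
    ∃ p, φ = assocForm l p := by
  induction n generalizing φ with
  | zero => exact ⟨0, linearMap_ext_T fun j => by simpa [assocForm_T] using hφ (T j)⟩
  | succ n ih =>
    let c := φ (lin l ^ n) / (n.factorial * l ^ n)
    have hc : c * (n.factorial * l ^ n) = φ (lin l ^ n) :=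
      div_mul_cancel₀ _ (mul_ne_zero (Nat.cast_ne_zero.2 n.factorial_ne_zero) (pow_ne_zero n hl))
    obtain ⟨p, hp⟩ := ih (φ - c • assocForm l (X ^ n)) fun h => by
      obtain ⟨r, hr⟩ := exists_eq_evalAt_add hl h
      have h1 : φ (lin l ^ n * h) = evalAt l h * φ (lin l ^ n) := by
        conv_lhs => rw [hr]
        rw [mul_add, map_add, ← mul_assoc, ← pow_succ, hφ, add_zero, mul_comm,
          ← Algebra.smul_def, map_smul, smul_eq_mul]
      rw [LinearMap.sub_apply, LinearMap.smul_apply, (assocForm_X_pow hl n).1, h1, ← hc,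
        smul_eq_mul]
      ring
    exact ⟨p + c • X ^ n, by rw [assocForm_add, assocForm_smul, ← hp, sub_add_cancel]⟩

theorem xVec_eq (f : Polynomial ℂ) (j : ℤ) : xVec f j = emb (toLaurent f * T j) := by
  refine ext' (by rw [theta_xVec, theta_emb, mul_comm]) ?_
  simp [xVec]

theorem isAssociated_characterOf {n : ℕ} {ψ : Virasoro →ₗ[ℂ] ℂ}
    (h : ∀ x ∈ polySubalgebra ((X - C l) ^ n), ∀ y ∈ polySubalgebra ((X - C l) ^ n), ψ ⁅x, y⁆ = 0)
    {p : Polynomial ℂ} : IsAssociated (characterOf _ ψ h) p ↔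
      ∀ g, ψ (emb (lin l ^ n * g)) = assocForm l p g := by
  have h1 : IsAssociated (characterOf _ ψ h) p ↔
      ∀ j : ℤ, ψ (emb (lin l ^ n * T j)) = assocForm l p (T j) := by
    simp only [IsAssociated, characterOf_apply, xVec_eq, toLaurent_lin_pow, assocForm_T]
  rw [h1]
  refine ⟨fun h2 g => ?_, fun h2 j => h2 _⟩
  have : ψ ∘ₗ emb ∘ₗ LinearMap.mulLeft ℂ (lin l ^ n) = assocForm l p := linearMap_ext_T h2
  exact LinearMap.congr_fun this g

end Virasoro

end

/-! ### The weight filtration on a module induced from Vir^((t-l)^n). -/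

noncomputable section

namespace Virasoro

open LaurentPolynomial (T)
open Polynomial (toLaurent X C)
open LieAlgebra (LieCharacter)

attribute [local instance] LieRing.ofAssociativeRing

theorem lin_mul_euler_lin_pow (l : ℂ) (b : ℕ) :
    lin l * euler (lin l ^ b) = (b : ℂ) • (lin l ^ b * T 1) := by
  rcases b with _ | b
  · have : euler 1 = 0 := by simpa using euler_T 0
    simp [this]
  · have h1 : euler 1 = 0 := by simpa using euler_T 0
    have := euler_lin_pow_mul (l := l) b 1
    rw [mul_one, h1, mul_zero, add_zero, mul_one] at this
    rw [this, mul_smul_comm, mul_smul_comm, pow_succ']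
    push_cast
    rw [mul_assoc]

theorem mem_polySubalgebra_lin {l : ℂ} {i : ℕ} {x : Virasoro} :
    x ∈ polySubalgebra ((X - C l) ^ i) ↔ ∃ h, theta x = lin l ^ i * h := by
  rw [mem_polySubalgebra_iff, toLaurent_lin_pow]

/-- The second term carries one more factor t - l, so the leading coefficient is the difference b -
(i + 1) of the exponents times l h(l). -/
theorem theta_lie_emb_lin_pow {l : ℂ} {i : ℕ} {x : Virasoro} {h : ℂ[T;T⁻¹]}
    (hx : theta x = lin l ^ (i + 1) * h) (b : ℕ) :
    theta ⁅x, emb (lin l ^ b)⁆ =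
      lin l ^ (i + b) * (((b : ℂ) - (i + 1)) • (T 1 * h) - lin l * euler h) := by
  have h1 := lin_mul_euler_lin_pow l b
  rw [theta_lie, hx, theta_emb, wittBracket, euler_lin_pow_mul]
  simp only [LaurentPolynomial.smul_eq_C_mul, map_sub, map_add, map_one] at h1 ⊢
  linear_combination (lin l ^ i * h) * h1

theorem lie_mem_polySubalgebra_lin {l : ℂ} {i : ℕ} {x : Virasoro}
    (hx : x ∈ polySubalgebra ((X - C l) ^ (i + 1))) (b : ℕ) :
    ⁅x, emb (lin l ^ b)⁆ ∈ polySubalgebra ((X - C l) ^ (i + b)) := by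
  obtain ⟨h, hh⟩ := mem_polySubalgebra_lin.1 hx
  exact mem_polySubalgebra_lin.2 ⟨_, theta_lie_emb_lin_pow hh b⟩

theorem polySubalgebra_lin_anti {l : ℂ} {i j : ℕ} (h : i ≤ j) :
    polySubalgebra ((X - C l) ^ j) ≤ polySubalgebra ((X - C l) ^ i) :=
  polySubalgebra_le (pow_dvd_pow _ h)

theorem sub_evalAt_smul_mem {l : ℂ} (hl : l ≠ 0) {j : ℕ} {x : Virasoro} {h : ℂ[T;T⁻¹]}
    (hx : theta x = lin l ^ j * h) :
    x - evalAt l h • emb (lin l ^ j) ∈ polySubalgebra ((X - C l) ^ (j + 1)) := by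
  obtain ⟨r, hr⟩ := exists_eq_evalAt_add hl h
  refine mem_polySubalgebra_lin.2 ⟨r, ?_⟩
  rw [map_sub, hx, map_smul, theta_emb, Algebra.smul_def]
  linear_combination lin l ^ j * hr

theorem lie_lin_pow_mem (l : ℂ) (a b : ℕ) :
    ⁅emb (lin l ^ a), emb (lin l ^ b)⁆ ∈ polySubalgebra ((X - C l) ^ (a + b - 1)) := by
  have key : ∀ a b : ℕ, ⁅emb (lin l ^ (a + 1)), emb (lin l ^ b)⁆ ∈
      polySubalgebra ((X - C l) ^ (a + 1 + b - 1)) := by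
    intro a b
    rw [show a + 1 + b - 1 = a + b by omega]
    exact lie_mem_polySubalgebra_lin (mem_polySubalgebra_lin.2 ⟨1, by simp⟩) b
  rcases a with _ | a
  · rcases b with _ | b
    · rw [lie_self]; exact zero_mem _
    · rw [← lie_skew, add_comm]; exact neg_mem (key b 0)
  · exact key a b

/-- The linear form `ψ` restricts to a character of `Vir^{(t - l)^n}` which is nonzero on
`(t - l)^N` and vanishes on the higher powers of `t - l`, where `N ≥ 2n - 2`. -/
structure HasTopDegree (l : ℂ) (n N : ℕ) (c : ℂ) (ψ : Virasoro →ₗ[ℂ] ℂ) : Prop where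
  root_ne_zero : l ≠ 0
  one_le : 1 ≤ n
  le : n ≤ N
  two_mul_le : 2 * n ≤ N + 2
  ne_zero : c ≠ 0
  apply_z : ψ z = 0
  apply_top : ∀ h, ψ (emb (lin l ^ N * h)) = c * evalAt l h
  apply_of_lt : ∀ k, N < k → ∀ h, ψ (emb (lin l ^ k * h)) = 0

namespace HasTopDegree

variable {l c : ℂ} {n N : ℕ} {ψ : Virasoro →ₗ[ℂ] ℂ} (H : HasTopDegree l n N c ψ)

include H

theorem apply_eq (x : Virasoro) : ψ x = ψ (emb (theta x)) := by
  conv_lhs => rw [← emb_theta_add x]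
  rw [map_add, map_smul, H.apply_z, smul_zero, add_zero]

theorem apply_eq_top {x : Virasoro} {h : ℂ[T;T⁻¹]} (hx : theta x = lin l ^ N * h) :
    ψ x = c * evalAt l h := by
  rw [H.apply_eq, hx, H.apply_top]

theorem apply_eq_zero {x : Virasoro} {k : ℕ} (hk : N < k)
    (hx : x ∈ polySubalgebra ((X - C l) ^ k)) : ψ x = 0 := by
  obtain ⟨h, hh⟩ := mem_polySubalgebra_lin.1 hx
  rw [H.apply_eq, hh, H.apply_of_lt k hk]

end HasTopDegree

theorem replicate_of_lt_one {ω : List ℕ} (h : ∀ a ∈ ω, a < 1) : ω = List.replicate ω.length 0 :=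
  List.eq_replicate_length.2 fun a ha => Nat.lt_one_iff.1 (h a ha)

section Filtration

variable {V : Type*} [AddCommGroup V] [Module ℂ V] [LieRingModule Virasoro V]
  (l : ℂ) (n N : ℕ) (v₀ : V)

/-- The product of the operators `(t - l)^a`, for `a` in a list, applied to `v₀`. -/
def word : List ℕ → V
  | [] => v₀
  | a :: ω => ⁅emb (lin l ^ a), word ω⁆

/-- The weight of a word, when the letter `a` has weight `N + 1 - 2a`. -/
def weight : List ℕ → ℤ
  | [] => 0
  | a :: ω => (N + 1 - 2 * a : ℤ) + weight ω

theorem weight_replicate (k : ℕ) : weight 1 (List.replicate k 0) = 2 * k := by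
  induction k with
  | zero => rfl
  | succ k ih => rw [List.replicate_succ, weight, ih]; push_cast; ring

/-- The span of the words in the letters below `n` of weight at most `d`. -/
def filt (d : ℤ) : Submodule ℂ V :=
  Submodule.span ℂ {v | ∃ ω : List ℕ, (∀ a ∈ ω, a < n) ∧ weight N ω ≤ d ∧ v = word l v₀ ω}

variable {l n N v₀}

theorem word_mem_filt {ω : List ℕ} (hω : ∀ a ∈ ω, a < n) {d : ℤ} (hd : weight N ω ≤ d) :
    word l v₀ ω ∈ filt l n N v₀ d :=
  Submodule.subset_span ⟨ω, hω, hd, rfl⟩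

theorem filt_mono {d e : ℤ} (h : d ≤ e) : filt l n N v₀ d ≤ filt l n N v₀ e :=
  Submodule.span_mono fun _ ⟨ω, h1, h2, h3⟩ => ⟨ω, h1, h2.trans h, h3⟩

theorem filt_induction {d : ℤ} (K : Submodule ℂ V)
    (h : ∀ ω : List ℕ, (∀ a ∈ ω, a < n) → weight N ω ≤ d → word l v₀ ω ∈ K) :
    filt l n N v₀ d ≤ K :=
  Submodule.span_le.2 fun _ ⟨ω, h1, h2, h3⟩ => h3 ▸ h ω h1 h2

variable {c : ℂ} {ψ : Virasoro →ₗ[ℂ] ℂ} (H : HasTopDegree l n N c ψ)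

include H in
-- For a < n one has 2a ≤ 2n - 2 ≤ N, so each letter weighs at least 1. This is the use of large
-- degree.
theorem HasTopDegree.weight_nonneg {ω : List ℕ} (hω : ∀ a ∈ ω, a < n) :
    (ω.length : ℤ) ≤ weight N ω := by
  induction ω with
  | nil => simp [weight]
  | cons a ω ih =>
    have h1 := ih fun b hb => hω b (List.mem_cons_of_mem _ hb)
    have h2 := hω a List.mem_cons_self
    have h3 := H.two_mul_le
    rw [weight, List.length_cons]
    push_cast
    omega

include H in
theorem HasTopDegree.filt_of_neg {d : ℤ} (hd : d < 0) : filt l n N v₀ d = ⊥ := by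
  rw [eq_bot_iff]
  refine filt_induction _ fun ω h1 h2 => ?_
  have := H.weight_nonneg h1
  omega

include H in
theorem HasTopDegree.filt_zero_le : filt l n N v₀ 0 ≤ ℂ ∙ v₀ := by
  refine filt_induction _ fun ω h1 h2 => ?_
  have := H.weight_nonneg h1
  obtain rfl : ω = [] := List.length_eq_zero_iff.1 (by omega)
  exact Submodule.mem_span_singleton_self _

variable [LieModule ℂ Virasoro V]

theorem lie_mem_filt {b : ℕ} (hb : b < n) {d e : ℤ} (hde : d + (N + 1 - 2 * b) ≤ e) {v : V}
    (hv : v ∈ filt l n N v₀ d) : ⁅emb (lin l ^ b), v⁆ ∈ filt l n N v₀ e := by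
  have h : filt l n N v₀ d ≤
      (filt l n N v₀ e).comap (LieModule.toEnd ℂ Virasoro V (emb (lin l ^ b))) := by
    refine filt_induction _ fun ω h1 h2 => ?_
    refine word_mem_filt (ω := b :: ω) ?_ ?_
    · intro a ha
      rcases List.mem_cons.1 ha with rfl | ha
      · exact hb
      · exact h1 a ha
    · rw [weight]; omega
  exact h hv

include H

variable (hv₀ : ∀ x ∈ polySubalgebra ((X - C l) ^ n), ⁅x, v₀⁆ = ψ x • v₀)

include hv₀

/-- After subtracting its scalar, an element of ⟨(t-l)^i⟩ shifts the filtration by N + 1 - 2i, the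
weight that a letter would have. It is commuted past the first letter b, which produces an element
of ⟨(t-l)^(i+b-1)⟩. -/
theorem HasTopDegree.lie_word_sub_mem (ω : List ℕ) : (∀ a ∈ ω, a < n) →
    ∀ (i : ℕ), n ≤ i → ∀ x ∈ polySubalgebra ((X - C l) ^ i),
      ⁅x, word l v₀ ω⁆ - ψ x • word l v₀ ω ∈ filt l n N v₀ (weight N ω + (N + 1 - 2 * i)) := by
  have hn := H.one_le
  have hnN := H.le
  induction ω with
  | nil =>
    intro _ i hi x hx
    rw [word, hv₀ x (polySubalgebra_lin_anti hi hx), sub_self]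
    exact zero_mem _
  | cons b ω ih =>
    intro hω i hi x hx
    have hω' : ∀ a ∈ ω, a < n := fun a ha => hω a (List.mem_cons_of_mem _ ha)
    have hb : b < n := hω b List.mem_cons_self
    obtain ⟨i, rfl⟩ : ∃ k, i = k + 1 := ⟨i - 1, by omega⟩
    have hlie := lie_mem_polySubalgebra_lin hx b
    have hword : ∀ {d : ℤ}, weight N ω ≤ d → word l v₀ ω ∈ filt l n N v₀ d :=
      fun hd => word_mem_filt hω' hd
    have e1 : ⁅x, word l v₀ (b :: ω)⁆ - ψ x • word l v₀ (b :: ω) =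
        ⁅emb (lin l ^ b), ⁅x, word l v₀ ω⁆ - ψ x • word l v₀ ω⁆ +
          ⁅⁅x, emb (lin l ^ b)⁆, word l v₀ ω⁆ := by
      rw [word, lie_sub, lie_smul, leibniz_lie x]
      abel
    rw [e1, weight]
    refine add_mem (lie_mem_filt hb (by omega) (ih hω' _ hi x hx)) ?_
    -- The bracket leaves ⟨(t-l)^n⟩ only if b = 0 and i + 1 = n; it is then a multiple of the letter
    -- (t-l)^(n-1) plus an element of ⟨(t-l)^n⟩.
    rcases Nat.lt_or_ge (i + b) n with hib | hib
    · obtain ⟨rfl, hi'⟩ : b = 0 ∧ i + 1 = n := by omega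
      obtain ⟨h, hh⟩ := mem_polySubalgebra_lin.1 hlie
      let y := ⁅x, emb (lin l ^ 0)⁆ - evalAt l h • emb (lin l ^ i)
      have hy : y ∈ polySubalgebra ((X - C l) ^ (i + 1)) := by
        exact sub_evalAt_smul_mem H.root_ne_zero (by rw [hh, add_zero])
      have e2 : ⁅⁅x, emb (lin l ^ 0)⁆, word l v₀ ω⁆ =
          evalAt l h • ⁅emb (lin l ^ i), word l v₀ ω⁆ +
            ((⁅y, word l v₀ ω⁆ - ψ y • word l v₀ ω) + ψ y • word l v₀ ω) := by
        rw [sub_add_cancel, sub_lie, smul_lie]; abel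
      rw [e2]
      refine add_mem (Submodule.smul_mem _ _ (lie_mem_filt (b := i) (by omega) ?_ (hword le_rfl)))
        (add_mem (filt_mono ?_ (ih hω' _ hi'.ge y hy)) (Submodule.smul_mem _ _ (hword ?_)))
      all_goals push_cast; omega
    · have e2 : ⁅⁅x, emb (lin l ^ b)⁆, word l v₀ ω⁆ =
          (⁅⁅x, emb (lin l ^ b)⁆, word l v₀ ω⁆ - ψ ⁅x, emb (lin l ^ b)⁆ • word l v₀ ω) +
            ψ ⁅x, emb (lin l ^ b)⁆ • word l v₀ ω := by abel
      rw [e2]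
      refine add_mem (filt_mono ?_ (ih hω' _ hib _ hlie)) ?_
      · push_cast; omega
      -- The scalar of the bracket is zero beyond the power N; up to it, the target degree is at
      -- least the weight of `ω`.
      · rcases Nat.lt_or_ge N (i + b) with h1 | h1
        · rw [H.apply_eq_zero h1 hlie, zero_smul]; exact zero_mem _
        · exact Submodule.smul_mem _ _ (hword (by push_cast; omega))

theorem HasTopDegree.lie_sub_mem {i : ℕ} (hi : n ≤ i) {x : Virasoro}
    (hx : x ∈ polySubalgebra ((X - C l) ^ i)) {d e : ℤ} (hde : d + (N + 1 - 2 * i) ≤ e) {v : V}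
    (hv : v ∈ filt l n N v₀ d) : ⁅x, v⁆ - ψ x • v ∈ filt l n N v₀ e := by
  have h : filt l n N v₀ d ≤
      (filt l n N v₀ e).comap (LieModule.toEnd ℂ Virasoro V x - ψ x • 1) :=
    filt_induction _ fun ω h1 h2 => filt_mono (by omega) (H.lie_word_sub_mem hv₀ ω h1 i hi x hx)
  exact h hv

/-- The condition d ≤ e absorbs the scalar of an element of ⟨(t-l)^n⟩. Below the power n, the
leading term is a multiple of the letter (t-l)^j, and removing it raises j. -/
theorem HasTopDegree.lie_mem {d e : ℤ} (hde : d ≤ e) {v : V} (hv : v ∈ filt l n N v₀ d) (j : ℕ) :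
    ∀ x ∈ polySubalgebra ((X - C l) ^ j), d + (N + 1 - 2 * j) ≤ e →
      ⁅x, v⁆ ∈ filt l n N v₀ e := by
  have hn2 := H.two_mul_le
  have hge : ∀ j, n ≤ j → ∀ x ∈ polySubalgebra ((X - C l) ^ j), d + (N + 1 - 2 * j) ≤ e →
      ⁅x, v⁆ ∈ filt l n N v₀ e := by
    intro j hj x hx he
    rw [← sub_add_cancel ⁅x, v⁆ (ψ x • v)]
    exact add_mem (H.lie_sub_mem hv₀ hj hx he hv) (Submodule.smul_mem _ _ (filt_mono hde hv))
  rcases Nat.lt_or_ge n j with hj | hj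
  · exact hge j hj.le
  induction hj using Nat.decreasingInduction with
  | self => exact hge n le_rfl
  | of_succ j hj ih =>
    intro x hx he
    obtain ⟨h, hh⟩ := mem_polySubalgebra_lin.1 hx
    have hy := sub_evalAt_smul_mem H.root_ne_zero hh
    have e2 : ⁅x, v⁆ = evalAt l h • ⁅emb (lin l ^ j), v⁆ +
        ⁅x - evalAt l h • emb (lin l ^ j), v⁆ := by
      rw [sub_lie, smul_lie]; abel
    rw [e2]
    exact add_mem (Submodule.smul_mem _ _ (lie_mem_filt hj he hv)) (ih _ hy (by push_cast; omega))

theorem HasTopDegree.exists_mem_filt (v : V)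
    (hgen : ∀ P : Submodule ℂ V, v₀ ∈ P → (∀ (x : Virasoro), ∀ w ∈ P, ⁅x, w⁆ ∈ P) → P = ⊤) :
    ∃ d : ℕ, v ∈ filt l n N v₀ d := by
  have hmono : Monotone fun d : ℕ => filt l n N v₀ (d : ℤ) := fun d e hde =>
    filt_mono (by exact_mod_cast hde)
  have h := hgen (⨆ d : ℕ, filt l n N v₀ d)
    (Submodule.mem_iSup_of_mem 0 (word_mem_filt (ω := []) (by simp) (by simp [weight]))) ?_
  · exact (Submodule.mem_iSup_of_directed _ hmono.directed_le).1 (h ▸ Submodule.mem_top)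
  · intro x w hw
    obtain ⟨d, hd⟩ := (Submodule.mem_iSup_of_directed _ hmono.directed_le).1 hw
    refine Submodule.mem_iSup_of_mem (d + (N + 1)) (H.lie_mem hv₀ ?_ hd 0 x ?_ ?_)
    · push_cast; omega
    · exact mem_polySubalgebra_lin.2 ⟨theta x, by simp⟩
    · push_cast; omega

/-- The element (t-l)^(N+1-a) g is dual to the letter (t-l)^a: their bracket has scalar -c l g(l) (N
+ 1 - 2a). On the graded space it acts like a derivative, and the sum like an Euler operator, with
eigenvalue proportional to the weight. Brackets between letters lose degree N - 1, so they are
negligible just when N ≥ 2. -/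
theorem HasTopDegree.euler_word (hN : 2 ≤ N) (g : ℂ[T;T⁻¹]) (ω : List ℕ) :
    (∀ a ∈ ω, a < n) →
    ∑ a ∈ Finset.range n, ⁅emb (lin l ^ a), ⁅emb (lin l ^ (N + 1 - a) * g), word l v₀ ω⁆ -
        ψ (emb (lin l ^ (N + 1 - a) * g)) • word l v₀ ω⁆ +
      (c * l * evalAt l g * weight N ω) • word l v₀ ω ∈ filt l n N v₀ (weight N ω - 1) := by
  have hn2 := H.two_mul_le
  have hnN := H.le
  let Y : ℕ → Virasoro := fun a => emb (lin l ^ (N + 1 - a) * g)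
  have hY : ∀ a, Y a ∈ polySubalgebra ((X - C l) ^ (N + 1 - a)) := fun a =>
    mem_polySubalgebra_lin.2 ⟨g, rfl⟩
  change _ → ∑ a ∈ Finset.range n, ⁅emb (lin l ^ a), ⁅Y a, word l v₀ ω⁆ - ψ (Y a) • word l v₀ ω⁆ +
    _ ∈ _
  induction ω with
  | nil =>
    intro _
    have : ∀ a ∈ Finset.range n,
        ⁅emb (lin l ^ a), ⁅Y a, word l v₀ []⁆ - ψ (Y a) • word l v₀ []⁆ = 0 := by
      intro a ha
      rw [Finset.mem_range] at ha
      rw [word, hv₀ _ (polySubalgebra_lin_anti (by omega) (hY a)), sub_self, lie_zero]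
    rw [Finset.sum_eq_zero this]
    simp [weight]
  | cons b ω ih =>
    intro hω
    have hω' : ∀ a ∈ ω, a < n := fun a ha => hω a (List.mem_cons_of_mem _ ha)
    have hb : b < n := hω b List.mem_cons_self
    specialize ih hω'
    have hword : word l v₀ ω ∈ filt l n N v₀ (weight N ω) := word_mem_filt hω' le_rfl
    set v := word l v₀ ω with hv
    have hcons : word l v₀ (b :: ω) = ⁅emb (lin l ^ b), v⁆ := rfl
    have hw : weight N (b :: ω) = (N + 1 - 2 * b : ℤ) + weight N ω := rfl
    rw [hcons, hw]
    have hterm : ∀ a ∈ Finset.range n,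
        ⁅emb (lin l ^ a), ⁅⁅Y a, emb (lin l ^ b)⁆, v⁆⁆ +
          (if a = b then (c * l * evalAt l g * (N + 1 - 2 * b)) • ⁅emb (lin l ^ b), v⁆ else 0) ∈
            filt l n N v₀ ((N + 1 - 2 * b : ℤ) + weight N ω - 1) := by
      intro a ha
      rw [Finset.mem_range] at ha
      have hθ : theta (Y a) = lin l ^ ((N - a) + 1) * g := by
        rw [show N - a + 1 = N + 1 - a by omega]; rfl
      have hmem := lie_mem_polySubalgebra_lin (mem_polySubalgebra_lin.2 ⟨g, hθ⟩) b
      -- For a < b the bracket lies beyond the power N and has no scalar. For a = b the scalar is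
      -- the contribution to be counted. For a > b a scalar may occur, but it leaves the letter a in
      -- place of the heavier letter b.
      rcases lt_trichotomy a b with hab | rfl | hab
      · rw [if_neg hab.ne, add_zero]
        have h1 := H.lie_sub_mem hv₀ (by omega) hmem le_rfl hword
        rw [H.apply_eq_zero (by omega) hmem, zero_smul, sub_zero] at h1
        exact lie_mem_filt ha (by omega) h1
      · rw [if_pos rfl]
        have h1 := H.lie_sub_mem hv₀ (by omega) hmem le_rfl hword
        have h2 : ψ ⁅Y a, emb (lin l ^ a)⁆ = -(c * l * evalAt l g * (N + 1 - 2 * a)) := by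
          rw [H.apply_eq_top (h := ((a : ℂ) - ((N - a : ℕ) + 1)) • (T 1 * g) - lin l * euler g)
            (by rw [theta_lie_emb_lin_pow hθ, Nat.sub_add_cancel (by omega)]), map_sub, map_smul,
            evalAt_mul H.root_ne_zero, evalAt_mul H.root_ne_zero, evalAt_lin, evalAt_T,
            Nat.cast_sub (by omega), smul_eq_mul, zpow_one]
          ring
        rw [h2, neg_smul, sub_neg_eq_add] at h1
        rw [← lie_smul, ← lie_add]
        exact lie_mem_filt ha (by omega) h1
      · rw [if_neg hab.ne', add_zero]
        refine lie_mem_filt (d := weight N ω + (2 * (a - b) - 1)) ha (by omega) ?_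
        exact H.lie_mem hv₀ (by omega) hword _ _ hmem (by push_cast; omega)
    have hterm2 : ∀ a ∈ Finset.range n,
        ⁅⁅emb (lin l ^ a), emb (lin l ^ b)⁆, ⁅Y a, v⁆ - ψ (Y a) • v⁆ ∈
            filt l n N v₀ ((N + 1 - 2 * b : ℤ) + weight N ω - 1) := by
      intro a ha
      rw [Finset.mem_range] at ha
      have h1 := H.lie_sub_mem hv₀ (by omega) (hY a) le_rfl hword
      exact H.lie_mem hv₀ (by omega) h1 _ _ (lie_lin_pow_mem l a b) (by omega)
    have hsplit : ∀ a, ⁅emb (lin l ^ a), ⁅Y a, ⁅emb (lin l ^ b), v⁆⁆ -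
        ψ (Y a) • ⁅emb (lin l ^ b), v⁆⁆ =
          ⁅emb (lin l ^ b), ⁅emb (lin l ^ a), ⁅Y a, v⁆ - ψ (Y a) • v⁆⁆ +
            ⁅⁅emb (lin l ^ a), emb (lin l ^ b)⁆, ⁅Y a, v⁆ - ψ (Y a) • v⁆ +
            ⁅emb (lin l ^ a), ⁅⁅Y a, emb (lin l ^ b)⁆, v⁆⁆ := by
      intro a
      have e1 : ⁅Y a, ⁅emb (lin l ^ b), v⁆⁆ - ψ (Y a) • ⁅emb (lin l ^ b), v⁆ =
          ⁅emb (lin l ^ b), ⁅Y a, v⁆ - ψ (Y a) • v⁆ + ⁅⁅Y a, emb (lin l ^ b)⁆, v⁆ := by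
        rw [lie_sub, lie_smul, leibniz_lie (Y a)]; abel
      rw [e1, lie_add, leibniz_lie (emb (lin l ^ a))]
      abel
    have hsum := add_mem (add_mem (lie_mem_filt hb (e := (N + 1 - 2 * b : ℤ) + weight N ω - 1)
      (by omega) ih) (Submodule.sum_mem _ hterm2)) (Submodule.sum_mem _ hterm)
    convert hsum using 1
    rw [Finset.sum_congr rfl fun a _ => hsplit a]
    simp only [Finset.sum_add_distrib, Finset.sum_ite_eq', Finset.mem_range, hb, if_true, lie_add,
      lie_sum, lie_smul]
    push_cast
    rw [mul_add, add_smul]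
    abel

end Filtration

section LowestCase

variable {V : Type*} [AddCommGroup V] [Module ℂ V] [LieRingModule Virasoro V]
  [LieModule ℂ Virasoro V] {l c : ℂ} {v₀ : V} {ψ : Virasoro →ₗ[ℂ] ℂ} (H : HasTopDegree l 1 1 c ψ)
  (hv₀ : ∀ x ∈ polySubalgebra ((X - C l) ^ 1), ⁅x, v₀⁆ = ψ x • v₀)

include H hv₀

theorem HasTopDegree.lie_replicate_eq_zero {j k : ℕ} (hjk : j < k) {x : Virasoro}
    (hx : x ∈ polySubalgebra ((X - C l) ^ (k + 1))) :
    ⁅x, word l v₀ (List.replicate j 0)⁆ = 0 := by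
  have h1 := H.lie_word_sub_mem hv₀ (List.replicate j 0)
    (by intro a ha; rw [List.eq_of_mem_replicate ha]; exact one_pos) (k + 1) (by omega) x hx
  rw [H.apply_eq_zero (by omega) hx, zero_smul, sub_zero, weight_replicate,
    H.filt_of_neg (v₀ := v₀) (by push_cast; omega)] at h1
  exact (Submodule.mem_bot ℂ).1 h1

/-- For n = N = 1 the only letter is 1. Commuting past it lowers the power of t - l from j + 1 to j
with the leading factor -(j + 1) l; these factors multiply up until the power 1, where ψ gives the
scalar c. -/
theorem HasTopDegree.lie_replicate (k : ℕ) : ∀ (x : Virasoro) (h : ℂ[T;T⁻¹]),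
    theta x = lin l ^ (k + 1) * h → ⁅x, word l v₀ (List.replicate k 0)⁆ =
      ((-l) ^ k * (k + 1).factorial * c * evalAt l h) • v₀ := by
  induction k with
  | zero =>
    intro x h hx
    have h1 : ⁅x, v₀⁆ = ψ x • v₀ := hv₀ x (mem_polySubalgebra_lin.2 ⟨h, hx⟩)
    rw [List.replicate_zero, word, h1, H.apply_eq_top hx]
    simp
  | succ k ih =>
    intro x h hx
    rw [List.replicate_succ, word, leibniz_lie,
      H.lie_replicate_eq_zero hv₀ k.lt_succ_self (mem_polySubalgebra_lin.2 ⟨h, hx⟩), lie_zero,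
      add_zero, ih _ _ (by rw [theta_lie_emb_lin_pow hx 0, add_zero]), map_sub, map_smul,
      evalAt_mul H.root_ne_zero, evalAt_mul H.root_ne_zero, evalAt_lin, evalAt_T,
      Nat.factorial_succ (k + 1)]
    congr 1
    push_cast
    rw [smul_eq_mul, zpow_one]
    ring

end LowestCase

end Virasoro

end

/-! ### Lowering operators and simplicity of Ind χ ⊗ M. -/

noncomputable section

namespace Virasoro

open LaurentPolynomial (T)
open Polynomial (toLaurent X C)
open LieAlgebra (LieCharacter)
open LieSubalgebra (Ind)

attribute [local instance] LieRing.ofAssociativeRing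

section Lowering

variable {V : Type*} [AddCommGroup V] [Module ℂ V] [LieRingModule Virasoro V]
  [LieModule ℂ Virasoro V] {l c : ℂ} {n N : ℕ} {v₀ : V} {ψ : Virasoro →ₗ[ℂ] ℂ}
  (H : HasTopDegree l n N c ψ)
  (hv₀ : ∀ x ∈ polySubalgebra ((X - C l) ^ n), ⁅x, v₀⁆ = ψ x • v₀)

/-- The operators on `V` given by elements of the ideal generated by `g`, up to scalars, which
decrease the filtration degree `d`. -/
def loweringOps (l : ℂ) (n N : ℕ) (v₀ : V) (g : Polynomial ℂ) (d : ℤ) : Set (Module.End ℂ V) :=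
  {Y | (∃ (h : Polynomial ℂ) (a : ℂ),
      Y = LieModule.toEnd ℂ Virasoro V (emb (toLaurent (g * h))) - a • 1) ∧
    ∀ v ∈ filt l n N v₀ d, Y v ∈ filt l n N v₀ (d - 1)}

include H hv₀

/-- In positive degree, no leading part is killed by all lowering operators: the left ideal they
generate contains a nonzero scalar modulo lower degree. It is the Euler operator for N ≥ 2; for N =
1 and d = 2k, it is multiplication by the kth power of the letter 1 after the map of
`lie_replicate`. -/
theorem HasTopDegree.exists_mem_span_loweringOps {g : Polynomial ℂ} (hg : g.eval l ≠ 0) {d : ℕ}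
    (hd : 0 < d) :
    ∃ E ∈ Ideal.span (loweringOps l n N v₀ g d), ∃ κ : ℂ, κ ≠ 0 ∧
      ∀ v ∈ filt l n N v₀ d, E v - κ • v ∈ filt l n N v₀ (d - 1) := by
  have hn := H.one_le
  have hnN := H.le
  have hn2 := H.two_mul_le
  have hpow : ∀ k, emb (lin l ^ k * toLaurent g) = emb (toLaurent (g * (X - C l) ^ k)) := by
    intro k
    rw [map_mul toLaurent, toLaurent_lin_pow, mul_comm]
  rcases Nat.lt_or_ge N 2 with hN | hN
  · obtain ⟨rfl, rfl⟩ : n = 1 ∧ N = 1 := by omega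
    rcases Nat.even_or_odd' d with ⟨k, rfl | rfl⟩
    · let x := emb (lin l ^ (k + 1) * toLaurent g)
      have hx : x ∈ polySubalgebra ((X - C l) ^ (k + 1)) := mem_polySubalgebra_lin.2 ⟨_, rfl⟩
      let κ := (-l) ^ k * (k + 1).factorial * c * evalAt l (toLaurent g)
      have hκ : κ ≠ 0 := by
        rw [show κ = (-l) ^ k * (k + 1).factorial * c * g.eval l by
          simp only [κ, evalAt_toLaurent]]
        exact mul_ne_zero (mul_ne_zero (mul_ne_zero (pow_ne_zero _ (neg_ne_zero.2 H.root_ne_zero))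
          (Nat.cast_ne_zero.2 (Nat.factorial_ne_zero _))) H.ne_zero) hg
      have hcase : ∀ ω : List ℕ, (∀ a ∈ ω, a < 1) → weight 1 ω ≤ ((2 * k : ℕ) : ℤ) →
          ω = List.replicate k 0 ∨ weight 1 ω ≤ ((2 * k : ℕ) : ℤ) - 1 ∧
            ⁅x, word l v₀ ω⁆ = 0 := by
        intro ω h1 h2
        have h3 := replicate_of_lt_one h1
        generalize ω.length = j at h3
        subst h3
        rw [weight_replicate] at h2 ⊢
        rcases Nat.lt_or_ge j k with h | h
        · exact Or.inr ⟨by push_cast; omega, H.lie_replicate_eq_zero hv₀ h hx⟩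
        · exact Or.inl (by rw [show j = k by push_cast at h2; omega])
      have hU : ∀ j : ℕ, ((LieModule.toEnd ℂ Virasoro V (emb (lin l ^ 0))) ^ j) v₀ =
          word l v₀ (List.replicate j 0) := by
        intro j
        induction j with
        | zero => rfl
        | succ j ih => rw [pow_succ', Module.End.mul_apply, ih]; rfl
      refine ⟨(LieModule.toEnd ℂ Virasoro V (emb (lin l ^ 0))) ^ k *
        LieModule.toEnd ℂ Virasoro V x, Ideal.mul_mem_left _ _ (Ideal.subset_span ⟨⟨_, 0, by
          rw [zero_smul, sub_zero, ← hpow]⟩, ?_⟩), κ, hκ, ?_⟩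
      · intro v hv
        refine (filt_induction ((filt l 1 1 v₀ (((2 * k : ℕ) : ℤ) - 1)).comap
          (LieModule.toEnd ℂ Virasoro V x)) fun ω h1 h2 => ?_) hv
        rw [Submodule.mem_comap, LieModule.toEnd_apply_apply]
        rcases hcase ω h1 h2 with rfl | ⟨-, h⟩
        · rw [H.lie_replicate hv₀ k x _ rfl]
          exact Submodule.smul_mem _ _ (word_mem_filt (ω := []) (by simp) (by
            rw [weight]; push_cast; omega))
        · rw [h]; exact zero_mem _
      · intro v hv
        refine (filt_induction ((filt l 1 1 v₀ (((2 * k : ℕ) : ℤ) - 1)).comap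
          ((LieModule.toEnd ℂ Virasoro V (emb (lin l ^ 0))) ^ k *
            LieModule.toEnd ℂ Virasoro V x - κ • 1)) fun ω h1 h2 => ?_) hv
        rw [Submodule.mem_comap, LinearMap.sub_apply, Module.End.mul_apply,
          LieModule.toEnd_apply_apply, LinearMap.smul_apply, Module.End.one_apply]
        rcases hcase ω h1 h2 with rfl | ⟨h3, h⟩
        · rw [H.lie_replicate hv₀ k x _ rfl, map_smul, hU, sub_self]
          exact zero_mem _
        · rw [h, map_zero, zero_sub]
          exact neg_mem (Submodule.smul_mem _ _ (word_mem_filt h1 h3))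
    -- For N = 1 all weights are even, so the graded piece of odd degree is zero and any scalar will
    -- do.
    · refine ⟨0, zero_mem _, 1, one_ne_zero, fun v hv => ?_⟩
      rw [LinearMap.zero_apply, zero_sub, one_smul]
      refine neg_mem ((filt_induction _ fun ω h1 h2 => ?_) hv)
      refine word_mem_filt h1 ?_
      have h3 := replicate_of_lt_one h1
      generalize ω.length = j at h3
      subst h3
      rw [weight_replicate] at h2 ⊢
      push_cast at h2 ⊢
      omega
  · let Y : ℕ → Virasoro := fun a => emb (lin l ^ (N + 1 - a) * toLaurent g)
    have hY : ∀ a, Y a ∈ polySubalgebra ((X - C l) ^ (N + 1 - a)) := fun a =>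
      mem_polySubalgebra_lin.2 ⟨_, rfl⟩
    let Y' : ℕ → Module.End ℂ V := fun a =>
      LieModule.toEnd ℂ Virasoro V (Y a) - ψ (Y a) • 1
    let E : Module.End ℂ V := ∑ a ∈ Finset.range n,
      LieModule.toEnd ℂ Virasoro V (emb (lin l ^ a)) * Y' a
    let κ := c * l * evalAt l (toLaurent g)
    have hκ : κ ≠ 0 := by
      rw [show κ = c * l * g.eval l by simp only [κ, evalAt_toLaurent]]
      exact mul_ne_zero (mul_ne_zero H.ne_zero H.root_ne_zero) hg
    refine ⟨E, Submodule.sum_mem _ fun a ha => Ideal.mul_mem_left _ _ (Ideal.subset_span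
      ⟨⟨_, ψ (Y a), by rw [← hpow]⟩, fun v hv => ?_⟩), -(κ * d),
      neg_ne_zero.2 (mul_ne_zero hκ (Nat.cast_ne_zero.2 hd.ne')), fun v hv => ?_⟩
    · rw [Finset.mem_range] at ha
      exact H.lie_sub_mem hv₀ (by omega) (hY a) (by omega) hv
    · refine (filt_induction ((filt l n N v₀ ((d : ℤ) - 1)).comap (E - (-(κ * d)) • 1))
        fun ω h1 h2 => ?_) hv
      have h3 := H.euler_word hv₀ hN (toLaurent g) ω h1
      have hE : E (word l v₀ ω) = ∑ a ∈ Finset.range n, ⁅emb (lin l ^ a),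
          ⁅emb (lin l ^ (N + 1 - a) * toLaurent g), word l v₀ ω⁆ -
            ψ (emb (lin l ^ (N + 1 - a) * toLaurent g)) • word l v₀ ω⁆ := by
        simp only [E, LinearMap.sum_apply]
        rfl
      rw [← hE] at h3
      have e : (E - (-(κ * d)) • (1 : Module.End ℂ V)) (word l v₀ ω) =
          (E (word l v₀ ω) + (κ * weight N ω) • word l v₀ ω) +
            (κ * (d - weight N ω)) • word l v₀ ω := by
        rw [LinearMap.sub_apply, LinearMap.smul_apply, Module.End.one_apply, neg_smul,
          sub_neg_eq_add, add_assoc, ← add_smul]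
        congr 2; ring
      rw [Submodule.mem_comap, e]
      refine add_mem (filt_mono (by omega) h3) ?_
      rcases h2.lt_or_eq with h4 | h4
      · exact Submodule.smul_mem _ _ (word_mem_filt h1 (by omega))
      · have : (d : ℂ) - weight N ω = 0 := by rw [h4]; simp
        rw [this, mul_zero, zero_smul]
        exact zero_mem _

omit H hv₀

variable {M : Type*} [AddCommGroup M] [Module ℂ M] [LieRingModule Virasoro M]
  [LieModule ℂ Virasoro M]

/-- The vectors annihilated by the elements `emb (g h)`, for polynomials `h`. -/
def annihilated (M : Type*) [AddCommGroup M] [Module ℂ M] [LieRingModule Virasoro M]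
    [LieModule ℂ Virasoro M] (g : Polynomial ℂ) : Submodule ℂ M where
  carrier := {m | ∀ h : Polynomial ℂ, ⁅emb (toLaurent (g * h)), m⁆ = 0}
  add_mem' {m m'} hm hm' h := by rw [lie_add, hm, hm', add_zero]
  zero_mem' h := lie_zero _
  smul_mem' a m hm h := by rw [lie_smul, hm, smul_zero]

theorem annihilated_mono {g g' : Polynomial ℂ} (h : g ∣ g') :
    annihilated M g ≤ annihilated M g' := by
  obtain ⟨r, rfl⟩ := h
  intro m hm h
  rw [mul_assoc]
  exact hm _

omit [LieRingModule Virasoro V] [LieModule ℂ Virasoro V] [LieRingModule Virasoro M]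
  [LieModule ℂ Virasoro M] in
theorem rTensor_mem_map₂ {F F' : Submodule ℂ V} {Z : Module.End ℂ V} (h : ∀ v ∈ F, Z v ∈ F')
    {K : Submodule ℂ M} {t : V ⊗[ℂ] M} (ht : t ∈ Submodule.map₂ (TensorProduct.mk ℂ V M) F K) :
    Z.rTensor M t ∈ Submodule.map₂ (TensorProduct.mk ℂ V M) F' K := by
  have hle : Submodule.map₂ (TensorProduct.mk ℂ V M) F K ≤
      (Submodule.map₂ (TensorProduct.mk ℂ V M) F' K).comap (Z.rTensor M) :=
    Submodule.map₂_le.2 fun v hv m hm => Submodule.apply_mem_map₂ _ (h v hv) hm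
  exact hle ht

theorem rTensor_toEnd_eq {g : Polynomial ℂ} {t : V ⊗[ℂ] M}
    (ht : t ∈ Submodule.map₂ (TensorProduct.mk ℂ V M) ⊤ (annihilated M g)) (h : Polynomial ℂ) :
    (LieModule.toEnd ℂ Virasoro V (emb (toLaurent (g * h)))).rTensor M t =
      ⁅emb (toLaurent (g * h)), t⁆ := by
  have hle : Submodule.map₂ (TensorProduct.mk ℂ V M) ⊤ (annihilated M g) ≤
      LinearMap.eqLocus ((LieModule.toEnd ℂ Virasoro V (emb (toLaurent (g * h)))).rTensor M)
        (LieModule.toEnd ℂ Virasoro (V ⊗[ℂ] M) (emb (toLaurent (g * h)))) := by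
    refine Submodule.map₂_le.2 fun v _ m hm => ?_
    rw [LinearMap.mem_eqLocus, TensorProduct.mk_apply, LinearMap.rTensor_tmul,
      LieModule.toEnd_apply_apply, LieModule.toEnd_apply_apply,
      TensorProduct.LieModule.lie_tmul_right, hm h, TensorProduct.tmul_zero, add_zero]
  exact hle ht

include H hv₀ in
-- Since g ℂ[t] kills the right-hand components, a lowering operator applied to the left factor is
-- the action of an element of Vir minus a scalar, so it preserves W. Either some lowering operator
-- gives a nonzero vector of smaller degree, or all kill t; then so does their left ideal, and t
-- itself has smaller degree.
theorem HasTopDegree.exists_tmul_mem {g : Polynomial ℂ} (hg : g.eval l ≠ 0)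
    (W : LieSubmodule ℂ Virasoro (V ⊗[ℂ] M)) (d : ℕ) : ∀ t ∈ W, t ≠ 0 →
      t ∈ Submodule.map₂ (TensorProduct.mk ℂ V M) (filt l n N v₀ d) (annihilated M g) →
      ∃ m ∈ annihilated M g, v₀ ⊗ₜ[ℂ] m ∈ W ∧ v₀ ⊗ₜ[ℂ] m ≠ 0 := by
  induction d with
  | zero =>
    intro t htW ht0 ht
    have h1 := Submodule.map₂_le_map₂_left (f := TensorProduct.mk ℂ V M) (q := annihilated M g)
      (H.filt_zero_le (v₀ := v₀)) ht
    rw [Submodule.map₂_span_singleton_eq_map, Submodule.mem_map] at h1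
    obtain ⟨m, hm, rfl⟩ := h1
    exact ⟨m, hm, htW, ht0⟩
  | succ d ih =>
    intro t htW ht0 ht
    obtain ⟨E, hE, κ, hκ, hEκ⟩ := H.exists_mem_span_loweringOps hv₀ hg d.succ_pos
    by_cases hY : ∀ Y ∈ loweringOps l n N v₀ g (d + 1 : ℕ), Y.rTensor M t = 0
    · have hEt : E.rTensor M t = 0 := by
        clear hEκ
        induction hE using Submodule.span_induction with
        | mem Y h => exact hY Y h
        | zero => rw [LinearMap.rTensor_zero, LinearMap.zero_apply]
        | add A B _ _ hA hB => rw [LinearMap.rTensor_add, LinearMap.add_apply, hA, hB, add_zero]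
        | smul A B _ hB =>
          rw [smul_eq_mul, LinearMap.rTensor_mul, Module.End.mul_apply, hB, map_zero]
      have h1 := rTensor_mem_map₂ (Z := E - κ • 1) (fun v hv => hEκ v hv) ht
      rw [LinearMap.rTensor_sub, LinearMap.sub_apply, hEt, LinearMap.rTensor_smul, zero_sub,
        neg_mem_iff, LinearMap.smul_apply, Module.End.one_eq_id, LinearMap.rTensor_id,
        LinearMap.id_apply, Submodule.smul_mem_iff _ hκ] at h1
      refine ih t htW ht0 ?_
      convert h1 using 3
      push_cast; ring
    · push Not at hY
      obtain ⟨Y, hY, hYt⟩ := hY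
      have h1 := rTensor_mem_map₂ hY.2 ht
      have ht' := Submodule.map₂_le_map₂_left (f := TensorProduct.mk ℂ V M)
        (q := annihilated M g) le_top ht
      refine ih (Y.rTensor M t) ?_ hYt ?_
      · obtain ⟨⟨h, a, rfl⟩, -⟩ := hY
        rw [LinearMap.rTensor_sub, LinearMap.sub_apply, rTensor_toEnd_eq ht', LinearMap.rTensor_smul,
          LinearMap.smul_apply, Module.End.one_eq_id, LinearMap.rTensor_id, LinearMap.id_apply]
        exact sub_mem (W.lie_mem htW) (W.smul_mem _ htW)
      · convert h1 using 3
        push_cast; ring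

end Lowering

/-- Every vector is annihilated by the elements `emb (g h)`, for all polynomials `h`, where `g` is
some polynomial that does not vanish at `l`. -/
def SmoothAt (l : ℂ) (M : Type*) [AddCommGroup M] [Module ℂ M] [LieRingModule Virasoro M]
    [LieModule ℂ Virasoro M] : Prop :=
  ∀ m : M, ∃ g : Polynomial ℂ, g.eval l ≠ 0 ∧ m ∈ annihilated M g

/-- Once gen ⊗ m lies in W, the annihilator of m acts on the left factor alone. It contains g ℂ[t],
so together with Vir^((t-l)^n) it spans Vir, and it generates Ind χ ⊗ m. The vectors m with Ind χ ⊗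
m ⊆ W form a submodule of the simple module M. -/
theorem isIrreducible_tensor_of_hasTopDegree {l c : ℂ} {n N : ℕ} {ψ : Virasoro →ₗ[ℂ] ℂ}
    (H : HasTopDegree l n N c ψ)
    (hψ : ∀ x ∈ polySubalgebra ((X - C l) ^ n), ∀ y ∈ polySubalgebra ((X - C l) ^ n),
      ψ ⁅x, y⁆ = 0)
    {M : Type*} [AddCommGroup M] [Module ℂ M] [LieRingModule Virasoro M] [LieModule ℂ Virasoro M]
    (hM : LieModule.IsIrreducible ℂ Virasoro M) (hl : SmoothAt l M) :
    LieModule.IsIrreducible ℂ Virasoro (Ind (characterOf _ ψ hψ) ⊗[ℂ] M) := by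
  set χ := characterOf _ ψ hψ with hχ
  have hv₀ : ∀ x ∈ polySubalgebra ((X - C l) ^ n), ⁅x, Ind.gen χ⁆ = ψ x • Ind.gen χ :=
    fun x hx => Ind.lie_gen χ ⟨x, hx⟩
  have hgen : ∀ P : Submodule ℂ (Ind χ), Ind.gen χ ∈ P →
      (∀ (x : Virasoro), ∀ w ∈ P, ⁅x, w⁆ ∈ P) → P = ⊤ := fun P h1 h2 =>
    Ind.induction_gen_of_sup_eq_top ⊤ (by simp) χ h1 fun x _ => h2 x
  have hexh : ∀ t : Ind χ ⊗[ℂ] M, ∃ (g : Polynomial ℂ) (d : ℕ), g.eval l ≠ 0 ∧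
      t ∈ Submodule.map₂ (TensorProduct.mk ℂ (Ind χ) M) (filt l n N (Ind.gen χ) d)
        (annihilated M g) := by
    intro t
    induction t with
    | zero => exact ⟨1, 0, by simp, zero_mem _⟩
    | tmul v m =>
      obtain ⟨g, hg, hm⟩ := hl m
      obtain ⟨d, hd⟩ := H.exists_mem_filt hv₀ v hgen
      exact ⟨g, d, hg, Submodule.apply_mem_map₂ _ hd hm⟩
    | add s t hs ht =>
      obtain ⟨g, d, hg, hs⟩ := hs
      obtain ⟨g', d', hg', ht⟩ := ht
      refine ⟨g * g', max d d', by rw [Polynomial.eval_mul]; exact mul_ne_zero hg hg', add_mem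
        (Submodule.map₂_le_map₂ (filt_mono (by push_cast; omega))
          (annihilated_mono (dvd_mul_right _ _)) hs)
        (Submodule.map₂_le_map₂ (filt_mono (by push_cast; omega))
          (annihilated_mono (dvd_mul_left _ _)) ht)⟩
  have := LieModule.nontrivial_of_isIrreducible ℂ Virasoro M
  have hne : Nontrivial (Ind χ) := ⟨Ind.gen χ, 0, Ind.gen_ne_zero χ⟩
  refine LieModule.IsIrreducible.mk fun W hW => ?_
  obtain ⟨t, htW, ht0⟩ : ∃ t ∈ W, t ≠ 0 := by
    by_contra! h
    exact hW ((LieSubmodule.eq_bot_iff W).2 h)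
  obtain ⟨g, d, hg, ht⟩ := hexh t
  obtain ⟨m, hm, hmW, hm0⟩ := H.exists_tmul_mem hv₀ hg W d t htW ht0 ht
  have hm0' : m ≠ 0 := by rintro rfl; exact hm0 (TensorProduct.tmul_zero _ _)
  let K : LieSubalgebra ℂ Virasoro :=
    { carrier := {x | ⁅x, m⁆ = 0}
      add_mem' := fun {x y} hx hy => by
        rw [Set.mem_ofPred_eq] at *
        rw [add_lie, hx, hy, add_zero]
      zero_mem' := zero_lie _
      smul_mem' := fun a x hx => by
        rw [Set.mem_ofPred_eq] at *
        rw [smul_lie, hx, smul_zero]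
      lie_mem' := fun {x y} hx hy => by
        have hx' : ⁅x, m⁆ = 0 := hx
        have hy' : ⁅y, m⁆ = 0 := hy
        change ⁅⁅x, y⁆, m⁆ = 0
        rw [lie_lie, hx', hy', lie_zero, lie_zero, sub_zero] }
  have hK : (polySubalgebra ((X - C l) ^ n)).toSubmodule ⊔ K.toSubmodule = ⊤ := by
    rw [eq_top_iff]
    intro x _
    have hcop : IsCoprime g ((X - C l) ^ n) :=
      (((Polynomial.irreducible_X_sub_C l).coprime_iff_not_dvd).2 (by
        rwa [Polynomial.dvd_iff_isRoot])).symm.pow_right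
    have hX : IsCoprime X ((X - C l) ^ n) :=
      (((Polynomial.irreducible_X_sub_C l).coprime_iff_not_dvd).2 (by
        rw [Polynomial.dvd_iff_isRoot, Polynomial.IsRoot, Polynomial.eval_X]
        exact H.root_ne_zero)).symm.pow_right
    obtain ⟨q, r, h⟩ := exists_eq_toLaurent_add hcop hX 0 (theta x)
    rw [LaurentPolynomial.T_zero, one_mul] at h
    rw [← emb_theta_add x, h, map_add, add_assoc, add_comm]
    exact Submodule.add_mem_sup (add_mem (emb_mem_polySubalgebra _ r)
      ((polySubalgebra _).smul_mem _ (z_mem_polySubalgebra _))) (hm q)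
  have h1 : ∀ v, v ⊗ₜ m ∈ W := by
    intro v
    have : W.toSubmodule.comap ((TensorProduct.mk ℂ (Ind χ) M).flip m) = ⊤ := by
      refine Ind.induction_gen_of_sup_eq_top K hK χ hmW fun x hx v hv => ?_
      have h2 := W.lie_mem (x := x) hv
      have h3 : ⁅x, m⁆ = 0 := hx
      rw [LinearMap.flip_apply, TensorProduct.mk_apply, TensorProduct.LieModule.lie_tmul_right, h3,
        TensorProduct.tmul_zero, add_zero] at h2
      exact h2
    exact (this ▸ Submodule.mem_top : v ∈ Submodule.comap _ _)
  let P : LieSubmodule ℂ Virasoro M :=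
    { carrier := {m | ∀ v : Ind χ, v ⊗ₜ[ℂ] m ∈ W}
      add_mem' := fun {m m'} hm hm' v => by
        rw [TensorProduct.tmul_add]; exact add_mem (hm v) (hm' v)
      zero_mem' := fun v => by rw [TensorProduct.tmul_zero]; exact zero_mem _
      smul_mem' := fun a m hm v => by rw [TensorProduct.tmul_smul]; exact W.smul_mem _ (hm v)
      lie_mem := fun {x m} hm v => by
        have h3 := W.lie_mem (x := x) (hm v)
        rw [TensorProduct.LieModule.lie_tmul_right] at h3
        exact (add_mem_cancel_left (hm _)).1 h3 }
  have hP : P = ⊤ := (IsSimpleOrder.eq_bot_or_eq_top P).resolve_left fun h => by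
    have h4 : m ∈ P := h1
    rw [h] at h4
    exact hm0' h4
  rw [eq_top_iff]
  intro t _
  induction t with
  | zero => exact zero_mem _
  | tmul v m =>
    have : m ∈ P := hP ▸ LieSubmodule.mem_top _
    exact this v
  | add s t hs ht => exact add_mem (hs trivial) (ht trivial)

end Virasoro

end

/-! ### Sufficiency of large degree: splitting off the roots of f. -/

noncomputable section

attribute [local instance] LieRing.ofAssociativeRing

theorem LieModule.IsIrreducible.of_equiv {R L M N : Type*} [CommRing R] [LieRing L] [LieAlgebra R L]
    [AddCommGroup M] [Module R M] [LieRingModule L M] [LieModule R L M]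
    [AddCommGroup N] [Module R N] [LieRingModule L N] [LieModule R L N]
    (e : M ≃ₗ⁅R,L⁆ N) (h : LieModule.IsIrreducible R L M) : LieModule.IsIrreducible R L N :=
  (LieSubmodule.orderIsoMapComap e).isSimpleOrder_iff.1 h

namespace Virasoro

open LaurentPolynomial (T)
open Polynomial (toLaurent X C)
open LieAlgebra (LieCharacter)
open LieSubalgebra (Ind addCharacter)

theorem hasTopDegree_of_isAssociated {l : ℂ} {n : ℕ} {ψ : Virasoro →ₗ[ℂ] ℂ} {p : Polynomial ℂ}
    (hl : l ≠ 0) (hn : 1 ≤ n)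
    (h : ∀ x ∈ polySubalgebra ((X - C l) ^ n), ∀ y ∈ polySubalgebra ((X - C l) ^ n), ψ ⁅x, y⁆ = 0)
    (hp : IsAssociated (characterOf _ ψ h) p) (hp0 : p ≠ 0) (hd : n ≤ p.natDegree + 2) :
    HasTopDegree l n (n + p.natDegree)
      (p.leadingCoeff * (p.natDegree.factorial * l ^ p.natDegree)) ψ where
  root_ne_zero := hl
  one_le := hn
  le := Nat.le_add_right _ _
  two_mul_le := by omega
  ne_zero := mul_ne_zero (Polynomial.leadingCoeff_ne_zero.2 hp0)
    (mul_ne_zero (Nat.cast_ne_zero.2 (Nat.factorial_ne_zero _)) (pow_ne_zero _ hl))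
  apply_z := by
    refine (eq_zero_of_lie_eq_zero ?_ h).1
    rw [Polynomial.coeff_zero_eq_eval_zero, Polynomial.eval_pow]
    exact pow_ne_zero _ (by simpa using hl)
  apply_top g := by
    rw [pow_add, mul_assoc, (isAssociated_characterOf h).1 hp, assocForm_natDegree hl]
  apply_of_lt k hk g := by
    obtain ⟨j, rfl⟩ := Nat.exists_eq_add_of_lt hk
    rw [show n + p.natDegree + j + 1 = n + (p.natDegree + j + 1) by ring, pow_add, mul_assoc,
      (isAssociated_characterOf h).1 hp, assocForm_of_natDegree_lt hl (by omega)]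

theorem cocycle_eq_zero_of_pos {j k : ℤ} (hjk : 0 < j + k) (p q : Polynomial ℂ) :
    cocycle (T j * toLaurent p) (T k * toLaurent q) = 0 := by
  induction p, q using toLaurent_induction₂ with
  | add_left p q s hp hq =>
    rw [map_add, mul_add, map_add, LinearMap.add_apply, hp, hq, add_zero]
  | add_right p q s hp hq => rw [map_add, mul_add, map_add, hp, hq, add_zero]
  | smul_left c p q h =>
    rw [toLaurent_smul, mul_smul_comm, map_smul, LinearMap.smul_apply, h, smul_zero]
  | smul_right c p q h => rw [toLaurent_smul, mul_smul_comm, map_smul, h, smul_zero]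
  | mono i l =>
    rw [toLaurent_X_pow, toLaurent_X_pow, ← LaurentPolynomial.T_add, ← LaurentPolynomial.T_add,
      cocycle_T, if_neg (by omega)]

/-- Differentiating g² leaves one factor g. The power of t clears the negative exponents of x, which
keeps the bracket polynomial and the cocycle zero. This carries smoothness from v to [x, v]. -/
theorem exists_lie_emb_eq (g : Polynomial ℂ) (x : Virasoro) :
    ∃ J : ℕ, ∀ h, ∃ q, ⁅emb (toLaurent (g ^ 2 * X ^ J * h)), x⁆ = emb (toLaurent (g * q)) := by
  obtain ⟨K, p, hp⟩ := LaurentPolynomial.exists_T_pow (theta x)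
  have hx : theta x = T (-K) * toLaurent p := by
    rw [hp, mul_comm, mul_assoc, ← LaurentPolynomial.T_add, add_neg_cancel,
      LaurentPolynomial.T_zero, mul_one]
  have h1 : (T (K : ℤ) : ℂ[T;T⁻¹]) * T (-K) = 1 := by rw [← LaurentPolynomial.T_add]; simp
  refine ⟨K + 1, fun h => ?_⟩
  have hA : toLaurent (g ^ 2 * X ^ (K + 1) * h) = T (K + 1 : ℤ) * toLaurent (g ^ 2 * h) := by
    rw [mul_right_comm, mul_comm, map_mul, toLaurent_X_pow]; push_cast; rfl
  have hc : cocycle (toLaurent (g ^ 2 * X ^ (K + 1) * h)) (theta x) = 0 := by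
    rw [hA, hx, cocycle_eq_zero_of_pos (by omega)]
  refine ⟨X * (g * h * (X * Polynomial.derivative p - ((2 * K + 1 : ℕ) : Polynomial ℂ) * p) -
    X * p * (2 * Polynomial.derivative g * h + g * Polynomial.derivative h)), ?_⟩
  rw [lie_eq, theta_emb, hc, zero_smul, add_zero, hA, hx, wittBracket, euler_mul, euler_mul,
    euler_T, euler_T, euler_toLaurent, euler_toLaurent]
  congr 1
  simp only [map_mul, map_sub, map_add, map_natCast, map_pow, Polynomial.toLaurent_X,
    Polynomial.derivative_mul, Polynomial.derivative_pow, LaurentPolynomial.smul_eq_C_mul,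
    LaurentPolynomial.T_add]
  push_cast
  simp only [map_add, map_natCast, map_neg, map_one, map_ofNat, pow_one]
  linear_combination (toLaurent g * T 1 * (toLaurent g * toLaurent h * (T 1 * toLaurent
    (Polynomial.derivative p) - (2 * (K : ℂ[T;T⁻¹]) + 1) * toLaurent p) - T 1 * toLaurent p *
    (2 * toLaurent (Polynomial.derivative g) * toLaurent h + toLaurent g * toLaurent
      (Polynomial.derivative h)))) * h1

theorem smoothAt_ind {l : ℂ} (hl : l ≠ 0) {H : LieSubalgebra ℂ Virasoro} (χ : LieCharacter ℂ H)
    {g : Polynomial ℂ} (hg : g.eval l ≠ 0) (hgen : Ind.gen χ ∈ annihilated (Ind χ) g) :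
    SmoothAt l (Ind χ) := by
  intro w
  induction w using Ind.induction_gen with
  | gen => exact ⟨g, hg, hgen⟩
  | add v w hv hw =>
    obtain ⟨g, hg, hv⟩ := hv
    obtain ⟨g', hg', hw⟩ := hw
    exact ⟨g * g', by rw [Polynomial.eval_mul]; exact mul_ne_zero hg hg',
      add_mem (annihilated_mono (dvd_mul_right _ _) hv) (annihilated_mono (dvd_mul_left _ _) hw)⟩
  | smul c v hv =>
    obtain ⟨g, hg, hv⟩ := hv
    exact ⟨g, hg, Submodule.smul_mem _ _ hv⟩
  | lie x v hv =>
    obtain ⟨g, hg, hv⟩ := hv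
    obtain ⟨J, hJ⟩ := exists_lie_emb_eq g x
    refine ⟨g ^ 2 * X ^ J, by simp [hg, hl], fun h => ?_⟩
    obtain ⟨q, hq⟩ := hJ h
    rw [leibniz_lie, hq, hv q, zero_add,
      show g ^ 2 * X ^ J * h = g * (g * X ^ J * h) by ring, hv, lie_zero]

theorem smoothAt_ind_restricted {l : ℂ} (hl : l ≠ 0) {f : Polynomial ℂ} (hf : f.eval l ≠ 0) {m : ℤ}
    {hm : -1 ≤ m} (χ : LieCharacter ℂ (restrictedSubalgebra f m hm)) : SmoothAt l (Ind χ) := by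
  obtain ⟨ψ, hψ, rfl⟩ := exists_eq_characterOf χ
  -- The character kills t^(2m+1) f² ℂ[t]; the exponent is raised to 2m + 2 because 2m + 1 is
  -- negative for m = -1.
  refine smoothAt_ind hl _ (g := f ^ 2 * X ^ (2 * m + 2).toNat) (by simp [hf, hl]) fun h => ?_
  have h1 : toLaurent (f ^ 2 * X ^ (2 * m + 2).toNat * h) =
      T (2 * m + 1) * toLaurent (f ^ 2 * (X * h)) := by
    rw [map_mul, map_mul, toLaurent_X_pow, Int.toNat_of_nonneg (by omega), map_mul, map_mul,
      Polynomial.toLaurent_X, show 2 * m + 2 = 2 * m + 1 + 1 by ring,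
      LaurentPolynomial.T_add (2 * m + 1) 1]
    ring
  rw [h1]
  have h2 : emb (T (2 * m + 1) * toLaurent (f ^ 2 * (X * h))) ∈ restrictedSubalgebra f m hm := by
    rw [pow_two, mul_assoc]
    exact emb_mem_restricted (by omega) _
  refine (Ind.lie_gen (characterOf _ ψ hψ) ⟨_, h2⟩).trans ?_
  rw [characterOf_apply, eq_zero_of_lie_eq_zero_upper hψ, zero_smul]

theorem isIrreducible_ind_congr {A A' : LieSubalgebra ℂ Virasoro} {ψ ψ' : Virasoro →ₗ[ℂ] ℂ}
    {h : ∀ x ∈ A, ∀ y ∈ A, ψ ⁅x, y⁆ = 0} (h' : ∀ x ∈ A', ∀ y ∈ A', ψ' ⁅x, y⁆ = 0)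
    (hA : A = A') (hψ : ψ = ψ') (H : LieModule.IsIrreducible ℂ Virasoro (Ind (characterOf A ψ h))) :
    LieModule.IsIrreducible ℂ Virasoro (Ind (characterOf A' ψ' h')) := by
  subst hA hψ
  exact H

theorem polySubalgebra_mul {f g : Polynomial ℂ} (h : IsCoprime f g) :
    polySubalgebra (f * g) = polySubalgebra f ⊓ polySubalgebra g := by
  refine le_antisymm (le_inf (polySubalgebra_le (dvd_mul_right _ _))
    (polySubalgebra_le (dvd_mul_left _ _))) fun x hx => ?_
  have h1 := hx.1
  have h2 := hx.2
  change _ ∈ polySubalgebra _ at h1 h2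
  rw [mem_polySubalgebra, Ideal.mem_span_singleton] at *
  rw [map_mul]
  exact (h.map toLaurent).mul_dvd h1 h2

theorem isCoprime_X_sub_C_pow {l : ℂ} {g : Polynomial ℂ} (hg : g.eval l ≠ 0) (n : ℕ) :
    IsCoprime g ((X - C l) ^ n) :=
  (((Polynomial.irreducible_X_sub_C l).coprime_iff_not_dvd).2 (by
    rwa [Polynomial.dvd_iff_isRoot])).symm.pow_right

theorem polySubalgebra_sup_restrictedSubalgebra {f g : Polynomial ℂ} (h : IsCoprime g f)
    (hf : f.coeff 0 ≠ 0) (m : ℤ) (hm : -1 ≤ m) :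
    (polySubalgebra f).toSubmodule ⊔ (restrictedSubalgebra g m hm).toSubmodule = ⊤ := by
  rw [eq_top_iff]
  intro x _
  obtain ⟨q, r, hx⟩ := exists_eq_toLaurent_add h (isCoprime_X hf) m (theta x)
  rw [← emb_theta_add x, hx, map_add, add_assoc, add_comm]
  exact Submodule.add_mem_sup (add_mem (emb_mem_polySubalgebra _ r)
    ((polySubalgebra _).smul_mem _ (z_mem_polySubalgebra _))) (emb_mem_restricted le_rfl q)

theorem add_lie_eq_zero {A B : LieSubalgebra ℂ Virasoro} {φ ψ : Virasoro →ₗ[ℂ] ℂ}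
    (h : ∀ x ∈ A, ∀ y ∈ A, φ ⁅x, y⁆ = 0) (h' : ∀ x ∈ B, ∀ y ∈ B, ψ ⁅x, y⁆ = 0) :
    ∀ x ∈ A ⊓ B, ∀ y ∈ A ⊓ B, (φ + ψ) ⁅x, y⁆ = 0 := fun x hx y hy => by
  rw [LinearMap.add_apply, h x hx.1 y hy.1, h' x hx.2 y hy.2, add_zero]

theorem addCharacter_characterOf {A B : LieSubalgebra ℂ Virasoro} {φ ψ : Virasoro →ₗ[ℂ] ℂ}
    (h : ∀ x ∈ A, ∀ y ∈ A, φ ⁅x, y⁆ = 0) (h' : ∀ x ∈ B, ∀ y ∈ B, ψ ⁅x, y⁆ = 0) :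
    addCharacter (characterOf A φ h) (characterOf B ψ h') =
      characterOf (A ⊓ B) (φ + ψ) (add_lie_eq_zero h h') := rfl

theorem sum_lie_eq_zero {n : ℂ → ℕ} {ψ : ℂ → Virasoro →ₗ[ℂ] ℂ}
    (hψ : ∀ l, ∀ x ∈ polySubalgebra ((X - C l) ^ n l), ∀ y ∈ polySubalgebra ((X - C l) ^ n l),
      ψ l ⁅x, y⁆ = 0) {S : Finset ℂ} {f : Polynomial ℂ} (hf : ∀ l ∈ S, (X - C l) ^ n l ∣ f) :
    ∀ x ∈ polySubalgebra f, ∀ y ∈ polySubalgebra f, (∑ l ∈ S, ψ l) ⁅x, y⁆ = 0 := by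
  intro x hx y hy
  rw [LinearMap.sum_apply]
  exact Finset.sum_eq_zero fun l hl => hψ l x (polySubalgebra_le (hf l hl) hx) y
    (polySubalgebra_le (hf l hl) hy)

/-- Let g be the product over the roots already treated. A new root a has g(a) ≠ 0, so Vir is the
sum of Vir^((t-a)^n) and 𝔟_m^g, the Mackey statement splits off the factor at a, and the remaining
module is smooth at a. -/
theorem isIrreducible_ind_sum {m : ℤ} {hm : -1 ≤ m} {φ : Virasoro →ₗ[ℂ] ℂ}
    (hφ : ∀ x ∈ upperSubalgebra m hm, ∀ y ∈ upperSubalgebra m hm, φ ⁅x, y⁆ = 0)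
    (hirr : LieModule.IsIrreducible ℂ Virasoro (Ind (characterOf _ φ hφ)))
    {n N : ℂ → ℕ} {c : ℂ → ℂ} {ψ : ℂ → Virasoro →ₗ[ℂ] ℂ}
    (hψ : ∀ l, ∀ x ∈ polySubalgebra ((X - C l) ^ n l), ∀ y ∈ polySubalgebra ((X - C l) ^ n l),
      ψ l ⁅x, y⁆ = 0)
    (S : Finset ℂ) (H : ∀ l ∈ S, HasTopDegree l (n l) (N l) (c l) (ψ l))
    (h : ∀ x ∈ restrictedSubalgebra (∏ l ∈ S, (X - C l) ^ n l) m hm,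
      ∀ y ∈ restrictedSubalgebra (∏ l ∈ S, (X - C l) ^ n l) m hm,
        (∑ l ∈ S, ψ l + φ) ⁅x, y⁆ = 0) :
    LieModule.IsIrreducible ℂ Virasoro (Ind (characterOf _ (∑ l ∈ S, ψ l + φ) h)) := by
  induction S using Finset.induction_on with
  | empty =>
    refine isIrreducible_ind_congr h ?_ (by simp) hirr
    rw [Finset.prod_empty, restrictedSubalgebra, polySubalgebra_one, top_inf_eq]
  | insert a S ha ih =>
    have H' : ∀ l ∈ S, HasTopDegree l (n l) (N l) (c l) (ψ l) := fun l hl =>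
      H l (Finset.mem_insert_of_mem hl)
    have Ha := H a (Finset.mem_insert_self a S)
    have h' : ∀ x ∈ restrictedSubalgebra (∏ l ∈ S, (X - C l) ^ n l) m hm,
      ∀ y ∈ restrictedSubalgebra (∏ l ∈ S, (X - C l) ^ n l) m hm,
        (∑ l ∈ S, ψ l + φ) ⁅x, y⁆ = 0 :=
      add_lie_eq_zero (sum_lie_eq_zero hψ fun l hl => Finset.dvd_prod_of_mem _ hl) hφ
    have hroot : (∏ l ∈ S, (X - C l) ^ n l).eval a ≠ 0 := by
      rw [Polynomial.eval_prod, Finset.prod_ne_zero_iff]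
      intro l hl
      rw [Polynomial.eval_pow]
      refine pow_ne_zero _ ?_
      rw [Polynomial.eval_sub, Polynomial.eval_X, Polynomial.eval_C, sub_ne_zero]
      rintro rfl
      exact ha hl
    have hcop := isCoprime_X_sub_C_pow hroot (n a)
    have hcoeff : ((X - C a) ^ n a).coeff 0 ≠ 0 := by
      rw [Polynomial.coeff_zero_eq_eval_zero, Polynomial.eval_pow]
      exact pow_ne_zero _ (by simpa using Ha.root_ne_zero)
    obtain ⟨e⟩ := Ind.nonempty_equiv_tensor
      (polySubalgebra_sup_restrictedSubalgebra hcop hcoeff m hm)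
      (characterOf _ (ψ a) (hψ a)) (characterOf _ _ h')
    have h1 := isIrreducible_tensor_of_hasTopDegree Ha (hψ a) (ih H' h')
      (smoothAt_ind_restricted Ha.root_ne_zero hroot _)
    have h2 := h1.of_equiv e.symm
    rw [addCharacter_characterOf] at h2
    refine isIrreducible_ind_congr h ?_ ?_ h2
    · rw [Finset.prod_insert ha, restrictedSubalgebra, restrictedSubalgebra,
        polySubalgebra_mul hcop.symm, inf_assoc]
    · rw [Finset.sum_insert ha, add_assoc]

theorem prod_X_sub_C_pow_rootMultiplicity {f : Polynomial ℂ} (hf : f.Monic) :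
    ∏ l ∈ f.roots.toFinset, (X - C l) ^ f.rootMultiplicity l = f := by
  rw [← Polynomial.prod_multiset_root_eq_finset_root]
  exact ((IsAlgClosed.splits f).eq_prod_roots_of_monic hf).symm

theorem HasLargeDegree.isIrreducible_ind {f : Polynomial ℂ} (hf : f.Monic) (hf0 : f.coeff 0 ≠ 0)
    {m : ℤ} {hm : -1 ≤ m} {α : LieCharacter ℂ (polySubalgebra f)} (hα : HasLargeDegree α)
    {β : LieCharacter ℂ (upperSubalgebra m hm)}
    (hβ : LieModule.IsIrreducible ℂ Virasoro (Ind β)) :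
    LieModule.IsIrreducible ℂ Virasoro (Ind (addCharacter α β)) := by
  obtain ⟨ν, p, hsum, hp⟩ := hα
  obtain ⟨φ, hφ, rfl⟩ := exists_eq_characterOf β
  choose ψ hψ hν using fun l => exists_eq_characterOf (ν l)
  have H : ∀ l ∈ f.roots.toFinset, HasTopDegree l (f.rootMultiplicity l)
      (f.rootMultiplicity l + (p l).natDegree)
      ((p l).leadingCoeff * ((p l).natDegree.factorial * l ^ (p l).natDegree)) (ψ l) := by
    intro l hl
    obtain ⟨h1, h2, h3⟩ := hp l hl
    have h4 := (Polynomial.mem_roots hf.ne_zero).1 (Multiset.mem_toFinset.1 hl)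
    refine hasTopDegree_of_isAssociated ?_
      (Nat.one_le_iff_ne_zero.2 ((Polynomial.rootMultiplicity_pos hf.ne_zero).2 h4).ne') (hψ l)
      (hν l ▸ h1) h2 h3
    rintro rfl
    rw [Polynomial.coeff_zero_eq_eval_zero] at hf0
    exact hf0 h4
  have h := sum_lie_eq_zero hψ (S := f.roots.toFinset) fun l _ => f.pow_rootMultiplicity_dvd l
  have hα : α = characterOf _ _ h := LieHom.ext fun x => by
    rw [hsum, characterOf_apply, LinearMap.sum_apply]
    exact Finset.sum_congr rfl fun l _ => by
      rw [hν, characterOf_apply, LieSubalgebra.coe_inclusion]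
  have h' := prod_X_sub_C_pow_rootMultiplicity hf
  rw [hα, addCharacter_characterOf]
  refine isIrreducible_ind_congr _ (by rw [h']) rfl
    (isIrreducible_ind_sum hφ hβ hψ f.roots.toFinset H ?_)
  rw [h']
  exact add_lie_eq_zero h hφ

end Virasoro

end

/-! ### Necessity of large degree. -/

noncomputable section

attribute [local instance] LieRing.ofAssociativeRing

open LieAlgebra (LieCharacter)

theorem TensorProduct.eq_zero_of_tmul_eq_zero {k V M : Type*} [Field k] [AddCommGroup V]
    [Module k V] [AddCommGroup M] [Module k M] {v : V} {m : M} (h : v ⊗ₜ[k] m = 0) :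
    v = 0 ∨ m = 0 := by
  refine or_iff_not_imp_left.2 fun hv => ?_
  have h1 : ¬∀ f : Module.Dual k V, f v = 0 := fun h => hv
    ((Module.forall_dual_apply_eq_zero_iff k v).1 h)
  push Not at h1
  obtain ⟨f, hf⟩ := h1
  have h2 := congrArg (TensorProduct.lid k M ∘ LinearMap.rTensor M f) h
  rw [Function.comp_apply, LinearMap.rTensor_tmul, TensorProduct.lid_tmul, Function.comp_apply,
    map_zero, map_zero] at h2
  exact (smul_eq_zero.1 h2).resolve_left hf

section Tensor

variable {k L : Type*} [Field k] [LieRing L] [LieAlgebra k L]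
  {V M V' M' : Type*} [AddCommGroup V] [Module k V] [LieRingModule L V] [LieModule k L V]
  [AddCommGroup M] [Module k M] [LieRingModule L M] [LieModule k L M]
  [AddCommGroup V'] [Module k V'] [LieRingModule L V'] [LieModule k L V']
  [AddCommGroup M'] [Module k M'] [LieRingModule L M'] [LieModule k L M']

/-- The kernel of φ ⊗ ψ is zero or everything. It is applied to a quotient map of M, and to the map
from Ind α to the module induced from an extension of α. -/
theorem LieModule.IsIrreducible.tmul_eq_zero_or (h : LieModule.IsIrreducible k L (V ⊗[k] M))
    (φ : V →ₗ⁅k, L⁆ V') (ψ : M →ₗ⁅k, L⁆ M') :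
    (∀ v m, φ v ⊗ₜ[k] ψ m = 0) ∨ ∀ v m, φ v ⊗ₜ[k] ψ m = 0 → v ⊗ₜ[k] m = 0 := by
  rcases h.eq_bot_or_eq_top (TensorProduct.LieModule.map φ ψ).ker with h | h
  · refine Or.inr fun v m hvm => (LieSubmodule.eq_bot_iff _).1 h _ ?_
    rwa [LieModuleHom.mem_ker, TensorProduct.LieModule.map_tmul]
  · refine Or.inl fun v m => ?_
    have : v ⊗ₜ[k] m ∈ (TensorProduct.LieModule.map φ ψ).ker := h ▸ LieSubmodule.mem_top _
    rwa [LieModuleHom.mem_ker, TensorProduct.LieModule.map_tmul] at this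

theorem LieModule.IsIrreducible.exists_tmul_ne_zero
    (h : LieModule.IsIrreducible k L (V ⊗[k] M)) : ∃ (v : V) (m : M), v ≠ 0 ∧ m ≠ 0 := by
  by_contra! h1
  have := LieModule.nontrivial_of_isIrreducible k L (V ⊗[k] M)
  obtain ⟨t, ht⟩ := exists_ne (0 : V ⊗[k] M)
  refine ht (TensorProduct.induction_on (motive := fun t => t = 0) t rfl (fun v m => ?_)
    fun s t hs ht => by rw [hs, ht, add_zero])
  by_cases hv : v = 0
  · rw [hv, TensorProduct.zero_tmul]
  · rw [h1 v m hv, TensorProduct.tmul_zero]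

theorem LieModule.IsIrreducible.right_of_tensor (h : LieModule.IsIrreducible k L (V ⊗[k] M)) :
    LieModule.IsIrreducible k L M := by
  obtain ⟨v, m, hv, hm⟩ := h.exists_tmul_ne_zero
  have : Nontrivial M := ⟨m, 0, hm⟩
  refine LieModule.IsIrreducible.mk fun W hW => ?_
  rcases h.tmul_eq_zero_or LieModuleHom.id (LieSubmodule.Quotient.mk' W) with h1 | h1
  · rw [eq_top_iff]
    intro w _
    rw [← LieSubmodule.Quotient.mk_eq_zero W]
    exact (TensorProduct.eq_zero_of_tmul_eq_zero (h1 v w)).resolve_left hv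
  · refine absurd ((LieSubmodule.eq_bot_iff W).2 fun w hw => ?_) hW
    refine (TensorProduct.eq_zero_of_tmul_eq_zero (h1 v w ?_)).resolve_left hv
    rw [(LieSubmodule.Quotient.mk_eq_zero W).2 hw, TensorProduct.tmul_zero]

open LieSubalgebra in
/-- If the tensor product with the module induced from a character is irreducible, then the
character does not extend to a larger subalgebra. -/
theorem LieModule.IsIrreducible.le_of_extends {A A' : LieSubalgebra k L} (hA : A ≤ A')
    {α : LieCharacter k A} (h : LieModule.IsIrreducible k L (Ind α ⊗[k] M))
    (α' : LieCharacter k A') (hα : ∀ x : A, α' (inclusion hA x) = α x) : A' ≤ A := by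
  intro x hx
  obtain ⟨φ, hφ⟩ := Ind.exists_hom (χ := α) (Ind.gen α') fun y => by
    rw [← hα]; exact Ind.lie_gen α' (inclusion hA y)
  obtain ⟨-, m, -, hm⟩ := h.exists_tmul_ne_zero
  rcases h.tmul_eq_zero_or φ (LieModuleHom.id : M →ₗ⁅k, L⁆ M) with h1 | h1
  · rcases TensorProduct.eq_zero_of_tmul_eq_zero (h1 (Ind.gen α) m) with h2 | h2
    · exact absurd (hφ.symm.trans h2) (Ind.gen_ne_zero α')
    · exact absurd h2 hm
  -- If nothing is lost, the relation x gen = α'(x) gen, valid in the image, already holds in Ind α,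
  -- which forces x ∈ A.
  · refine Ind.mem_of_lie_gen_eq_smul α (c := α' ⟨x, hx⟩) (sub_eq_zero.1 ?_)
    refine (TensorProduct.eq_zero_of_tmul_eq_zero (h1 _ m ?_)).resolve_right hm
    rw [map_sub, map_smul, LieModuleHom.map_lie, hφ, Ind.lie_gen α' ⟨x, hx⟩, sub_self,
      TensorProduct.zero_tmul]

end Tensor

namespace Virasoro

open LaurentPolynomial (T)
open Polynomial (toLaurent X C)
open LieSubalgebra (Ind addCharacter)

section NonVanishing

variable {M : Type*} [AddCommGroup M] [Module ℂ M] [LieRingModule Virasoro M]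
  [LieModule ℂ Virasoro M] {f : Polynomial ℂ} {φ : Virasoro →ₗ[ℂ] ℂ}
  {hφ : ∀ x ∈ polySubalgebra f, ∀ y ∈ polySubalgebra f, φ ⁅x, y⁆ = 0}

/-- If φ killed ⟨f⟩ ∩ ⟨f'²⟩, it could be extended by zero on ⟨f'²⟩ to a character of Vir^(f'), which
is larger than Vir^f since f' ∉ ⟨f⟩. -/
theorem exists_apply_sq_ne_zero {f' : Polynomial ℂ} {l : ℂ} (hl : l ≠ 0)
    (hf : f = f' * (X - C l)) (hf0 : f.coeff 0 ≠ 0)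
    (h : LieModule.IsIrreducible ℂ Virasoro (Ind (characterOf (polySubalgebra f) φ hφ) ⊗[ℂ] M)) :
    ∃ a b, toLaurent f' ^ 2 * a = toLaurent f * b ∧ φ (emb (toLaurent f * b)) ≠ 0 := by
  by_contra! h1
  have hz := (eq_zero_of_lie_eq_zero hf0 hφ).1
  obtain ⟨ψ, hψ, hψ0⟩ := Submodule.exists_extend_of_eq_zero (polySubalgebra f).toSubmodule
    (polySubalgebra (f' ^ 2)).toSubmodule φ (by
      intro x hx hx'
      obtain ⟨b, hb⟩ := mem_polySubalgebra_iff.1 hx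
      obtain ⟨a, ha⟩ := mem_polySubalgebra_iff.1 hx'
      rw [map_pow] at ha
      rw [← emb_theta_add x, map_add, map_smul, hz, smul_zero, add_zero, hb]
      exact h1 a b (ha.symm.trans hb))
  have hψ' : ∀ x ∈ polySubalgebra f', ∀ y ∈ polySubalgebra f', ψ ⁅x, y⁆ = 0 :=
    lie_eq_zero_of_eq_zero (hψ0 _ (z_mem_polySubalgebra _)) fun g => hψ0 _ (by
      rw [← map_pow]; exact emb_mem_polySubalgebra _ _)
  have hle : polySubalgebra f ≤ polySubalgebra f' := polySubalgebra_le (hf ▸ dvd_mul_right _ _)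
  have h2 := h.le_of_extends hle (characterOf _ ψ hψ') (fun x => by
    rw [characterOf_apply, characterOf_apply, LieSubalgebra.coe_inclusion]; exact hψ x x.2)
    (emb_mem_polySubalgebra f' 1)
  obtain ⟨b, hb⟩ := mem_polySubalgebra_iff.1 h2
  have hf'0 : toLaurent f' ≠ 0 := by
    rw [Polynomial.toLaurent_ne_zero]
    rintro rfl
    simp [hf] at hf0
  rw [theta_emb, hf, map_mul, mul_assoc] at hb
  have h3 := congrArg (evalAt l) (mul_left_cancel₀ hf'0 hb)
  change _ = evalAt l (lin l * b) at h3
  rw [evalAt_mul hl, evalAt_lin, evalAt_one, zero_mul] at h3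
  exact one_ne_zero h3

theorem exists_apply_ne_zero {g : Polynomial ℂ} {l : ℂ} {n : ℕ} (hl : l ≠ 0) (hn : 1 ≤ n)
    (hf : f = g * (X - C l) ^ n) (hg : g.eval l ≠ 0) (hf0 : f.coeff 0 ≠ 0)
    (h : LieModule.IsIrreducible ℂ Virasoro (Ind (characterOf (polySubalgebra f) φ hφ) ⊗[ℂ] M)) :
    ∃ a, φ (emb (toLaurent f * (toLaurent g * (lin l ^ (n - 2) * a)))) ≠ 0 := by
  obtain ⟨n, rfl⟩ := Nat.exists_eq_add_of_le' hn
  obtain ⟨a, b, hab, hb⟩ := exists_apply_sq_ne_zero (f' := g * (X - C l) ^ n) hl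
    (by rw [hf, pow_succ, mul_assoc]) hf0 h
  have hf' : toLaurent f = toLaurent g * lin l ^ (n + 1) := by
    rw [hf, map_mul, toLaurent_lin_pow]
  have hg0 : toLaurent g ≠ 0 := by
    rw [Polynomial.toLaurent_ne_zero]
    rintro rfl
    simp at hg
  have hl0 : lin l ≠ 0 := by
    rw [lin, Polynomial.toLaurent_ne_zero]; exact Polynomial.X_sub_C_ne_zero l
  rw [map_mul, toLaurent_lin_pow] at hab
  -- With n now one less than the multiplicity, f'² = f g (t-l)^(n-1) for n ≥ 1. For n = 0 the
  -- truncated exponent is 0, and g a = (t-l) b forces g to divide b, by a Bézout relation.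
  rcases n with _ | n
  · have h1 : toLaurent g * a = lin l * b := by
      refine mul_left_cancel₀ hg0 ?_
      rw [hf'] at hab
      linear_combination hab
    obtain ⟨u, v, huv⟩ := (isCoprime_X_sub_C_pow hg 1).map toLaurent
    rw [pow_one] at huv
    change u * _ + v * lin l = 1 at huv
    refine ⟨u * b + v * a, ?_⟩
    convert hb using 4
    rw [Nat.zero_add, Nat.sub_eq_zero_of_le (by norm_num : 1 ≤ 2), pow_zero]
    linear_combination b * huv + v * h1
  · refine ⟨a, ?_⟩
    have h2 : toLaurent f * (toLaurent g * (lin l ^ (n + 1 + 1 - 2) * a)) =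
        toLaurent f * b := by
      rw [← hab, hf', show n + 1 + 1 - 2 = n by omega]
      ring
    rwa [h2]

end NonVanishing

/-- The cofactors g_l = f/(t-l)^(n_l) have no common root, so their squares generate the unit ideal.
If f = 1 the sum is empty and equal to 0, which is why the relation is stated modulo f². -/
theorem exists_partition {f : Polynomial ℂ} (hf : f.Monic) : ∃ g θ : ℂ → Polynomial ℂ,
    (∀ l ∈ f.roots.toFinset, f = g l * (X - C l) ^ f.rootMultiplicity l ∧ (g l).eval l ≠ 0) ∧
    (∀ l ∈ f.roots.toFinset, ∀ j ∈ f.roots.toFinset, j ≠ l → f ∣ g l * g j) ∧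
    f ^ 2 ∣ 1 - ∑ l ∈ f.roots.toFinset, θ l * g l ^ 2 := by
  set S := f.roots.toFinset with hS
  set s : ℂ → Polynomial ℂ := fun l => (X - C l) ^ f.rootMultiplicity l with hs
  have hprod : ∏ l ∈ S, s l = f := prod_X_sub_C_pow_rootMultiplicity hf
  have hg : ∀ l ∈ S, f = (∏ j ∈ S \ {l}, s j) * s l := fun l hl => by
    rw [← Finset.erase_eq, Finset.prod_erase_mul _ _ hl, hprod]
  have hcop : ∀ i j, i ≠ j → IsCoprime (s i) (s j) := fun i j hij =>
    (Polynomial.pairwise_coprime_X_sub_C Function.injective_id hij).pow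
  have hdvd : ∀ l, ∀ j ∈ S, j ≠ l → s j ∣ ∏ i ∈ S \ {l}, s i := fun l j hj hjl =>
    Finset.dvd_prod_of_mem _ (by simp [hj, hjl])
  have h1 : ∃ θ : ℂ → Polynomial ℂ, f ^ 2 ∣ 1 - ∑ l ∈ S, θ l * (∏ j ∈ S \ {l}, s j) ^ 2 := by
    rcases S.eq_empty_or_nonempty with h | h
    · refine ⟨0, ?_⟩
      rw [← hprod, h]
      simp
    · obtain ⟨θ, hθ⟩ := (exists_sum_eq_one_iff_pairwise_coprime (s := fun l => s l ^ 2) h).2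
        fun i j hij => (hcop i j (Subtype.coe_injective.ne hij)).pow
      simp only [Finset.prod_pow] at hθ
      exact ⟨θ, by rw [hθ, sub_self]; exact dvd_zero _⟩
  obtain ⟨θ, hθ⟩ := h1
  refine ⟨fun l => ∏ j ∈ S \ {l}, s j, θ, fun l hl => ⟨hg l hl, ?_⟩, fun l hl j hj hjl => ?_, hθ⟩
  · rw [Polynomial.eval_prod, Finset.prod_ne_zero_iff]
    intro j hj
    rw [Finset.mem_sdiff, Finset.mem_singleton] at hj
    rw [Polynomial.eval_pow, Polynomial.eval_sub, Polynomial.eval_X, Polynomial.eval_C]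
    exact pow_ne_zero _ (sub_ne_zero.2 (Ne.symm hj.2))
  · conv_lhs => rw [hg l hl]
    exact mul_dvd_mul_left _ (hdvd j l hl hjl.symm)

theorem exists_isAssociated {l : ℂ} (hl : l ≠ 0) (n : ℕ) (A : ℂ[T;T⁻¹] →ₗ[ℂ] ℂ)
    (hA : ∀ a, A (lin l ^ n * a) = 0) :
    ∃ (ν : LieCharacter ℂ (polySubalgebra ((X - C l) ^ n))) (p : Polynomial ℂ),
      A = assocForm l p ∧ IsAssociated ν p ∧ ∀ (x : polySubalgebra ((X - C l) ^ n)) a,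
        theta x = lin l ^ n * a → ν x = A a := by
  have hl0 : lin l ^ n ≠ 0 := by
    refine pow_ne_zero _ ?_
    rw [lin, Polynomial.toLaurent_ne_zero]; exact Polynomial.X_sub_C_ne_zero l
  -- A left inverse of multiplication by (t-l)^n extends the form (t-l)^n a ↦ A(a) to all of Vir;
  -- outside ⟨(t-l)^n⟩ its values are irrelevant.
  obtain ⟨L, hL⟩ := LinearMap.exists_leftInverse_of_injective
    (LinearMap.mulLeft ℂ (lin l ^ n)) (LinearMap.ker_eq_bot.2 (mul_right_injective₀ hl0))
  have hL' : ∀ a, L (lin l ^ n * a) = a := fun a => by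
    have := LinearMap.congr_fun hL a
    rwa [LinearMap.comp_apply, LinearMap.mulLeft_apply, LinearMap.id_apply] at this
  have hψ : ∀ x a, theta x = lin l ^ n * a → (A ∘ₗ L ∘ₗ theta) x = A a := fun x a hx => by
    rw [LinearMap.comp_apply, LinearMap.comp_apply, hx, hL']
  obtain ⟨p, hp⟩ := exists_eq_assocForm hl n A hA
  have h : ∀ x ∈ polySubalgebra ((X - C l) ^ n), ∀ y ∈ polySubalgebra ((X - C l) ^ n),
      (A ∘ₗ L ∘ₗ theta) ⁅x, y⁆ = 0 :=
    lie_eq_zero_of_eq_zero (by simp) fun a => by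
      rw [hψ _ (lin l ^ n * a) (by rw [theta_emb, toLaurent_lin_pow]; ring), hA]
  refine ⟨characterOf _ _ h, p, hp, (isAssociated_characterOf h).2 fun a => ?_, fun x a hx => ?_⟩
  · rw [hψ _ a (theta_emb _), hp]
  · rw [characterOf_apply, hψ x a hx]

/-- The local character at l is (t-l)^(n_l) a ↦ φ(f g_l θ_l a); on f a it takes the value φ(f θ_l
g_l² a), and these add up to φ(f a). An associated polynomial that is zero or of degree below n_l -
2 makes the local form vanish on ⟨(t-l)^(n_l - 2)⟩, which contradicts the nonvanishing of φ. -/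
theorem hasLargeDegree_of_forall {f : Polynomial ℂ} (hf : f.Monic) (hf0 : f.coeff 0 ≠ 0)
    {φ : Virasoro →ₗ[ℂ] ℂ}
    (hφ : ∀ x ∈ polySubalgebra f, ∀ y ∈ polySubalgebra f, φ ⁅x, y⁆ = 0)
    (h : ∀ l ∈ f.roots.toFinset, ∀ g : Polynomial ℂ,
      f = g * (X - C l) ^ f.rootMultiplicity l → g.eval l ≠ 0 →
      ∃ a, φ (emb (toLaurent f * (toLaurent g * (lin l ^ (f.rootMultiplicity l - 2) * a)))) ≠ 0) :
    HasLargeDegree (characterOf (polySubalgebra f) φ hφ) := by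
  obtain ⟨hz, hφ2⟩ := eq_zero_of_lie_eq_zero hf0 hφ
  obtain ⟨g, θ, hg, hgg, hθ⟩ := exists_partition hf
  have hc : ∀ {a b : ℂ[T;T⁻¹]}, φ (emb b) = 0 → a = b → φ (emb a) = 0 := fun h e => e ▸ h
  have key : ∀ l, ∃ (ν : LieCharacter ℂ (polySubalgebra ((X - C l) ^ f.rootMultiplicity l)))
      (p : Polynomial ℂ), l ∈ f.roots.toFinset →
      (IsAssociated ν p ∧ p ≠ 0 ∧ f.rootMultiplicity l ≤ p.natDegree + 2) ∧
      ∀ x : polySubalgebra f, ∀ a, theta x = toLaurent f * a →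
        ν (LieSubalgebra.inclusion (polySubalgebra_le (f.pow_rootMultiplicity_dvd l)) x) =
          φ (emb (toLaurent f * (toLaurent (θ l * g l ^ 2) * a))) := by
    intro l
    by_cases hl : l ∈ f.roots.toFinset
    swap
    · exact ⟨characterOf _ 0 fun _ _ _ _ => rfl, 0, fun h => absurd h hl⟩
    obtain ⟨hgl, hgl0⟩ := hg l hl
    have hl0 : l ≠ 0 := by
      rintro rfl
      rw [Polynomial.coeff_zero_eq_eval_zero] at hf0
      exact hf0 ((Polynomial.mem_roots hf.ne_zero).1 (Multiset.mem_toFinset.1 hl))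
    have hgl' : toLaurent f = toLaurent (g l) * lin l ^ f.rootMultiplicity l := by
      conv_lhs => rw [hgl]
      rw [map_mul, toLaurent_lin_pow]
    let A : ℂ[T;T⁻¹] →ₗ[ℂ] ℂ := φ ∘ₗ emb ∘ₗ LinearMap.mulLeft ℂ (toLaurent (f * (g l * θ l)))
    have hA : ∀ a, A a = φ (emb (toLaurent f * (toLaurent (g l) * toLaurent (θ l) * a))) :=
      fun a => by
        rw [← mul_assoc, ← map_mul, ← map_mul]; rfl
    have hA0 : ∀ a, A (lin l ^ f.rootMultiplicity l * a) = 0 := fun a => by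
      refine (hA _).trans (hc (hφ2 (toLaurent (θ l) * a)) ?_)
      linear_combination -(toLaurent f * toLaurent (θ l) * a) * hgl'
    obtain ⟨ν, p, hp, hνp, hν⟩ := exists_isAssociated hl0 (f.rootMultiplicity l) A hA0
    refine ⟨ν, p, fun _ => ⟨⟨hνp, ?_⟩, fun x a ha => ?_⟩⟩
    · by_contra hlow
      have hlow' : ∀ a, A (lin l ^ (f.rootMultiplicity l - 2) * a) = 0 := by
        intro a
        rw [hp]
        by_cases hp0 : p = 0
        · rw [hp0, show assocForm l 0 = 0 from linearMap_ext_T fun j => by simp [assocForm_T],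
            LinearMap.zero_apply]
        · refine assocForm_of_natDegree_lt hl0 ?_ a
          have := not_le.1 fun h => hlow ⟨hp0, h⟩
          omega
      obtain ⟨a, ha⟩ := h l hl (g l) hgl hgl0
      refine ha ?_
      obtain ⟨r, hr⟩ := hθ
      have hone : (1 : ℂ[T;T⁻¹]) = toLaurent f ^ 2 * toLaurent r +
          ∑ j ∈ f.roots.toFinset, toLaurent (θ j * g j ^ 2) := by
        rw [← map_sum, ← map_pow, ← map_mul, ← map_add, ← hr, sub_add_cancel, map_one]
      set b := toLaurent (g l) * (lin l ^ (f.rootMultiplicity l - 2) * a) with hb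
      rw [← one_mul (toLaurent f * b), hone, add_mul, map_add, map_add, mul_assoc, hφ2, zero_add,
        Finset.sum_mul, map_sum, map_sum]
      refine Finset.sum_eq_zero fun j hj => ?_
      -- The term j = l vanishes by the low degree of p. For j ≠ l, f divides g_l g_j, so the term
      -- lies in ⟨f²⟩.
      by_cases hjl : j = l
      · subst hjl
        refine hc ((hA _).symm.trans (hlow' (toLaurent (g j) ^ 2 * a))) ?_
        rw [hb, map_mul, map_pow]
        ring
      · obtain ⟨q, hq⟩ := hgg l hl j hj hjl
        have hq' := congrArg toLaurent hq
        rw [map_mul, map_mul] at hq'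
        refine hc (hφ2 (toLaurent q * toLaurent (θ j) * toLaurent (g j) *
          (lin l ^ (f.rootMultiplicity l - 2) * a))) ?_
        rw [hb, map_mul, map_pow]
        linear_combination (toLaurent (θ j) * toLaurent (g j) * toLaurent f *
          (lin l ^ (f.rootMultiplicity l - 2) * a)) * hq'
    · rw [hν _ (toLaurent (g l) * a) (by rw [LieSubalgebra.coe_inclusion, ha, hgl']; ring), hA,
        map_mul toLaurent, map_pow,
        show toLaurent (g l) * toLaurent (θ l) * (toLaurent (g l) * a) =
          toLaurent (θ l) * toLaurent (g l) ^ 2 * a by ring]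
  choose ν p hνp using key
  refine ⟨ν, p, fun x => ?_, fun l hl => (hνp l hl).1⟩
  obtain ⟨a, ha⟩ := mem_polySubalgebra_iff.1 x.2
  rw [Finset.sum_congr rfl fun l hl => (hνp l hl).2 x a ha, characterOf_apply, ← map_sum, ← map_sum,
    ← Finset.mul_sum, ← Finset.sum_mul, ← map_sum]
  conv_lhs => rw [← emb_theta_add (x : Virasoro)]
  rw [map_add, map_smul, hz, smul_zero, add_zero, ha, ← sub_eq_zero, ← map_sub, ← map_sub]
  obtain ⟨r, hr⟩ := hθ
  have hr' := congrArg toLaurent hr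
  rw [map_sub, map_one, map_mul, map_pow] at hr'
  refine hc (hφ2 (toLaurent f * toLaurent r * a)) ?_
  linear_combination (toLaurent f * a) * hr'

theorem hasLargeDegree_of_isIrreducible_tensor {f : Polynomial ℂ} (hf : f.Monic)
    (hf0 : f.coeff 0 ≠ 0) {M : Type*} [AddCommGroup M] [Module ℂ M] [LieRingModule Virasoro M]
    [LieModule ℂ Virasoro M] {α : LieCharacter ℂ (polySubalgebra f)}
    (h : LieModule.IsIrreducible ℂ Virasoro (Ind α ⊗[ℂ] M)) : HasLargeDegree α := by
  obtain ⟨φ, hφ, rfl⟩ := exists_eq_characterOf α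
  refine hasLargeDegree_of_forall hf hf0 hφ fun l hl g hg hgl => ?_
  have hroot := (Polynomial.mem_roots hf.ne_zero).1 (Multiset.mem_toFinset.1 hl)
  refine exists_apply_ne_zero ?_ ((Polynomial.rootMultiplicity_pos hf.ne_zero).2 hroot) hg hgl hf0 h
  rintro rfl
  rw [Polynomial.coeff_zero_eq_eval_zero] at hf0
  exact hf0 hroot

end Virasoro

end

theorem mainTheorem4 (f : Polynomial ℂ) (hf : f.Monic) (hf0 : f.coeff 0 ≠ 0)
    (m : ℤ) (hm : -1 ≤ m) :
    (∀ (α : LieAlgebra.LieCharacter ℂ (Virasoro.polySubalgebra f))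
        (β : LieAlgebra.LieCharacter ℂ (Virasoro.upperSubalgebra m hm)),
      Nonempty (LieSubalgebra.Ind (LieSubalgebra.addCharacter α β) ≃ₗ⁅ℂ, Virasoro⁆
        LieSubalgebra.Ind α ⊗[ℂ] LieSubalgebra.Ind β)) ∧
    ∀ μ : LieAlgebra.LieCharacter ℂ (Virasoro.restrictedSubalgebra f m hm),
      (∃! d : LieAlgebra.LieCharacter ℂ (Virasoro.polySubalgebra f) ×
          LieAlgebra.LieCharacter ℂ (Virasoro.upperSubalgebra m hm),
        μ = LieSubalgebra.addCharacter d.1 d.2) ∧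
      ∀ (α : LieAlgebra.LieCharacter ℂ (Virasoro.polySubalgebra f))
        (β : LieAlgebra.LieCharacter ℂ (Virasoro.upperSubalgebra m hm)),
        μ = LieSubalgebra.addCharacter α β →
          Nonempty (LieSubalgebra.Ind μ ≃ₗ⁅ℂ, Virasoro⁆
            LieSubalgebra.Ind α ⊗[ℂ] LieSubalgebra.Ind β) ∧
          (LieModule.IsIrreducible ℂ Virasoro (LieSubalgebra.Ind μ) ↔
            Virasoro.HasLargeDegreeRestricted μ ∧
              LieModule.IsIrreducible ℂ Virasoro (LieSubalgebra.Ind β)) := by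
  refine ⟨fun α β => LieSubalgebra.Ind.nonempty_equiv_tensor
    (Virasoro.polySubalgebra_sup_upperSubalgebra hf0) α β,
    fun μ => ⟨Virasoro.existsUnique_addCharacter hf0 μ, ?_⟩⟩
  rintro α β rfl
  have he := LieSubalgebra.Ind.nonempty_equiv_tensor
    (Virasoro.polySubalgebra_sup_upperSubalgebra hf0) α β
  refine ⟨he, fun h => ?_, ?_⟩
  · obtain ⟨e⟩ := he
    have h' := h.of_equiv e
    exact ⟨⟨α, β, rfl, Virasoro.hasLargeDegree_of_isIrreducible_tensor hf hf0 h'⟩,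
      h'.right_of_tensor⟩
  · rintro ⟨⟨α', β', h, hα'⟩, hβ⟩
    -- Large degree of μ refers to some decomposition; by uniqueness it is the given one.
    obtain ⟨rfl, rfl⟩ := Virasoro.addCharacter_injective hf0 h
    exact hα'.isIrreducible_ind hf hf0 hβ
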